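/- Let $(S_n)_{n\ge 0}$ be the simple random walk on $\mathbb Z^2$, let $\|\cdot\|$ be the Euclidean norm, and write $x\sim y$ if $\|x-y\|=1$. Let $$a(x)=\sum_{k=0}^\infty\big(\mathbb P_0[S_k=0]-\mathbb P_x[S_k=0]\big),\qquad x\in\mathbb Z^2,$$ be its potential kernel (the sum being the limit of the partial sums). The conditioned walk $(\widehat S_n)_{n\ge 0}$ is the Markov chain on $\mathbb Z^2\setminus\{0\}$ with transition probabilities $\widehat P(x,y)=\frac{a(y)}{4a(x)}$ if $x\sim y$, $x\ne 0$, and $\widehat P(x,y)=0$ otherwise. For $A\subset\mathbb Z^2\setminus\{0\}$ put $\widehat\tau_A=\min\{n\ge 0:\widehat S_n\in A\}$ and $\widehat\tau_A^+=\min\{n\ge 1:\widehat S_n\in A\}$ (with $\min\emptyset=\infty$), and for finite $A$ and $y\in A$ let $$\widehat{\mathrm{Es}}_A(y)=\mathbb P_y[\widehat\tau_A^+=\infty],\qquad \widehat{\mathrm{cap}}(A)=\sum_{z\in A}a^2(z)\,\widehat{\mathrm{Es}}_A(z),\qquad \widehat{\mathrm{hm}}_A(y)=\frac{a^2(y)\,\widehat{\mathrm{Es}}_A(y)}{\widehat{\mathrm{cap}}(A)}.$$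 Let also $\mathrm{dist}(x,A)=\inf_{y\in A}\|x-y\|$ and $\mathrm{diam}(A)=\sup_{y,z\in A}\|y-z\|$. Theorem. There is a universal constant $C$ such that the following holds. Let $A\subset\mathbb Z^2\setminus\{0\}$ be finite and let $x\in\mathbb Z^2\setminus\{0\}$, $x\notin A$, be such that $\mathrm{dist}(x,A)\ge 12(\mathrm{diam}(A)+1)$. Then for every $y\in A$ $$\mathbb P_x\big[\widehat S_{\widehat\tau_A}=y\;\big|\;\widehat\tau_A<\infty\big]=\widehat{\mathrm{hm}}_A(y)\,(1+\varepsilon)\qquad\text{for some real }\varepsilon\text{ with }|\varepsilon|\le C\,\frac{\mathrm{diam}(A)}{\mathrm{dist}(x,A)}.$$ -/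

import Mathlib

open MeasureTheory ProbabilityTheory Filter

noncomputable section

/-! ### Markov chains on a countable discrete state space -/

/-- The row `P x ·` of a real matrix `P`, as a measure: the mass of `{y}` is `P x y`. -/
def rowMeasure {S : Type*} [MeasurableSpace S] (P : S → S → ℝ) (x : S) : Measure S :=
  Measure.sum fun y => ENNReal.ofReal (P x y) • Measure.dirac y

open scoped Classical in
/-- The one-step kernel with transition probabilities `P x y`. A row that is not a probability
vector is replaced by the unit mass at `x`, so that the kernel is defined for every matrix; for the
two walks below this happens only at the state `0` of the conditioned walk, which is not in its
state space and is never reached from the other states. -/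
def stepKernel {S : Type*} [MeasurableSpace S] [Countable S] [DiscreteMeasurableSpace S]
    (P : S → S → ℝ) : Kernel S S where
  toFun x := if IsProbabilityMeasure (rowMeasure P x) then rowMeasure P x else Measure.dirac x
  measurable' := Measurable.of_discrete

open scoped Classical in
instance stepKernel_isMarkov {S : Type*} [MeasurableSpace S] [Countable S]
    [DiscreteMeasurableSpace S] (P : S → S → ℝ) : IsMarkovKernel (stepKernel P) where
  isProbabilityMeasure x := by
    change IsProbabilityMeasure (if IsProbabilityMeasure (rowMeasure P x) then rowMeasure P x
      else Measure.dirac x)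
    split_ifs with h
    · exact h
    · infer_instance

/-- The step at time `n`, as a kernel from the past `(ω 0, …, ω n)`: it depends on `ω n` only. -/
def historyKernel {S : Type*} [MeasurableSpace S] [Countable S] [DiscreteMeasurableSpace S]
    (P : S → S → ℝ) (n : ℕ) : Kernel (Finset.Iic n → S) S :=
  (stepKernel P).comap (fun h => h ⟨n, Finset.mem_Iic.2 le_rfl⟩) (measurable_pi_apply _)

instance historyKernel_isMarkov {S : Type*} [MeasurableSpace S] [Countable S]
    [DiscreteMeasurableSpace S] (P : S → S → ℝ) (n : ℕ) : IsMarkovKernel (historyKernel P n) := by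
  unfold historyKernel
  infer_instance

/-- The law `ℙ_x`, on the space of trajectories `ω : ℕ → S`, of the Markov chain with transition
matrix `P` started at `x`; the chain itself is the coordinate process. -/
def chainLaw {S : Type*} [MeasurableSpace S] [Countable S] [DiscreteMeasurableSpace S]
    (P : S → S → ℝ) (x : S) : Measure (ℕ → S) :=
  Kernel.traj (X := fun _ => S) (historyKernel P) 0 (fun _ => x)

/-- The coordinate process. -/
def coord {S : Type*} (n : ℕ) (ω : ℕ → S) : S := ω n

/-- The entrance time `min {n ≥ 0 : ω n ∈ A}` (`⊤` if there is no such `n`). -/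
def entranceTime {S : Type*} (A : Set S) : (ℕ → S) → WithTop ℕ :=
  hittingAfter coord A 0

/-- The hitting time `min {n ≥ 1 : ω n ∈ A}` (`⊤` if there is no such `n`). -/
def hittingTime {S : Type*} (A : Set S) : (ℕ → S) → WithTop ℕ :=
  hittingAfter coord A 1

/-! ### Simple random walk, its potential kernel, and the conditioned walk -/

/-- Nearest neighbours in `ℤ²`. -/
def Nbr (x y : ℤ × ℤ) : Prop := |x.1 - y.1| + |x.2 - y.2| = 1

open scoped Classical in
/-- Transition matrix of the simple random walk on `ℤ²`. -/
def srwMatrix (x y : ℤ × ℤ) : ℝ := if Nbr x y then 1 / 4 else 0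

/-- The potential kernel `a(x) = ∑_{k ≥ 0} (ℙ_0[S_k = 0] - ℙ_x[S_k = 0])`. The series converges
only conditionally, so its sum is the limit of the partial sums. -/
def potentialKernel (x : ℤ × ℤ) : ℝ :=
  limUnder atTop fun n : ℕ => ∑ k ∈ Finset.range n,
    ((chainLaw srwMatrix 0).real {ω | ω k = 0} - (chainLaw srwMatrix x).real {ω | ω k = 0})

open scoped Classical in
/-- Transition matrix of the conditioned walk, the Doob transform of the simple random walk by
the potential kernel. -/
def condMatrix (x y : ℤ × ℤ) : ℝ :=
  if Nbr x y ∧ x ≠ 0 then potentialKernel y / (4 * potentialKernel x) else 0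

/-- The law of the conditioned walk started at `x`. -/
def condWalk (x : ℤ × ℤ) : Measure (ℕ → ℤ × ℤ) := chainLaw condMatrix x

open scoped Classical in
/-- Escape probability from `x ∈ A` for the conditioned walk (and `0` if `x ∉ A`). -/
def condEs (A : Finset (ℤ × ℤ)) (x : ℤ × ℤ) : ℝ :=
  if x ∈ A then (condWalk x).real {ω | hittingTime (A : Set (ℤ × ℤ)) ω = ⊤} else 0

/-- Capacity with respect to the conditioned walk. -/
def condCap (A : Finset (ℤ × ℤ)) : ℝ := ∑ y ∈ A, potentialKernel y ^ 2 * condEs A y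

/-- Harmonic measure with respect to the conditioned walk. -/
def condHm (A : Finset (ℤ × ℤ)) (y : ℤ × ℤ) : ℝ :=
  potentialKernel y ^ 2 * condEs A y / condCap A

/-- `ℙ_x[Ŝ_τ = y ∣ τ < ∞]`, with `τ` the entrance time of the conditioned walk into `A`. -/
def condEntrance (A : Finset (ℤ × ℤ)) (x y : ℤ × ℤ) : ℝ :=
  ((condWalk x)[|{ω | entranceTime (A : Set (ℤ × ℤ)) ω < ⊤}]).real
    {ω | stoppedValue coord (entranceTime (A : Set (ℤ × ℤ))) ω = y}

/-! ### Euclidean distances in `ℤ²` -/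

/-- The inclusion of `ℤ²` in the Euclidean plane. -/
def toPlane (x : ℤ × ℤ) : EuclideanSpace ℝ (Fin 2) := !₂[(x.1 : ℝ), (x.2 : ℝ)]

/-- `dist(x, A) = inf_{y ∈ A} ‖x - y‖`. -/
def latticeDist (x : ℤ × ℤ) (A : Finset (ℤ × ℤ)) : ℝ :=
  Metric.infDist (toPlane x) (toPlane '' (A : Set (ℤ × ℤ)))

/-- `diam(A) = sup_{x, y ∈ A} ‖x - y‖`. -/
def latticeDiam (A : Finset (ℤ × ℤ)) : ℝ :=
  Metric.diam (toPlane '' (A : Set (ℤ × ℤ)))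

end

/-! Multiplication by the potential kernel a undoes the Doob transform. The function h_y(x) = a(x)
P̂_x[enter A at y] / a(y) (`condHit`) is bounded, harmonic off A ∪ {0}, equal to 1_{y} on A and to 0
at 0: it is the probability that simple random walk reaches A before 0, and does so at y. In the
same way a(y) Ês_A(y) equals μ(y) (`harmMeas`), the mean over the neighbours of y of e(w) = a(w) -
∑_z h_z(w) a(z) (`escape`). With M = ∑ a μ (`harmMass`) and T(x) = ∑_z h_z(x) a(z) (`hitMean`), the
entrance law is a(y) h_y(x) / T(x) and the harmonic measure is a(y) μ(y) / M. The task is therefore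
to bound |h_y(x) M - μ(y) T(x)| by C (d/D) μ(y) T(x), where d is the size of A and D its distance
from x.

Let g(w, x) = a(w) + a(x) - a(w - x) be the Green function of the walk killed at 0. By Green's
identity, h_y(x) is the mean over the neighbours w of y of g(w, x) - ∑_z h_z(w) g(z, x)
(`eq_avg_killedGreen`). This is the expression defining μ(y) with g(·, x) in place of a. Near A,
g(·, x) equals c·a up to O(d/D) (`exists_abs_green_sub_le`). The difference of the two expressions
is harmonic between A ∪ {0} and a sphere of radius of order d, vanishes on A ∪ {0}, and is O(d/D) on
the sphere, where e is bounded below (`exists_le_escape`). The maximum principle bounds it by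
O(d/D)·e, and averaging at y gives a relative error (`abs_sub_le_of_surface`). The unknown c
disappears on summing over y with weights a(y), because T(x) is at least a constant times M
(`exists_le_green`, `mul_harmMass_le_hitMean`). When x is too close to 0 for these bounds, the
inequality, being linear in the h_z, is carried from a sphere around A outwards to x by the maximum
principle (`exists_abs_sub_le_of_far`).

Two facts about a suffice: a(u) - a(v) = O(|u - v|/|u|) for comparable norms (`exists_abs_sub_le`),
and unbounded logarithmic-type growth (`exists_growth`). Both follow from elementary binomial
estimates, because in rotated coordinates the walk is a pair of independent walks on ℤ; the
asymptotic expansion of a is not needed. -/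

section MarkovChain

/-! ### Prefix probabilities of a chain and the Markov property at time one -/

variable {S : Type*} [MeasurableSpace S] [Countable S] [DiscreteMeasurableSpace S]

/-- Each finite-dimensional marginal lives on a countable discrete space, so it is determined by its
point masses, which are prefix probabilities. Uniqueness of projective limits does the rest. -/
theorem measure_ext_of_prefix {μ ν : Measure (ℕ → S)} [IsFiniteMeasure μ] [IsFiniteMeasure ν]
    (h : ∀ (n : ℕ) (p : ℕ → S), μ {ω | ∀ i ≤ n, ω i = p i} = ν {ω | ∀ i ≤ n, ω i = p i}) :
    μ = ν := by
  have hP : IsProjectiveMeasureFamily (α := fun _ : ℕ => S) (fun I : Finset ℕ => μ.map I.restrict) := by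
    intro I J hJI
    rw [Measure.map_map (by fun_prop) (by fun_prop)]
    rfl
  refine IsProjectiveLimit.unique (P := fun I : Finset ℕ => μ.map I.restrict) (fun I => rfl) ?_
  rw [isProjectiveLimit_nat_iff hP]
  intro n
  refine (Measure.ext_iff_singleton).2 fun p => ?_
  rcases isEmpty_or_nonempty S with hS | ⟨⟨s⟩⟩
  · exact (IsEmpty.false (p ⟨0, by simp⟩)).elim
  let q : ℕ → S := fun i => if hi : i ∈ Finset.Iic n then p ⟨i, hi⟩ else s
  have hset : ∀ ω : ℕ → S, (∀ i ≤ n, ω i = q i) ↔ (Finset.Iic n).restrict ω = p := by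
    intro ω
    constructor
    · intro hω
      ext ⟨i, hi⟩
      have := hω i (Finset.mem_Iic.1 hi)
      simpa [q, Finset.mem_Iic.1 hi] using this
    · rintro rfl i hi
      simp [q, hi]
  rw [Measure.map_apply (by fun_prop) (measurableSet_singleton _),
    Measure.map_apply (by fun_prop) (measurableSet_singleton _)]
  have := h n q
  simp only [hset] at this
  exact this.symm

theorem measurableSet_eval_eq {ι : Type*} (i : ι) (s : S) :
    MeasurableSet {ω : ι → S | ω i = s} := by
  have h : {ω : ι → S | ω i = s} = (fun ω => ω i) ⁻¹' {s} := by ext ω; simp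
  rw [h]
  exact (measurableSet_singleton s).preimage (measurable_pi_apply i)

instance chainLaw_isProbability (P : S → S → ℝ) (x : S) : IsProbabilityMeasure (chainLaw P x) := by
  unfold chainLaw; infer_instance

theorem chainLaw_prefix_zero (P : S → S → ℝ) (x : S) (p : ℕ → S) :
    chainLaw P x {ω | ∀ i ≤ 0, ω i = p i} = Measure.dirac x {p 0} := by
  have h := Kernel.traj_map_frestrictLe_apply (X := fun _ => S) (κ := historyKernel P) 0 0 (fun _ => x)
  rw [Kernel.partialTraj_self, Kernel.id_apply] at h
  have h2 := congrArg (fun m => m {h : (i : Finset.Iic 0) → S | h ⟨0, by simp⟩ = p 0}) h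
  have hm : MeasurableSet {h : (i : Finset.Iic 0) → S | h ⟨0, by simp⟩ = p 0} :=
    measurableSet_eval_eq _ (p 0)
  rw [Measure.map_apply (by fun_prop) hm] at h2
  rw [Measure.dirac_apply' _ (measurableSet_singleton _)]
  rw [Measure.dirac_apply' _ hm] at h2
  have e : {ω : ℕ → S | ∀ i ≤ 0, ω i = p i} = (Preorder.frestrictLe 0) ⁻¹'
      {h : (i : Finset.Iic 0) → S | h ⟨0, by simp⟩ = p 0} := by
    ext ω; simp
  rw [e]
  refine h2.trans ?_
  by_cases hx : x = p 0 <;> simp [hx, Set.indicator]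

theorem chainLaw_prefix_succ (P : S → S → ℝ) (x : S) (n : ℕ) (p : ℕ → S) :
    chainLaw P x {ω | ∀ i ≤ n + 1, ω i = p i} =
      chainLaw P x {ω | ∀ i ≤ n, ω i = p i} * stepKernel P (p n) {p (n + 1)} := by
  have h := Kernel.partialTraj_compProd_eq_map_traj (X := fun _ => S) (κ := historyKernel P) (a := 0) (b := n)
    (Nat.zero_le n) (x₀ := fun _ => x)
  rw [← Kernel.traj_map_frestrictLe_apply] at h
  set t : Set ((i : Finset.Iic n) → S) := {(Finset.Iic n).restrict p} with ht
  have hmt : MeasurableSet t := measurableSet_singleton _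
  have h2 := congrArg (fun m => m (t ×ˢ {p (n + 1)})) h
  rw [Measure.compProd_apply_prod hmt (measurableSet_singleton _),
    Measure.map_apply (by fun_prop) (hmt.prod (measurableSet_singleton _))] at h2
  have e1 : {ω : ℕ → S | ∀ i ≤ n + 1, ω i = p i} =
      (fun ω : ℕ → S => (Preorder.frestrictLe n ω, ω (n + 1))) ⁻¹' (t ×ˢ {p (n + 1)}) := by
    ext ω
    simp only [Set.mem_ofPred_eq, Set.mem_preimage, Set.mem_prod, ht, Set.mem_singleton_iff,
      funext_iff, Subtype.forall, Finset.mem_Iic]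
    constructor
    · intro hω
      exact ⟨fun i hi => hω i (hi.trans n.le_succ), hω _ le_rfl⟩
    · rintro ⟨h1, h2⟩ i hi
      rcases Nat.lt_or_eq_of_le hi with hi | rfl
      · exact h1 i (by omega)
      · exact h2
  have e2 : {ω : ℕ → S | ∀ i ≤ n, ω i = p i} = Preorder.frestrictLe n ⁻¹' t := by
    ext ω
    simp only [Set.mem_ofPred_eq, Set.mem_preimage, ht, Set.mem_singleton_iff,
      funext_iff, Subtype.forall, Finset.mem_Iic]
    rfl
  rw [e1, e2]
  refine h2.symm.trans ?_
  rw [ht, Measure.restrict_singleton, lintegral_smul_measure, lintegral_dirac,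
    Measure.map_apply (by fun_prop) (measurableSet_singleton _), smul_eq_mul]
  rfl

theorem chainLaw_apply_zero (P : S → S → ℝ) (x : S) (p : ℕ → S) (n : ℕ) (h : x ≠ p 0) :
    chainLaw P x {ω | ∀ i ≤ n, ω i = p i} = 0 := by
  refine measure_mono_null (t := {ω | ∀ i ≤ 0, ω i = p i}) ?_ ?_
  · intro ω hω i hi
    exact hω i (by omega)
  · rw [chainLaw_prefix_zero, Measure.dirac_apply' _ (measurableSet_singleton _)]
    simp [h]

/-- The trajectory law is built by appending last steps; removing the last factor from both sides,
by induction on `n`, turns this into a decomposition at the first step. -/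
theorem chainLaw_prefix_cons (P : S → S → ℝ) (x : S) (p : ℕ → S) (n : ℕ) :
    chainLaw P x {ω | ω 0 = x ∧ ∀ i ≤ n, ω (i + 1) = p i} =
      stepKernel P x {p 0} * chainLaw P (p 0) {ω | ∀ i ≤ n, ω i = p i} := by
  let p' : ℕ → S := fun i => Nat.casesOn i x p
  have key : ∀ n, {ω : ℕ → S | ω 0 = x ∧ ∀ i ≤ n, ω (i + 1) = p i} =
      {ω | ∀ i ≤ n + 1, ω i = p' i} := by
    intro n
    ext ω
    simp only [Set.mem_ofPred_eq]
    constructor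
    · rintro ⟨h0, h⟩ i hi
      cases i with
      | zero => exact h0
      | succ i => exact h i (by omega)
    · intro h
      exact ⟨h 0 (by omega), fun i hi => h (i + 1) (by omega)⟩
  induction n with
  | zero =>
    rw [key, chainLaw_prefix_succ, chainLaw_prefix_zero, chainLaw_prefix_zero]
    simp [p', Measure.dirac_apply' _ (measurableSet_singleton _)]
  | succ n ih =>
    rw [key, chainLaw_prefix_succ, ← key, ih, chainLaw_prefix_succ, mul_assoc]

theorem chainLaw_ae_zero (P : S → S → ℝ) (x : S) : ∀ᵐ ω ∂(chainLaw P x), ω 0 = x := by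
  have h := chainLaw_prefix_zero P x (fun _ => x)
  rw [Measure.dirac_apply' _ (measurableSet_singleton _)] at h
  simp only [Set.mem_singleton_iff, Set.indicator_of_mem, Pi.one_apply] at h
  have hm : MeasurableSet {ω : ℕ → S | ω 0 = x} :=
    measurableSet_eval_eq 0 x
  have h' : chainLaw P x {ω | ω 0 = x} = 1 := by
    rw [← h]; congr 1; ext ω; simp
  exact (prob_compl_eq_zero_iff hm).2 h'

/-- The Markov property at time one. -/
theorem chainLaw_map_shift (P : S → S → ℝ) (x : S) :
    (chainLaw P x).map (fun ω n => ω (n + 1)) =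
      (stepKernel P x).bind (chainLaw P) := by
  have hmeas : Measurable (chainLaw P) := Measurable.of_discrete
  have hshift : Measurable (fun (ω : ℕ → S) (n : ℕ) => ω (n + 1)) := by fun_prop
  have : IsProbabilityMeasure ((chainLaw P x).map (fun ω n => ω (n + 1))) :=
    Measure.isProbabilityMeasure_map hshift.aemeasurable
  have : IsFiniteMeasure ((stepKernel P x).bind (chainLaw P)) := by
    constructor
    rw [Measure.bind_apply MeasurableSet.univ hmeas.aemeasurable]
    simp
  refine measure_ext_of_prefix fun n p => ?_
  have hm : MeasurableSet {ω : ℕ → S | ∀ i ≤ n, ω i = p i} := by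
    have : {ω : ℕ → S | ∀ i ≤ n, ω i = p i} = ⋂ i ∈ Set.Iic n, {ω : ℕ → S | ω i = p i} := by
      ext ω; simp
    rw [this]
    exact MeasurableSet.biInter (Set.to_countable _) fun i _ =>
      measurableSet_eval_eq i (p i)
  rw [Measure.map_apply hshift hm, Measure.bind_apply hm hmeas.aemeasurable]
  have e1 : chainLaw P x ((fun (ω : ℕ → S) (n : ℕ) => ω (n + 1)) ⁻¹' {ω | ∀ i ≤ n, ω i = p i}) =
      chainLaw P x {ω | ω 0 = x ∧ ∀ i ≤ n, ω (i + 1) = p i} := by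
    refine measure_congr ?_
    filter_upwards [chainLaw_ae_zero P x] with ω hω
    refine propext ?_
    change (∀ i ≤ n, ω (i + 1) = p i) ↔ (ω 0 = x ∧ ∀ i ≤ n, ω (i + 1) = p i)
    simp [hω]
  rw [e1, chainLaw_prefix_cons]
  -- The integrand vanishes off `p 0`, so the integral over the first step reduces to one product.
  have e2 : ∀ z, chainLaw P z {ω | ∀ i ≤ n, ω i = p i} =
      ({p 0} : Set S).indicator (fun z => chainLaw P z {ω | ∀ i ≤ n, ω i = p i}) z := by
    intro z
    by_cases hz : z = p 0
    · simp [hz]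
    · rw [Set.indicator_of_notMem (by simpa using hz), chainLaw_apply_zero P z p n hz]
  rw [lintegral_congr e2, lintegral_indicator (measurableSet_singleton _),
    Measure.restrict_singleton, lintegral_smul_measure, lintegral_dirac, smul_eq_mul]

end MarkovChain

/-! ### Neighbour averages and first-step analysis on ℤ² -/

/-- The mean of `f` over the four neighbours of `x`. -/
noncomputable def avg (f : ℤ × ℤ → ℝ) (x : ℤ × ℤ) : ℝ :=
  (f (x + (1, 0)) + f (x + (-1, 0)) + f (x + (0, 1)) + f (x + (0, -1))) / 4

/-- The four unit vectors. -/
def units : Finset (ℤ × ℤ) := {(1, 0), (-1, 0), (0, 1), (0, -1)}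

theorem sum_units {M : Type*} [AddCommMonoid M] (f : ℤ × ℤ → M) :
    ∑ e ∈ units, f e = f (1, 0) + f (-1, 0) + f (0, 1) + f (0, -1) := by
  unfold units
  rw [Finset.sum_insert (by simp), Finset.sum_insert (by simp), Finset.sum_insert (by simp),
    Finset.sum_singleton]
  simp only [add_assoc]

theorem avg_eq_sum (f : ℤ × ℤ → ℝ) (x : ℤ × ℤ) :
    avg f x = (∑ e ∈ units, f (x + e)) / 4 := by
  rw [sum_units (fun e => f (x + e))]; rfl

theorem nbr_iff (x y : ℤ × ℤ) : Nbr x y ↔ y - x ∈ units := by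
  obtain ⟨x1, x2⟩ := x
  obtain ⟨y1, y2⟩ := y
  simp only [Nbr, units, Finset.mem_insert, Finset.mem_singleton, Prod.mk_sub_mk, Prod.mk.injEq]
  grind

theorem nbr_add_unit (x : ℤ × ℤ) {e : ℤ × ℤ} (he : e ∈ units) : Nbr x (x + e) := by
  rw [nbr_iff]; simpa using he

/-- A matrix on `ℤ²` whose row at `x` is a probability vector on the neighbours of `x`. -/
structure IsWalkRow (P : ℤ × ℤ → ℤ × ℤ → ℝ) (x : ℤ × ℤ) : Prop where
  nonneg : ∀ y, 0 ≤ P x y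
  eq_zero : ∀ y, ¬ Nbr x y → P x y = 0
  sum_eq : ∑ e ∈ units, P x (x + e) = 1

theorem lintegral_rowMeasure {P : ℤ × ℤ → ℤ × ℤ → ℝ} {x : ℤ × ℤ} (h : IsWalkRow P x)
    (f : ℤ × ℤ → ENNReal) :
    ∫⁻ y, f y ∂(rowMeasure P x) = ∑ e ∈ units, ENNReal.ofReal (P x (x + e)) * f (x + e) := by
  unfold rowMeasure
  rw [lintegral_sum_measure]
  simp only [lintegral_smul_measure, lintegral_dirac, smul_eq_mul]
  have : ∑ e ∈ units, ENNReal.ofReal (P x (x + e)) * f (x + e) =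
      ∑ y ∈ units.map (addLeftEmbedding x), ENNReal.ofReal (P x y) * f y := by
    rw [Finset.sum_map]; rfl
  rw [this]
  refine tsum_eq_sum fun y hy => ?_
  rw [h.eq_zero y, ENNReal.ofReal_zero, zero_mul]
  intro hn
  refine hy (Finset.mem_map.2 ⟨y - x, (nbr_iff x y).1 hn, ?_⟩)
  simp

theorem isProbabilityMeasure_rowMeasure {P : ℤ × ℤ → ℤ × ℤ → ℝ} {x : ℤ × ℤ} (h : IsWalkRow P x) :
    IsProbabilityMeasure (rowMeasure P x) := by
  constructor
  rw [← lintegral_one, lintegral_rowMeasure h]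
  simp only [mul_one]
  rw [← ENNReal.ofReal_sum_of_nonneg fun e _ => h.nonneg _, h.sum_eq, ENNReal.ofReal_one]

theorem lintegral_stepKernel {P : ℤ × ℤ → ℤ × ℤ → ℝ} {x : ℤ × ℤ} (h : IsWalkRow P x)
    (f : ℤ × ℤ → ENNReal) :
    ∫⁻ y, f y ∂(stepKernel P x) = ∑ e ∈ units, ENNReal.ofReal (P x (x + e)) * f (x + e) := by
  have : stepKernel P x = rowMeasure P x := if_pos (isProbabilityMeasure_rowMeasure h)
  rw [this, lintegral_rowMeasure h]

/-- First-step analysis for an event of the shifted trajectory. -/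
theorem chainLaw_real_shift {P : ℤ × ℤ → ℤ × ℤ → ℝ} {x : ℤ × ℤ} (h : IsWalkRow P x)
    {E F : Set (ℕ → ℤ × ℤ)} (hF : MeasurableSet F)
    (hEF : ∀ ω : ℕ → ℤ × ℤ, ω 0 = x → (ω ∈ E ↔ (fun n => ω (n + 1)) ∈ F)) :
    (chainLaw P x).real E = ∑ e ∈ units, P x (x + e) * (chainLaw P (x + e)).real F := by
  have hshift : Measurable (fun (ω : ℕ → ℤ × ℤ) (n : ℕ) => ω (n + 1)) := by fun_prop
  have hmeas : Measurable (chainLaw P) := Measurable.of_discrete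
  have h1 : chainLaw P x E = ∑ e ∈ units, ENNReal.ofReal (P x (x + e)) * chainLaw P (x + e) F := by
    rw [← lintegral_stepKernel h (fun z => chainLaw P z F), ← Measure.bind_apply hF hmeas.aemeasurable,
      ← chainLaw_map_shift, Measure.map_apply hshift hF]
    refine measure_congr ?_
    filter_upwards [chainLaw_ae_zero P x] with ω hω
    exact propext (hEF ω hω)
  rw [measureReal_def, h1, ENNReal.toReal_sum fun e _ =>
    ENNReal.mul_ne_top ENNReal.ofReal_ne_top (measure_ne_top _ _)]
  refine Finset.sum_congr rfl fun e _ => ?_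
  rw [ENNReal.toReal_mul, ENNReal.toReal_ofReal (h.nonneg _)]
  rfl

theorem chainLaw_real_congr {P : ℤ × ℤ → ℤ × ℤ → ℝ} {x : ℤ × ℤ} {E F : Set (ℕ → ℤ × ℤ)}
    (hEF : ∀ ω : ℕ → ℤ × ℤ, ω 0 = x → (ω ∈ E ↔ ω ∈ F)) :
    (chainLaw P x).real E = (chainLaw P x).real F := by
  rw [measureReal_def, measureReal_def]
  congr 1
  refine measure_congr ?_
  filter_upwards [chainLaw_ae_zero P x] with ω hω
  exact propext (hEF ω hω)

/-! ### The simple random walk -/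

theorem isWalkRow_srwMatrix (x : ℤ × ℤ) : IsWalkRow srwMatrix x where
  nonneg y := by unfold srwMatrix; split_ifs <;> norm_num
  eq_zero y h := by simp [srwMatrix, h]
  sum_eq := by
    rw [Finset.sum_congr rfl fun e he => show srwMatrix x (x + e) = 1 / 4 by
      simp [srwMatrix, nbr_add_unit x he]]
    simp [units]

/-- The probability that the simple random walk started at `x` is at `0` at time `k`. -/
noncomputable def returnProb (k : ℕ) (x : ℤ × ℤ) : ℝ := (chainLaw srwMatrix x).real {ω | ω k = 0}

theorem returnProb_zero (x : ℤ × ℤ) : returnProb 0 x = if x = 0 then 1 else 0 := by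
  unfold returnProb
  split_ifs with h
  · rw [chainLaw_real_congr (F := Set.univ)]
    · simp
    · intro ω hω; simp [hω, h]
  · rw [chainLaw_real_congr (F := ∅)]
    · simp
    · intro ω hω; simp [hω, h]

theorem returnProb_succ (k : ℕ) (x : ℤ × ℤ) : returnProb (k + 1) x = avg (returnProb k) x := by
  unfold returnProb
  rw [chainLaw_real_shift (isWalkRow_srwMatrix x) (measurableSet_eval_eq k 0) (fun ω _ => by rfl),
    avg_eq_sum, Finset.sum_div]
  refine Finset.sum_congr rfl fun e he => ?_
  simp [srwMatrix, nbr_add_unit x he]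
  ring

theorem potentialKernel_eq (x : ℤ × ℤ) : potentialKernel x =
    limUnder atTop fun n : ℕ => ∑ k ∈ Finset.range n, (returnProb k 0 - returnProb k x) := rfl

/-! ### Entrance laws of Markov chains on `ℤ²` -/

/-- The trajectory enters `A` at `y`. -/
def entersAt (A : Finset (ℤ × ℤ)) (y : ℤ × ℤ) : Set (ℕ → ℤ × ℤ) :=
  {ω | ∃ n, ω n = y ∧ ∀ i < n, ω i ∉ A}

/-- The trajectory enters `A` at `y`, at time `N` at the latest. -/
def entersAtBy (A : Finset (ℤ × ℤ)) (y : ℤ × ℤ) (N : ℕ) : Set (ℕ → ℤ × ℤ) :=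
  {ω | ∃ n ≤ N, ω n = y ∧ ∀ i < n, ω i ∉ A}

theorem measurableSet_entersAtBy (A : Finset (ℤ × ℤ)) (y : ℤ × ℤ) (N : ℕ) :
    MeasurableSet (entersAtBy A y N) := by
  have : entersAtBy A y N = ⋃ n ∈ Set.Iic N, ({ω | ω n = y} ∩
      ⋂ i ∈ Set.Iio n, ⋂ z ∈ (A : Set (ℤ × ℤ)), {ω | ω i = z}ᶜ) := by
    ext ω
    simp only [entersAtBy, Set.mem_ofPred_eq, Set.mem_iUnion, Set.mem_inter_iff, Set.mem_iInter,
      Set.mem_compl_iff, Set.mem_Iic, Set.mem_Iio, exists_prop, Finset.mem_coe]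
    constructor
    · rintro ⟨n, hn, h1, h2⟩
      exact ⟨n, hn, h1, fun i hi z hz h => h2 i hi (h ▸ hz)⟩
    · rintro ⟨n, hn, h1, h2⟩
      exact ⟨n, hn, h1, fun i hi hz => h2 i hi _ hz rfl⟩
  rw [this]
  refine MeasurableSet.biUnion (Set.to_countable _) fun n _ =>
    (measurableSet_eval_eq n y).inter (MeasurableSet.biInter (Set.to_countable _) fun i _ =>
      MeasurableSet.biInter (Set.to_countable _) fun z _ => (measurableSet_eval_eq i z).compl)

theorem entersAt_eq_iUnion (A : Finset (ℤ × ℤ)) (y : ℤ × ℤ) :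
    entersAt A y = ⋃ N, entersAtBy A y N := by
  ext ω
  simp only [entersAt, entersAtBy, Set.mem_ofPred_eq, Set.mem_iUnion]
  constructor
  · rintro ⟨n, h⟩
    exact ⟨n, n, le_rfl, h⟩
  · rintro ⟨_, n, _, h⟩
    exact ⟨n, h⟩

theorem measurableSet_entersAt (A : Finset (ℤ × ℤ)) (y : ℤ × ℤ) :
    MeasurableSet (entersAt A y) := by
  rw [entersAt_eq_iUnion]
  exact MeasurableSet.iUnion fun N => measurableSet_entersAtBy A y N

/-- The time-bounded events allow induction on the horizon; this limit transfers the resulting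
bounds to the entrance event itself. -/
theorem tendsto_entersAtBy {P : ℤ × ℤ → ℤ × ℤ → ℝ} (A : Finset (ℤ × ℤ)) (x y : ℤ × ℤ) :
    Tendsto (fun N => (chainLaw P x).real (entersAtBy A y N)) atTop
      (nhds ((chainLaw P x).real (entersAt A y))) := by
  rw [entersAt_eq_iUnion]
  refine (ENNReal.tendsto_toReal (measure_ne_top _ _)).comp (tendsto_measure_iUnion_atTop ?_)
  intro N M h ω hω
  obtain ⟨n, hn, h'⟩ := hω
  exact ⟨n, hn.trans h, h'⟩

theorem entersAt_shift {A : Finset (ℤ × ℤ)} {ω : ℕ → ℤ × ℤ} (h : ω 0 ∉ A) {y : ℤ × ℤ} (hy : y ∈ A) :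
    ω ∈ entersAt A y ↔ (fun n => ω (n + 1)) ∈ entersAt A y := by
  constructor
  · rintro ⟨n, h1, h2⟩
    cases n with
    | zero => exact absurd (h1 ▸ hy) h
    | succ n => exact ⟨n, h1, fun i hi => h2 (i + 1) (by omega)⟩
  · rintro ⟨n, h1, h2⟩
    refine ⟨n + 1, h1, fun i hi => ?_⟩
    cases i with
    | zero => exact h
    | succ i => exact h2 i (by omega)

theorem entersAtBy_shift {A : Finset (ℤ × ℤ)} {ω : ℕ → ℤ × ℤ} (h : ω 0 ∉ A) {y : ℤ × ℤ} (hy : y ∈ A)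
    (N : ℕ) : ω ∈ entersAtBy A y (N + 1) ↔ (fun n => ω (n + 1)) ∈ entersAtBy A y N := by
  constructor
  · rintro ⟨n, hn, h1, h2⟩
    cases n with
    | zero => exact absurd (h1 ▸ hy) h
    | succ n => exact ⟨n, by omega, h1, fun i hi => h2 (i + 1) (by omega)⟩
  · rintro ⟨n, hn, h1, h2⟩
    refine ⟨n + 1, by omega, h1, fun i hi => ?_⟩
    cases i with
    | zero => exact h
    | succ i => exact h2 i (by omega)

theorem entersAt_of_mem {A : Finset (ℤ × ℤ)} {ω : ℕ → ℤ × ℤ} (h : ω 0 ∈ A) {y : ℤ × ℤ} :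
    ω ∈ entersAt A y ↔ ω 0 = y := by
  constructor
  · rintro ⟨n, h1, h2⟩
    cases n with
    | zero => exact h1
    | succ n => exact absurd h (h2 0 (by omega))
  · intro h1
    exact ⟨0, h1, fun i hi => absurd hi (by omega)⟩

theorem entersAtBy_of_mem {A : Finset (ℤ × ℤ)} {ω : ℕ → ℤ × ℤ} (h : ω 0 ∈ A) {y : ℤ × ℤ} (N : ℕ) :
    ω ∈ entersAtBy A y N ↔ ω 0 = y := by
  constructor
  · rintro ⟨n, -, h1, h2⟩
    cases n with
    | zero => exact h1
    | succ n => exact absurd h (h2 0 (by omega))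
  · intro h1
    exact ⟨0, by omega, h1, fun i hi => absurd hi (by omega)⟩

theorem entersAt_disjoint (A : Finset (ℤ × ℤ)) {y z : ℤ × ℤ} (hy : y ∈ A) (hz : z ∈ A) (h : y ≠ z) :
    Disjoint (entersAt A y) (entersAt A z) := by
  rw [Set.disjoint_left]
  rintro ω ⟨n, h1, h2⟩ ⟨m, h3, h4⟩
  rcases lt_trichotomy n m with hnm | rfl | hnm
  · exact h4 n hnm (h1 ▸ hy)
  · exact h (h1.symm.trans h3)
  · exact h2 m hnm (h3 ▸ hz)

/-! ### Entrance and hitting times in terms of `meets` and `entersAt` -/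

/-- The trajectory meets `A`. -/
def meets (A : Finset (ℤ × ℤ)) : Set (ℕ → ℤ × ℤ) := ⋃ y ∈ A, entersAt A y

theorem mem_meets (A : Finset (ℤ × ℤ)) (ω : ℕ → ℤ × ℤ) : ω ∈ meets A ↔ ∃ n, ω n ∈ A := by
  simp only [meets, Set.mem_iUnion, exists_prop]
  constructor
  · rintro ⟨y, hy, n, h, -⟩
    exact ⟨n, h ▸ hy⟩
  · intro h
    classical
    exact ⟨ω (Nat.find h), Nat.find_spec h, Nat.find h, rfl, fun i hi => Nat.find_min h hi⟩

theorem measurableSet_meets (A : Finset (ℤ × ℤ)) : MeasurableSet (meets A) :=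
  Finset.measurableSet_biUnion _ fun y _ => measurableSet_entersAt A y

theorem real_meets (P : ℤ × ℤ → ℤ × ℤ → ℝ) (A : Finset (ℤ × ℤ)) (x : ℤ × ℤ) :
    (chainLaw P x).real (meets A) = ∑ y ∈ A, (chainLaw P x).real (entersAt A y) := by
  unfold meets
  rw [measureReal_biUnion_finset]
  · intro y hy z hz h
    exact entersAt_disjoint A hy hz h
  · exact fun y _ => measurableSet_entersAt A y

theorem entranceTime_lt_top (A : Finset (ℤ × ℤ)) :
    {ω | entranceTime (A : Set (ℤ × ℤ)) ω < ⊤} = meets A := by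
  ext ω
  rw [mem_meets]
  simp [lt_top_iff_ne_top, entranceTime, hittingAfter_eq_top_iff, coord]

theorem hittingTime_eq_top (A : Finset (ℤ × ℤ)) (ω : ℕ → ℤ × ℤ) :
    ω ∈ {ω | hittingTime (A : Set (ℤ × ℤ)) ω = ⊤} ↔ (fun n => ω (n + 1)) ∈ (meets A)ᶜ := by
  rw [Set.mem_compl_iff, mem_meets]
  simp only [Set.mem_ofPred_eq, hittingTime, hittingAfter_eq_top_iff, coord, Finset.mem_coe, not_exists]
  constructor
  · intro h n
    exact h (n + 1) (by omega)
  · intro h j hj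
    obtain ⟨n, rfl⟩ : ∃ n, j = n + 1 := ⟨j - 1, by omega⟩
    exact h n

/-- The intersection with `meets A` matters: off it the entrance time is `⊤` and the stopped value
is a default with no meaning. -/
theorem meets_inter_stoppedValue (A : Finset (ℤ × ℤ)) {y : ℤ × ℤ} (hy : y ∈ A) :
    meets A ∩ {ω | stoppedValue coord (entranceTime (A : Set (ℤ × ℤ))) ω = y} = entersAt A y := by
  classical
  ext ω
  have key : ∀ n, ω n ∈ A → (∀ i < n, ω i ∉ A) →
      stoppedValue coord (entranceTime (A : Set (ℤ × ℤ))) ω = ω n := by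
    intro n h1 h2
    have : entranceTime (A : Set (ℤ × ℤ)) ω = (n : WithTop ℕ) := by
      refine le_antisymm (hittingAfter_le_of_mem (Nat.zero_le n) h1) ?_
      by_contra hlt
      rw [not_le] at hlt
      have hne : entranceTime (A : Set (ℤ × ℤ)) ω ≠ ⊤ := ne_top_of_lt hlt
      obtain ⟨m, hm⟩ := WithTop.ne_top_iff_exists.1 hne
      have hmem := hittingAfter_mem_set_of_ne_top (u := coord) (s := (A : Set (ℤ × ℤ))) (n := 0) hne
      change coord (entranceTime (A : Set (ℤ × ℤ)) ω).untopA ω ∈ _ at hmem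
      rw [← hm] at hmem hlt
      exact h2 m (WithTop.coe_lt_coe.1 hlt) hmem
    rw [stoppedValue, this]
    rfl
  rw [Set.mem_inter_iff, mem_meets]
  constructor
  · rintro ⟨h, hs⟩
    have h1 := Nat.find_spec h
    have h2 : ∀ i < Nat.find h, ω i ∉ A := fun i hi => Nat.find_min h hi
    exact ⟨Nat.find h, (key _ h1 h2).symm.trans hs, h2⟩
  · rintro ⟨n, h1, h2⟩
    have hA : ω n ∈ A := h1 ▸ hy
    exact ⟨⟨n, hA⟩, (key n hA h2).trans h1⟩

/-! ### The simple random walk on `ℤ` -/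

/-- The probability that the simple random walk on `ℤ` goes from `r` to `0` in `n` steps. -/
noncomputable def lineProb : ℕ → ℤ → ℝ
  | 0, r => if r = 0 then 1 else 0
  | n + 1, r => (lineProb n (r - 1) + lineProb n (r + 1)) / 2

theorem lineProb_nonneg (n : ℕ) (r : ℤ) : 0 ≤ lineProb n r := by
  induction n generalizing r with
  | zero => unfold lineProb; split_ifs <;> norm_num
  | succ n ih => unfold lineProb; have := ih (r - 1); have := ih (r + 1); positivity

theorem lineProb_neg (n : ℕ) (r : ℤ) : lineProb n (-r) = lineProb n r := by
  induction n generalizing r with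
  | zero => simp [lineProb]
  | succ n ih =>
    unfold lineProb
    rw [← ih (r - 1), ← ih (r + 1), show -(r - 1) = -r + 1 by ring, show -(r + 1) = -r - 1 by ring]
    ring

theorem lineProb_odd (n : ℕ) (r : ℤ) (h : (n + r) % 2 = 1) : lineProb n r = 0 := by
  induction n generalizing r with
  | zero => rw [lineProb, if_neg]; rintro rfl; simp at h
  | succ n ih =>
    rw [lineProb, ih (r - 1) (by push_cast at h; omega), ih (r + 1) (by push_cast at h; omega)]
    simp

/-- This is the ratio of consecutive binomial coefficients, cross-multiplied so that neither
factorials nor parity cases appear. -/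
theorem lineProb_add_two (n : ℕ) (r : ℤ) :
    (n + r + 2) * lineProb n (r + 2) = (n - r) * lineProb n r := by
  induction n generalizing r with
  | zero =>
    unfold lineProb
    by_cases h : r = 0
    · simp [h]
    · by_cases h2 : r = -2
      · simp [h2]
      · simp [h, show r + 2 ≠ 0 by omega]
  | succ n ih =>
    have h1 := ih (r + 1)
    have h2 := ih (r - 1)
    rw [show r + 1 + 2 = r + 3 by ring] at h1
    rw [show r - 1 + 2 = r + 1 by ring] at h2
    rw [lineProb, lineProb, show r + 2 - 1 = r + 1 by ring, show r + 2 + 1 = r + 3 by ring]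
    push_cast at *
    linear_combination (1 / 2) * h1 + (1 / 2) * h2

/-- Each step of the planar walk changes both x₁ + x₂ and x₁ - x₂ by ±1, all four sign pairs being
equally likely; the two rotated coordinates are independent walks on ℤ. -/
theorem returnProb_eq_mul (n : ℕ) (x : ℤ × ℤ) :
    returnProb n x = lineProb n (x.1 + x.2) * lineProb n (x.1 - x.2) := by
  induction n generalizing x with
  | zero =>
    rw [returnProb_zero]
    unfold lineProb
    obtain ⟨x1, x2⟩ := x
    by_cases h : x1 + x2 = 0
    · by_cases h' : x1 - x2 = 0
      · rw [if_pos, if_pos h, if_pos h', mul_one]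
        ext <;> simp <;> omega
      · rw [if_neg, if_neg h', mul_zero]
        rintro h0
        simp only [Prod.mk_eq_zero] at h0
        omega
    · rw [if_neg, if_neg h, zero_mul]
      rintro h0
      simp only [Prod.mk_eq_zero] at h0
      omega
  | succ n ih =>
    rw [returnProb_succ]
    unfold avg lineProb
    simp only [ih, Prod.fst_add, Prod.snd_add]
    rw [show x.1 + 1 + (x.2 + 0) = x.1 + x.2 + 1 by ring,
      show x.1 + 1 - (x.2 + 0) = x.1 - x.2 + 1 by ring,
      show x.1 + -1 + (x.2 + 0) = x.1 + x.2 - 1 by ring,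
      show x.1 + -1 - (x.2 + 0) = x.1 - x.2 - 1 by ring,
      show x.1 + 0 + (x.2 + 1) = x.1 + x.2 + 1 by ring,
      show x.1 + 0 - (x.2 + 1) = x.1 - x.2 - 1 by ring,
      show x.1 + 0 + (x.2 + -1) = x.1 + x.2 - 1 by ring,
      show x.1 + 0 - (x.2 + -1) = x.1 - x.2 + 1 by ring]
    ring

/-! ### Binomial bounds at even times -/

/-- The probability that the walk on `ℤ` moves by `2 k` in `2 m` steps. -/
noncomputable def evenProb (m : ℕ) (k : ℤ) : ℝ := lineProb (2 * m) (2 * k)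

theorem evenProb_nonneg (m : ℕ) (k : ℤ) : 0 ≤ evenProb m k := lineProb_nonneg _ _

theorem evenProb_neg (m : ℕ) (k : ℤ) : evenProb m (-k) = evenProb m k := by
  unfold evenProb; rw [← lineProb_neg]; congr 1; ring

theorem evenProb_natAbs (m : ℕ) (k : ℤ) : evenProb m k.natAbs = evenProb m k := by
  rcases Int.natAbs_eq k with h | h
  · rw [← h]
  · conv_rhs => rw [h]
    rw [evenProb_neg]

theorem evenProb_succ (m : ℕ) (k : ℤ) :
    (m + k + 1) * evenProb m (k + 1) = (m - k) * evenProb m k := by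
  have h := lineProb_add_two (2 * m) (2 * k)
  unfold evenProb
  rw [show 2 * (k + 1) = 2 * k + 2 by ring]
  push_cast at h
  linarith

theorem evenProb_center_succ (m : ℕ) :
    evenProb (m + 1) 0 = evenProb m 0 * ((2 * m + 1) / (2 * m + 2)) := by
  have h1 := evenProb_succ m 0
  have h2 := evenProb_neg m 1
  have : evenProb (m + 1) 0 = (evenProb m (-1) + 2 * evenProb m 0 + evenProb m 1) / 4 := by
    unfold evenProb
    rw [show 2 * (m + 1) = 2 * m + 1 + 1 by ring, lineProb, lineProb, lineProb]
    norm_num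
    ring
  rw [this, h2]
  have hm : (0 : ℝ) < m + 1 := by positivity
  push_cast at h1
  simp only [add_zero, sub_zero] at h1
  have h3 : evenProb m 1 = m * evenProb m 0 / (m + 1) := by
    rw [eq_div_iff hm.ne']; linarith
  rw [h3]
  field_simp
  ring

/-- The inequality (2m + 1)(2m + 3) ≤ (2m + 2)² is what closes the induction, and replaces
Stirling's formula. -/
theorem evenProb_center_sq_le (m : ℕ) : evenProb m 0 ^ 2 ≤ 1 / (2 * m + 1) := by
  induction m with
  | zero => simp [evenProb, lineProb]
  | succ m ih =>
    rw [evenProb_center_succ, mul_pow]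
    calc evenProb m 0 ^ 2 * ((2 * m + 1) / (2 * m + 2) : ℝ) ^ 2
        ≤ 1 / (2 * m + 1) * ((2 * m + 1) / (2 * m + 2) : ℝ) ^ 2 := by gcongr
      _ ≤ 1 / (2 * ((m + 1 : ℕ) : ℝ) + 1) := by
        push_cast
        rw [div_pow, div_mul_div_comm, div_le_div_iff₀ (by positivity) (by positivity)]
        have : (0 : ℝ) ≤ m := by positivity
        nlinarith [mul_nonneg this this]

theorem le_evenProb_center_sq (m : ℕ) : 1 / (4 * (m + 1)) ≤ evenProb (m + 1) 0 ^ 2 := by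
  induction m with
  | zero => rw [evenProb_center_succ]; norm_num [evenProb, lineProb]
  | succ m ih =>
    rw [evenProb_center_succ (m + 1), mul_pow]
    calc (1 : ℝ) / (4 * (((m + 1 : ℕ) : ℝ) + 1))
        ≤ 1 / (4 * (m + 1)) * ((2 * ((m + 1 : ℕ) : ℝ) + 1) / (2 * ((m + 1 : ℕ) : ℝ) + 2)) ^ 2 := by
          push_cast
          rw [div_pow, div_mul_div_comm, div_le_div_iff₀ (by positivity) (by positivity)]
          have : (0 : ℝ) ≤ m := by positivity
          nlinarith [mul_nonneg this this]
      _ ≤ _ := by gcongr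

/-- For k < m the ratio of consecutive terms is 1 - (2k + 1)/(m + k + 1) ≤ exp(-(2k + 1)/(2m)), and
the odd numbers sum to k². For k ≥ m the next term is 0. -/
theorem evenProb_le_exp (m k : ℕ) :
    evenProb m k ≤ evenProb m 0 * Real.exp (-(k ^ 2 / (2 * m))) := by
  induction k with
  | zero => simp
  | succ k ih =>
    have h := evenProb_succ m k
    have hpos : (0 : ℝ) < m + k + 1 := by positivity
    push_cast at h ⊢
    rcases lt_or_ge k m with hkm | hkm
    · have h1 : (m - k : ℝ) / (m + k + 1) ≤ Real.exp (-((2 * k + 1) / (2 * m))) := by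
        refine le_trans ?_ (Real.one_sub_le_exp_neg _)
        have hk' : (k : ℝ) + 1 ≤ m := by exact_mod_cast hkm
        have hm : (0 : ℝ) < 2 * m := by have : (0 : ℝ) ≤ k := by positivity
                                        linarith
        rw [div_le_iff₀ hpos]
        have h3 : (2 * k + 1 : ℝ) / (2 * m) * (m + k + 1) ≤ 2 * k + 1 := by
          rw [div_mul_eq_mul_div, div_le_iff₀ hm]
          gcongr
          linarith
        linarith
      have h2 : evenProb m (k + 1) = evenProb m k * ((m - k) / (m + k + 1)) := by
        field_simp; linarith
      rw [h2]
      calc evenProb m k * ((m - k) / (m + k + 1))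
          ≤ (evenProb m 0 * Real.exp (-(k ^ 2 / (2 * m)))) * Real.exp (-((2 * k + 1) / (2 * m))) := by
            have h5 := evenProb_nonneg m 0
            have hk' : (k : ℝ) + 1 ≤ m := by exact_mod_cast hkm
            have h6 : 0 ≤ (m - k : ℝ) / (m + k + 1) := div_nonneg (by linarith) hpos.le
            exact mul_le_mul ih h1 h6 (by positivity)
        _ = _ := by
            rw [mul_assoc, ← Real.exp_add]; congr 2; ring
    · have h1 : evenProb m (k + 1) ≤ 0 := by
        have h2 : (m + k + 1) * evenProb m (k + 1) ≤ 0 := by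
          rw [h]
          have : (m : ℝ) ≤ k := by exact_mod_cast hkm
          exact mul_nonpos_of_nonpos_of_nonneg (by linarith) (evenProb_nonneg _ _)
        by_contra hc
        rw [not_le] at hc
        have := mul_pos hpos hc
        linarith
      refine h1.trans ?_
      have := evenProb_nonneg m 0
      positivity

theorem evenProb_le_center (m : ℕ) (k : ℤ) : evenProb m k ≤ evenProb m 0 := by
  rw [← evenProb_natAbs]
  refine (evenProb_le_exp m _).trans ?_
  have h := evenProb_nonneg m 0
  refine mul_le_of_le_one_right h ?_
  rw [Real.exp_le_one_iff]
  rw [neg_nonpos]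
  positivity

/-- Consecutive terms differ by at most (2k + 1)/(m + 1) times the central one; the odd numbers are
summed again. -/
theorem le_evenProb (m k : ℕ) : evenProb (m + 1) 0 * (1 - k ^ 2 / (m + 1)) ≤ evenProb (m + 1) k := by
  induction k with
  | zero => simp
  | succ k ih =>
    have h := evenProb_succ (m + 1) k
    push_cast at h ⊢
    have hpos : (0 : ℝ) < m + 1 + k + 1 := by positivity
    have h2 : evenProb (m + 1) (k + 1) =
        evenProb (m + 1) k - evenProb (m + 1) k * ((2 * k + 1) / (m + 1 + k + 1)) := by
      field_simp; linarith
    have h3 : evenProb (m + 1) k * ((2 * k + 1) / (m + 1 + k + 1)) ≤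
        evenProb (m + 1) 0 * ((2 * k + 1) / (m + 1)) := by
      have := evenProb_le_center (m + 1) k
      have := evenProb_nonneg (m + 1) 0
      gcongr
      have : (0 : ℝ) ≤ k := by positivity
      linarith
    rw [h2]
    have h4 : evenProb (m + 1) 0 * (1 - (k + 1) ^ 2 / (m + 1)) =
      evenProb (m + 1) 0 * (1 - k ^ 2 / (m + 1)) - evenProb (m + 1) 0 * ((2 * k + 1) / (m + 1)) := by
      ring
    rw [h4]
    linarith

theorem lineProb_sq_le (n : ℕ) (r : ℤ) : lineProb (n + 1) r ^ 2 ≤ 1 / (n + 1) := by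
  have heven : ∀ m r, lineProb (2 * m) r ≤ evenProb m 0 := by
    intro m r
    rcases Int.even_or_odd' r with ⟨k, rfl | rfl⟩
    · exact evenProb_le_center m k
    · rw [lineProb_odd _ _ (by push_cast; omega)]
      exact evenProb_nonneg m 0
  rcases Nat.even_or_odd' (n + 1) with ⟨m, hm | hm⟩
  · rw [hm]
    refine (pow_le_pow_left₀ (lineProb_nonneg _ _) (heven m r) 2).trans
      ((evenProb_center_sq_le m).trans ?_)
    have : (n + 1 : ℝ) = 2 * m := by exact_mod_cast hm
    rw [this]
    have hm0 : (0 : ℝ) < 2 * m := by rw [← this]; positivity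
    gcongr
    linarith
  · rw [hm]
    have : (n + 1 : ℝ) = 2 * m + 1 := by exact_mod_cast hm
    rw [this]
    have h2 : lineProb (2 * m + 1) r ≤ evenProb m 0 := by
      rw [lineProb]
      linarith [heven m (r - 1), heven m (r + 1)]
    exact (pow_le_pow_left₀ (lineProb_nonneg _ _) h2 2).trans (evenProb_center_sq_le m)

theorem returnProb_nonneg (n : ℕ) (x : ℤ × ℤ) : 0 ≤ returnProb n x := measureReal_nonneg

theorem tendsto_returnProb (x : ℤ × ℤ) : Tendsto (fun n => returnProb n x) atTop (nhds 0) := by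
  rw [← tendsto_add_atTop_iff_nat 1]
  refine squeeze_zero (fun n => returnProb_nonneg _ _) (fun n => ?_)
    tendsto_one_div_add_atTop_nhds_zero_nat
  rw [returnProb_eq_mul]
  have h1 := lineProb_sq_le n (x.1 + x.2)
  have h2 := lineProb_sq_le n (x.1 - x.2)
  nlinarith [sq_nonneg (lineProb (n + 1) (x.1 + x.2) - lineProb (n + 1) (x.1 - x.2))]

/-! ### Potential kernel on the even sublattice -/

/-- The return probability at time `2 m` from the site `(k + l, k - l)`. -/
noncomputable def diagProb (m : ℕ) (k l : ℤ) : ℝ := evenProb m k * evenProb m l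

theorem returnProb_even (m : ℕ) (k l : ℤ) : returnProb (2 * m) (k + l, k - l) = diagProb m k l := by
  rw [returnProb_eq_mul]
  unfold diagProb evenProb
  congr 2 <;> ring

theorem returnProb_odd (m : ℕ) (k l : ℤ) : returnProb (2 * m + 1) (k + l, k - l) = 0 := by
  rw [returnProb_eq_mul, lineProb_odd _ _ (by push_cast; omega), zero_mul]

theorem diagProb_sub (m k : ℕ) (l : ℤ) :
    diagProb m k l - diagProb m (k + 1) l =
      evenProb m k * evenProb m l * ((2 * k + 1) / (m + k + 1)) := by
  have h := evenProb_succ m k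
  push_cast at h
  unfold diagProb
  have hpos : (0 : ℝ) < m + k + 1 := by positivity
  have : evenProb m (k + 1) = evenProb m k * ((m - k) / (m + k + 1)) := by
    field_simp; linarith
  rw [this]
  field_simp
  ring

theorem diagProb_sub_nonneg (m k : ℕ) (l : ℤ) : 0 ≤ diagProb m k l - diagProb m (k + 1) l := by
  rw [diagProb_sub]
  have := evenProb_nonneg m k
  have := evenProb_nonneg m l
  positivity

theorem evenProb_mul_le (m : ℕ) (k l : ℤ) :
    evenProb m k * evenProb m l ≤
      1 / (2 * m + 1) * Real.exp (-(((k : ℝ) ^ 2 + (l : ℝ) ^ 2) / (2 * m))) := by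
  have hk := evenProb_le_exp m k.natAbs
  have hl := evenProb_le_exp m l.natAbs
  rw [evenProb_natAbs, Nat.cast_natAbs, Int.cast_abs, sq_abs] at hk hl
  have h0 := evenProb_nonneg m 0
  calc evenProb m k * evenProb m l ≤ _ := mul_le_mul hk hl (evenProb_nonneg _ _) (by positivity)
    _ = evenProb m 0 ^ 2 * Real.exp (-(((k : ℝ) ^ 2 + (l : ℝ) ^ 2) / (2 * m))) := by
      rw [add_div, neg_add, Real.exp_add]; ring
    _ ≤ _ := by gcongr; exact evenProb_center_sq_le m

theorem diagProb_sub_le_sq (m k : ℕ) (l : ℤ) :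
    diagProb (m + 1) k l - diagProb (m + 1) (k + 1) l ≤ (2 * k + 1) * (1 / (m + 1 : ℝ) ^ 2) := by
  rw [diagProb_sub]
  have h := evenProb_mul_le (m + 1) k l
  have h1 : Real.exp (-((((k : ℕ) : ℤ) : ℝ) ^ 2 + (l : ℝ) ^ 2) / (2 * ((m + 1 : ℕ) : ℝ))) ≤ 1 := by
    rw [Real.exp_le_one_iff, neg_div, neg_nonpos]; positivity
  rw [neg_div] at h1
  have h2 : evenProb (m + 1) k * evenProb (m + 1) l ≤ 1 / (m + 1) := by
    refine h.trans ((mul_le_of_le_one_right (by positivity) h1).trans ?_)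
    push_cast
    gcongr
    linarith [show (0 : ℝ) ≤ m by positivity]
  calc evenProb (m + 1) k * evenProb (m + 1) l * ((2 * k + 1) / ((m + 1 : ℕ) + k + 1))
      ≤ 1 / (m + 1) * ((2 * k + 1) / (m + 1)) := by
        push_cast
        gcongr
        linarith [show (0 : ℝ) ≤ k by positivity]
    _ = _ := by field_simp

/-- With N = k² + l² the increment is O((2k + 1)/((m + 1)² + N²)): for m + 1 ≥ N by the central
bound, for smaller times by Gaussian decay. The right-hand side is put in telescoping form so that
the sum over m is at most 16(2k + 1)/N. -/
theorem diagProb_sub_le (m k : ℕ) (l : ℤ) (hN : 1 ≤ (k : ℝ) ^ 2 + (l : ℝ) ^ 2) :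
    diagProb (m + 1) k l - diagProb (m + 1) (k + 1) l ≤
      16 * (2 * k + 1) * (1 / (m + ((k : ℝ) ^ 2 + (l : ℝ) ^ 2)) -
        1 / ((m + 1 : ℕ) + ((k : ℝ) ^ 2 + (l : ℝ) ^ 2))) := by
  set N := (k : ℝ) ^ 2 + (l : ℝ) ^ 2 with hNdef
  have hm : (0 : ℝ) ≤ m := by positivity
  have hkey : diagProb (m + 1) k l - diagProb (m + 1) (k + 1) l ≤
      (2 * k + 1) * (8 / (((m : ℝ) + 1) ^ 2 + N ^ 2)) := by
    rcases le_total N (m + 1) with hNm | hNm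
    · refine (diagProb_sub_le_sq m k l).trans ?_
      refine mul_le_mul_of_nonneg_left ?_ (by positivity)
      rw [div_le_div_iff₀ (by positivity) (by positivity)]
      nlinarith
    · rw [diagProb_sub]
      have h := evenProb_mul_le (m + 1) k l
      push_cast at h
      rw [← hNdef] at h
      have hm1 : (0 : ℝ) < m + 1 := by positivity
      have hN0 : 0 < N := by linarith
      -- The bound exp t ≥ t²/2 at t = N/(2(m + 1)) is all the Gaussian decay that is needed.
      have hexp : Real.exp (-(N / (2 * (m + 1)))) ≤ 8 * (m + 1) ^ 2 / N ^ 2 := by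
        have hq := Real.quadratic_le_exp_of_nonneg (x := N / (2 * (m + 1))) (by positivity)
        have h3 : N ^ 2 / (8 * (m + 1) ^ 2) ≤ Real.exp (N / (2 * (m + 1))) := by
          refine le_trans ?_ hq
          have : (N / (2 * ((m : ℝ) + 1))) ^ 2 / 2 = N ^ 2 / (8 * (m + 1) ^ 2) := by
            field_simp; norm_num
          rw [this]
          have : 0 ≤ N / (2 * ((m : ℝ) + 1)) := by positivity
          linarith
        have h4 := inv_anti₀ (by positivity) h3
        rwa [← Real.exp_neg, inv_div] at h4
      calc evenProb (m + 1) k * evenProb (m + 1) l * ((2 * k + 1) / ((m + 1 : ℕ) + k + 1))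
          ≤ (1 / (2 * (m + 1) + 1) * (8 * (m + 1) ^ 2 / N ^ 2)) * ((2 * k + 1) / (m + 1)) := by
            refine mul_le_mul (h.trans (by gcongr)) ?_ (by positivity) (by positivity)
            push_cast
            gcongr
            linarith [show (0 : ℝ) ≤ k by positivity]
        _ = (2 * k + 1) * ((8 * (m + 1)) / ((2 * (m + 1) + 1) * N ^ 2)) := by field_simp
        _ ≤ (2 * k + 1) * (8 / (((m : ℝ) + 1) ^ 2 + N ^ 2)) := by
            refine mul_le_mul_of_nonneg_left ?_ (by positivity)
            rw [div_le_div_iff₀ (by positivity) (by positivity)]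
            nlinarith [mul_le_mul hNm hNm hm1.le hN0.le]
  refine hkey.trans ?_
  rw [show 16 * (2 * (k : ℝ) + 1) = (2 * k + 1) * 16 by ring, mul_assoc]
  gcongr
  push_cast
  rw [div_sub_div _ _ (by positivity) (by positivity), mul_div_assoc',
    div_le_div_iff₀ (by positivity) (by positivity)]
  nlinarith [sq_nonneg ((m : ℝ) + 1 - N)]

theorem summable_diagProb_sub (k : ℕ) (l : ℤ) :
    Summable fun m => diagProb m k l - diagProb m (k + 1) l := by
  rw [← summable_nat_add_iff 1]
  have hs : Summable fun m : ℕ => (2 * k + 1 : ℝ) * (1 / (m + 1 : ℝ) ^ 2) := by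
    have := (summable_nat_add_iff 1).2 (Real.summable_one_div_nat_pow.2 (by norm_num : 1 < 2))
    push_cast at this
    exact this.mul_left _
  exact Summable.of_nonneg_of_le (fun m => diagProb_sub_nonneg _ _ _)
    (fun m => diagProb_sub_le_sq m k l) hs

theorem diagProb_comm (m : ℕ) (k l : ℤ) : diagProb m k l = diagProb m l k := mul_comm _ _

theorem diagProb_natAbs (m : ℕ) (k l : ℤ) : diagProb m k.natAbs l.natAbs = diagProb m k l := by
  simp only [diagProb, evenProb_natAbs]

theorem summable_diagProb (k l : ℤ) : Summable fun m => diagProb m 0 0 - diagProb m k l := by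
  have h1 : ∀ (k : ℕ) (l : ℤ), Summable fun m => diagProb m 0 l - diagProb m k l := by
    intro k l
    induction k with
    | zero => simp
    | succ k ih =>
      refine (ih.add (summable_diagProb_sub k l)).congr fun m => ?_
      push_cast; ring
  have h2 := (h1 l.natAbs 0).add (h1 k.natAbs l.natAbs)
  refine h2.congr fun m => ?_
  rw [diagProb_natAbs, diagProb_comm m l.natAbs 0, diagProb_comm m 0 l.natAbs]
  ring

/-! ### Existence and first properties of the potential kernel -/

theorem tendsto_potentialKernel_even (k l : ℤ) :
    Tendsto (fun n : ℕ => ∑ j ∈ Finset.range n, (returnProb j 0 - returnProb j (k + l, k - l)))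
      atTop (nhds (∑' m, (diagProb m 0 0 - diagProb m k l))) := by
  have h : HasSum (fun j => returnProb j 0 - returnProb j (k + l, k - l))
      (∑' m, (diagProb m 0 0 - diagProb m k l) + 0) := by
    have h0 : ((0 : ℤ × ℤ)) = ((0 : ℤ) + 0, (0 : ℤ) - 0) := rfl
    refine HasSum.even_add_odd ?_ ?_
    · convert! (summable_diagProb k l).hasSum using 2 with m
      rw [h0, returnProb_even, returnProb_even]
    · convert! hasSum_zero using 2 with m
      rw [h0, returnProb_odd, returnProb_odd, sub_zero]
  rw [add_zero] at h
  exact h.tendsto_sum_nat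

theorem exists_tendsto_partialSums (x : ℤ × ℤ) : ∃ L : ℝ,
    Tendsto (fun n : ℕ => ∑ j ∈ Finset.range n, (returnProb j 0 - returnProb j x)) atTop (nhds L) := by
  have heven : ∀ y : ℤ × ℤ, (y.1 + y.2) % 2 = 0 → ∃ L : ℝ,
      Tendsto (fun n : ℕ => ∑ j ∈ Finset.range n, (returnProb j 0 - returnProb j y))
        atTop (nhds L) := by
    intro y hy
    rw [show y = ((y.1 + y.2) / 2 + (y.1 - y.2) / 2, (y.1 + y.2) / 2 - (y.1 - y.2) / 2) by
      ext <;> simp only <;> omega]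
    exact ⟨_, tendsto_potentialKernel_even _ _⟩
  by_cases hx : (x.1 + x.2) % 2 = 0
  · exact heven x hx
  · obtain ⟨L1, h1⟩ := heven (x + (1, 0)) (by simp only [Prod.fst_add, Prod.snd_add]; omega)
    obtain ⟨L2, h2⟩ := heven (x + (-1, 0)) (by simp only [Prod.fst_add, Prod.snd_add]; omega)
    obtain ⟨L3, h3⟩ := heven (x + (0, 1)) (by simp only [Prod.fst_add, Prod.snd_add]; omega)
    obtain ⟨L4, h4⟩ := heven (x + (0, -1)) (by simp only [Prod.fst_add, Prod.snd_add]; omega)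
    -- The neighbours of an odd site are even. Since p_{j+1} is the average of p_j, the mean of
    -- their partial sums is that at x, up to the boundary terms p_0(x) and p_n(x), and p_n(x) → 0.
    refine ⟨(L1 + L2 + L3 + L4) / 4 - returnProb 0 x + 0, ?_⟩
    refine ((((h1.add h2).add h3).add h4).div_const 4 |>.sub_const (returnProb 0 x) |>.add
      (tendsto_returnProb x)).congr fun n => ?_
    induction n with
    | zero => simp
    | succ n ih =>
      simp only [Finset.sum_range_succ] at ih ⊢
      rw [← ih, returnProb_succ n x]
      unfold avg
      ring

theorem tendsto_potentialKernel (x : ℤ × ℤ) :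
    Tendsto (fun n : ℕ => ∑ j ∈ Finset.range n, (returnProb j 0 - returnProb j x)) atTop
      (nhds (potentialKernel x)) := by
  rw [potentialKernel_eq]
  exact tendsto_nhds_limUnder (exists_tendsto_partialSums x)

theorem potentialKernel_even (k l : ℤ) :
    potentialKernel (k + l, k - l) = ∑' m, (diagProb m 0 0 - diagProb m k l) :=
  tendsto_nhds_unique (tendsto_potentialKernel _) (tendsto_potentialKernel_even k l)

theorem potentialKernel_zero : potentialKernel 0 = 0 := by
  refine tendsto_nhds_unique (tendsto_potentialKernel 0) ?_
  simp

theorem avg_potentialKernel (x : ℤ × ℤ) :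
    avg potentialKernel x = potentialKernel x + if x = 0 then 1 else 0 := by
  have h := ((((tendsto_potentialKernel (x + (1, 0))).add (tendsto_potentialKernel (x + (-1, 0)))).add
    (tendsto_potentialKernel (x + (0, 1)))).add (tendsto_potentialKernel (x + (0, -1)))).div_const 4
  have h2 := ((tendsto_potentialKernel x).add_const (returnProb 0 x)).sub (tendsto_returnProb x)
  rw [sub_zero, returnProb_zero] at h2
  refine tendsto_nhds_unique h (h2.congr fun n => ?_)
  induction n with
  | zero => simp [returnProb_zero]
  | succ n ih =>
    simp only [Finset.sum_range_succ] at ih ⊢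
    have h3 := returnProb_succ n x
    unfold avg at h3
    rw [h3]
    linarith

theorem avg_potentialKernel_of_ne {x : ℤ × ℤ} (hx : x ≠ 0) :
    avg potentialKernel x = potentialKernel x := by
  simp [avg_potentialKernel, hx]

theorem avg_potentialKernel_zero : avg potentialKernel 0 = 1 := by
  simp [avg_potentialKernel, potentialKernel_zero]

/-! ### Lattice symmetries of the potential kernel -/

theorem potentialKernel_congr {x y : ℤ × ℤ} (h : ∀ n, returnProb n x = returnProb n y) :
    potentialKernel x = potentialKernel y := by
  simp only [potentialKernel_eq, h]

theorem potentialKernel_reflect_fst (x1 x2 : ℤ) :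
    potentialKernel (-x1, x2) = potentialKernel (x1, x2) := by
  refine potentialKernel_congr fun n => ?_
  rw [returnProb_eq_mul, returnProb_eq_mul, ← lineProb_neg n (x1 + x2), ← lineProb_neg n (x1 - x2),
    mul_comm]
  congr 2 <;> ring

theorem potentialKernel_swap (x1 x2 : ℤ) :
    potentialKernel (x2, x1) = potentialKernel (x1, x2) := by
  refine potentialKernel_congr fun n => ?_
  rw [returnProb_eq_mul, returnProb_eq_mul, ← lineProb_neg n (x1 - x2)]
  congr 2 <;> ring

theorem potentialKernel_reflect_snd (x1 x2 : ℤ) :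
    potentialKernel (x1, -x2) = potentialKernel (x1, x2) := by
  rw [potentialKernel_swap, potentialKernel_reflect_fst, potentialKernel_swap]

theorem potentialKernel_neg (x : ℤ × ℤ) : potentialKernel (-x) = potentialKernel x := by
  obtain ⟨x1, x2⟩ := x
  rw [Prod.neg_mk, potentialKernel_reflect_fst, potentialKernel_reflect_snd]

theorem potentialKernel_natAbs (x1 x2 : ℤ) :
    potentialKernel ((x1.natAbs : ℤ), (x2.natAbs : ℤ)) = potentialKernel (x1, x2) := by
  rcases Int.natAbs_eq x1 with h1 | h1 <;> rcases Int.natAbs_eq x2 with h2 | h2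
  · rw [← h1, ← h2]
  · conv_rhs => rw [h1, h2, potentialKernel_reflect_snd]
  · conv_rhs => rw [h1, h2, potentialKernel_reflect_fst]
  · conv_rhs => rw [h1, h2, potentialKernel_reflect_fst, potentialKernel_reflect_snd]

theorem potentialKernel_nonneg_even (k l : ℤ) : 0 ≤ potentialKernel (k + l, k - l) := by
  rw [potentialKernel_even]
  refine tsum_nonneg fun m => ?_
  rw [sub_nonneg]
  unfold diagProb
  exact mul_le_mul (evenProb_le_center _ _) (evenProb_le_center _ _) (evenProb_nonneg _ _)
    (evenProb_nonneg _ _)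

theorem potentialKernel_unit {e : ℤ × ℤ} (he : e ∈ units) : potentialKernel e = 1 := by
  have h := avg_potentialKernel_zero
  unfold avg at h
  simp only [zero_add] at h
  rw [potentialKernel_reflect_fst 1 0, potentialKernel_reflect_snd 0 1, potentialKernel_swap 1 0] at h
  simp only [units, Finset.mem_insert, Finset.mem_singleton] at he
  rcases he with rfl | rfl | rfl | rfl
  · linarith
  · rw [potentialKernel_reflect_fst]; linarith
  · rw [potentialKernel_swap 1 0]; linarith
  · rw [potentialKernel_reflect_snd, potentialKernel_swap 1 0]; linarith

/-! ### Increments of the potential kernel along diagonals -/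

theorem potentialKernel_diag_sub (k : ℕ) (l : ℤ) :
    potentialKernel ((k : ℤ) + 1 + l, (k : ℤ) + 1 - l) - potentialKernel ((k : ℤ) + l, (k : ℤ) - l) =
      ∑' m, (diagProb m k l - diagProb m (k + 1) l) := by
  rw [potentialKernel_even, potentialKernel_even,
    ← (summable_diagProb _ _).tsum_sub (summable_diagProb _ _)]
  refine tsum_congr fun m => ?_
  ring

theorem potentialKernel_diag_sub_nonneg (k : ℕ) (l : ℤ) :
    0 ≤ potentialKernel ((k : ℤ) + 1 + l, (k : ℤ) + 1 - l) -
      potentialKernel ((k : ℤ) + l, (k : ℤ) - l) := by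
  rw [potentialKernel_diag_sub]
  exact tsum_nonneg fun m => diagProb_sub_nonneg m k l

theorem potentialKernel_diag_sub_le (k : ℕ) (l : ℤ) (hN : 1 ≤ (k : ℝ) ^ 2 + (l : ℝ) ^ 2) :
    potentialKernel ((k : ℤ) + 1 + l, (k : ℤ) + 1 - l) - potentialKernel ((k : ℤ) + l, (k : ℤ) - l) ≤
      16 * (2 * k + 1) / ((k : ℝ) ^ 2 + (l : ℝ) ^ 2) := by
  rw [potentialKernel_diag_sub]
  set N := (k : ℝ) ^ 2 + (l : ℝ) ^ 2 with hNdef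
  -- At time 0 only the origin has mass, and `hN` excludes it; the sum may thus start at time 1,
  -- where `diagProb_sub_le` applies.
  have h0 : diagProb 0 k l - diagProb 0 (k + 1) l = 0 := by
    rw [diagProb_sub]
    have : evenProb 0 k * evenProb 0 l = 0 := by
      rw [mul_eq_zero]
      by_contra! hc
      simp only [evenProb, lineProb, ne_eq, ite_eq_right_iff, not_forall] at hc
      obtain ⟨⟨h1, -⟩, ⟨h2, -⟩⟩ := hc
      have h3 : (k : ℝ) = 0 := by exact_mod_cast (by omega : (k : ℤ) = 0)
      have h4 : (l : ℝ) = 0 := by exact_mod_cast (by omega : l = 0)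
      rw [hNdef, h3, h4] at hN
      norm_num at hN
    rw [this, zero_mul]
  rw [(summable_diagProb_sub k l).tsum_eq_zero_add, h0, zero_add]
  refine Real.tsum_le_of_sum_range_le (fun m => diagProb_sub_nonneg _ _ _) fun n => ?_
  have hN0 : 0 < N := by linarith
  have h1 : ∑ m ∈ Finset.range n, (diagProb (m + 1) k l - diagProb (m + 1) (k + 1) l) ≤
      16 * (2 * k + 1) * (1 / N - 1 / ((n : ℝ) + N)) := by
    induction n with
    | zero => simp
    | succ n ih =>
      rw [Finset.sum_range_succ]
      have := diagProb_sub_le n k l hN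
      rw [← hNdef] at this
      linarith
  refine h1.trans ?_
  rw [mul_div_assoc]
  rw [div_eq_mul_one_div (2 * (k : ℝ) + 1) N, ← mul_assoc]
  gcongr
  have : 0 ≤ 1 / ((n : ℝ) + N) := by positivity
  linarith

/-- Only the times in [M, 2M) with M = 2(k + 1)² are kept. On this diffusive scale the Gaussian
factor is at least 1/2, so there are M terms of order k/M², which add up to order 1/k. -/
theorem le_potentialKernel_diag_sub (k : ℕ) :
    1 / (256 * (k + 1 : ℝ)) ≤
      potentialKernel ((k : ℤ) + 1, (k : ℤ) + 1) - potentialKernel ((k : ℤ), (k : ℤ)) := by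
  have h := potentialKernel_diag_sub k 0
  simp only [add_zero, sub_zero] at h
  rw [h]
  set M := 2 * (k + 1) ^ 2 with hM
  have hMpos : 0 < M := by positivity
  have hterm : ∀ m ∈ Finset.Ico M (2 * M), (2 * k + 1 : ℝ) / (64 * (M : ℝ) ^ 2) ≤
      diagProb m k 0 - diagProb m (k + 1) 0 := by
    intro m hm
    rw [Finset.mem_Ico] at hm
    obtain ⟨m', rfl⟩ : ∃ m', m = m' + 1 := ⟨m - 1, by omega⟩
    rw [diagProb_sub]
    have h1 := le_evenProb m' k
    have h2 := le_evenProb_center_sq m'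
    have h0 := evenProb_nonneg (m' + 1) 0
    have hMm : (2 * (k + 1) ^ 2 : ℝ) ≤ m' + 1 := by exact_mod_cast hm.1
    have hmM : (m' + 1 : ℝ) ≤ 2 * M := by exact_mod_cast hm.2.le
    have hk0 : (0 : ℝ) ≤ k := by positivity
    have h3 : (1 : ℝ) / 2 ≤ 1 - k ^ 2 / (m' + 1) := by
      have : (k : ℝ) ^ 2 / (m' + 1) ≤ 1 / 2 := by
        rw [div_le_div_iff₀ (by positivity) (by norm_num)]
        nlinarith
      linarith
    have h4 : evenProb (m' + 1) 0 * (1 / 2) ≤ evenProb (m' + 1) k :=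
      (mul_le_mul_of_nonneg_left h3 h0).trans h1
    calc (2 * k + 1 : ℝ) / (64 * (M : ℝ) ^ 2)
        ≤ (2 * k + 1 : ℝ) / (16 * ((m' : ℝ) + 1) ^ 2) := by
          refine div_le_div_of_nonneg_left (by positivity) (by positivity) ?_
          nlinarith [show (0 : ℝ) ≤ m' by positivity]
      _ = (1 / (4 * ((m' : ℝ) + 1)) * (1 / 2)) * ((2 * k + 1) / (2 * (m' + 1))) := by
          field_simp; norm_num
      _ ≤ (evenProb (m' + 1) 0 ^ 2 * (1 / 2)) * ((2 * k + 1) / (((m' + 1 : ℕ) : ℝ) + k + 1)) := by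
          refine mul_le_mul (mul_le_mul_of_nonneg_right h2 (by norm_num)) ?_ (by positivity)
            (by positivity)
          refine div_le_div_of_nonneg_left (by positivity) (by positivity) ?_
          push_cast
          nlinarith
      _ ≤ _ := by
          refine mul_le_mul_of_nonneg_right ?_ (by positivity)
          nlinarith
  refine le_trans ?_ ((summable_diagProb_sub k 0).sum_le_tsum (Finset.Ico M (2 * M))
    fun m _ => diagProb_sub_nonneg m k 0)
  refine le_trans ?_ (Finset.card_nsmul_le_sum _ _ _ hterm)
  rw [Nat.card_Ico, show 2 * M - M = M by omega, nsmul_eq_mul]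
  have hMr : (M : ℝ) = 2 * (k + 1) ^ 2 := by rw [hM]; push_cast; ring
  have : (M : ℝ) * ((2 * k + 1) / (64 * M ^ 2)) = (2 * k + 1) / (64 * M) := by
    field_simp
  rw [this, hMr, div_le_div_iff₀ (by positivity) (by positivity)]
  nlinarith [show (0 : ℝ) ≤ k by positivity]

/-! ### Regularity and growth of the potential kernel -/

/-- The sup norm on `ℤ²`. -/
def nrm (x : ℤ × ℤ) : ℕ := max x.1.natAbs x.2.natAbs

theorem nrm_eq_zero {x : ℤ × ℤ} : nrm x = 0 ↔ x = 0 := by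
  obtain ⟨x1, x2⟩ := x
  simp only [nrm, Prod.mk_eq_zero]
  omega

theorem nrm_zero : nrm 0 = 0 := rfl

theorem nrm_pos {x : ℤ × ℤ} (h : x ≠ 0) : 0 < nrm x :=
  Nat.pos_of_ne_zero fun h0 => h (nrm_eq_zero.1 h0)

theorem nrm_neg (x : ℤ × ℤ) : nrm (-x) = nrm x := by simp [nrm]

theorem nrm_sub_comm (x y : ℤ × ℤ) : nrm (x - y) = nrm (y - x) := by
  rw [← nrm_neg, neg_sub]

theorem nrm_add_le (x y : ℤ × ℤ) : nrm (x + y) ≤ nrm x + nrm y := by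
  simp only [nrm, Prod.fst_add, Prod.snd_add]; omega

theorem nrm_sub_le (x y z : ℤ × ℤ) : nrm (x - z) ≤ nrm (x - y) + nrm (y - z) := by
  have := nrm_add_le (x - y) (y - z)
  rwa [sub_add_sub_cancel] at this

theorem nrm_le_add_sub (x y : ℤ × ℤ) : nrm x ≤ nrm y + nrm (x - y) := by
  have := nrm_add_le y (x - y)
  rwa [add_sub_cancel] at this

theorem nrm_unit {e : ℤ × ℤ} (he : e ∈ units) : nrm e = 1 := by
  simp only [units, Finset.mem_insert, Finset.mem_singleton] at he
  rcases he with rfl | rfl | rfl | rfl <;> rfl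

theorem abs_diag_step_of_nonneg (x : ℤ × ℤ) (hx : x ≠ 0) (he : (x.1 + x.2) % 2 = 0)
    (h0 : 0 ≤ x.1 + x.2) :
    |potentialKernel (x + (1, 1)) - potentialKernel x| ≤ 96 / nrm x := by
  obtain ⟨x1, x2⟩ := x
  simp only at he h0
  obtain ⟨k, hk⟩ : ∃ k : ℕ, x1 + x2 = 2 * k := ⟨((x1 + x2) / 2).toNat, by omega⟩
  obtain ⟨l, hl⟩ : ∃ l : ℤ, x1 - x2 = 2 * l := ⟨(x1 - x2) / 2, by omega⟩
  have e1 : ((x1, x2) : ℤ × ℤ) = ((k : ℤ) + l, (k : ℤ) - l) := by ext <;> simp only <;> omega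
  have e2 : ((x1, x2) : ℤ × ℤ) + (1, 1) = ((k : ℤ) + 1 + l, (k : ℤ) + 1 - l) := by
    ext <;> simp only [Prod.mk_add_mk] <;> omega
  have hn := nrm_pos hx
  have hn1 : nrm (x1, x2) ^ 2 ≤ 2 * (k ^ 2 + l.natAbs ^ 2) := by
    have h1 : nrm (x1, x2) ≤ k + l.natAbs := by simp only [nrm]; omega
    refine (Nat.pow_le_pow_left h1 2).trans ?_
    generalize l.natAbs = m
    zify
    nlinarith [sq_nonneg ((k : ℤ) - m)]
  have hn2 : k ≤ nrm (x1, x2) := by simp only [nrm]; omega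
  have hl2 : ((l.natAbs : ℝ)) ^ 2 = (l : ℝ) ^ 2 := by
    rw [Nat.cast_natAbs, Int.cast_abs, sq_abs]
  have hn1' : (nrm (x1, x2) : ℝ) ^ 2 ≤ 2 * ((k : ℝ) ^ 2 + (l : ℝ) ^ 2) := by
    rw [← hl2]; exact_mod_cast hn1
  have hn2' : (k : ℝ) ≤ nrm (x1, x2) := by exact_mod_cast hn2
  have hn' : (1 : ℝ) ≤ nrm (x1, x2) := by exact_mod_cast hn
  have hN : 1 ≤ (k : ℝ) ^ 2 + (l : ℝ) ^ 2 := by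
    rw [← hl2]
    have h1 : 1 ≤ k ^ 2 + l.natAbs ^ 2 := by nlinarith
    exact_mod_cast h1
  rw [e2, e1]
  rw [abs_of_nonneg (potentialKernel_diag_sub_nonneg k l), ← e1]
  refine (le_of_eq (by rw [e1])).trans ((potentialKernel_diag_sub_le k l hN).trans ?_)
  rw [div_le_div_iff₀ (by positivity) (by positivity)]
  nlinarith

/-- The point reflection x ↦ -(x + (1, 1)) handles x₁ + x₂ < 0, and axis reflections give the other
diagonals. The summand `c` pays for the step from (-1, -1) into 0. -/
theorem exists_abs_diag_step : ∃ C : ℝ, 1 ≤ C ∧ ∀ x : ℤ × ℤ, x ≠ 0 → (x.1 + x.2) % 2 = 0 →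
    ∀ s : ℤ × ℤ, nrm s = 1 → (s.1 + s.2) % 2 = 0 →
    |potentialKernel (x + s) - potentialKernel x| ≤ C / nrm x := by
  set c := |potentialKernel (1, 1)| with hc
  have hc0 : 0 ≤ c := abs_nonneg _
  have key : ∀ x : ℤ × ℤ, x ≠ 0 → (x.1 + x.2) % 2 = 0 →
      |potentialKernel (x + (1, 1)) - potentialKernel x| ≤ (192 + c) / nrm x := by
    intro x hx he
    have hn := nrm_pos hx
    have hn' : (1 : ℝ) ≤ nrm x := by exact_mod_cast hn
    rcases le_or_gt 0 (x.1 + x.2) with h | h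
    · refine (abs_diag_step_of_nonneg x hx he h).trans ?_
      gcongr
      linarith
    · by_cases hx1 : x + (1, 1) = 0
      · have hx2 : x = -(1, 1) := eq_neg_of_add_eq_zero_left hx1
        rw [hx1, hx2, potentialKernel_neg, potentialKernel_zero, zero_sub, abs_neg, ← hc]
        simp [nrm]
      · have h1 := abs_diag_step_of_nonneg (-(x + (1, 1))) (neg_ne_zero.2 hx1)
          (by simp only [Prod.fst_neg, Prod.snd_neg, Prod.fst_add, Prod.snd_add]; omega)
          (by simp only [Prod.fst_neg, Prod.snd_neg, Prod.fst_add, Prod.snd_add]; omega)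
        rw [neg_add, neg_add_cancel_right, ← neg_add, potentialKernel_neg, potentialKernel_neg,
          nrm_neg] at h1
        rw [abs_sub_comm]
        refine h1.trans ?_
        have hp := nrm_pos hx1
        have h2 : nrm x ≤ 2 * nrm (x + (1, 1)) := by
          simp only [nrm, Prod.fst_add, Prod.snd_add] at hp ⊢
          omega
        have h2' : (nrm x : ℝ) ≤ 2 * nrm (x + (1, 1)) := by exact_mod_cast h2
        have hp' : (0 : ℝ) < nrm (x + (1, 1)) := by exact_mod_cast hp
        rw [div_le_div_iff₀ hp' (by linarith)]
        nlinarith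
  refine ⟨192 + c, by linarith, fun x hx he s hs hs2 => ?_⟩
  obtain ⟨x1, x2⟩ := x
  obtain ⟨s1, s2⟩ := s
  simp only [nrm] at hs
  simp only at he hs2
  have h1 : s1 = 1 ∨ s1 = -1 := by omega
  have h2 : s2 = 1 ∨ s2 = -1 := by omega
  rcases h1 with rfl | rfl <;> rcases h2 with rfl | rfl
  · exact key _ hx he
  · have := key (x1, -x2) (by simpa using hx) (by simp only; omega)
    rw [Prod.mk_add_mk] at this ⊢
    rw [potentialKernel_reflect_snd, ← potentialKernel_reflect_snd, neg_add, neg_neg] at this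
    simpa [nrm] using this
  · have := key (-x1, x2) (by simpa using hx) (by simp only; omega)
    rw [Prod.mk_add_mk] at this ⊢
    rw [potentialKernel_reflect_fst x1, ← potentialKernel_reflect_fst, neg_add, neg_neg] at this
    simpa [nrm] using this
  · have := key (-x1, -x2) (by simpa using hx) (by simp only; omega)
    rw [Prod.mk_add_mk] at this ⊢
    rw [potentialKernel_reflect_fst x1, potentialKernel_reflect_snd,
      ← potentialKernel_reflect_fst, ← potentialKernel_reflect_snd, neg_add, neg_neg,
      neg_add, neg_neg] at this
    simpa [nrm] using this

/-- A unit step changes the parity class, so harmonicity is used: at an even x, the value a(x + (1,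
0)) is the mean of a over four even sites, each within one or two diagonal steps of x. -/
theorem exists_abs_unit_step : ∃ C : ℝ, 1 ≤ C ∧ ∀ x : ℤ × ℤ, x ≠ 0 → ∀ e ∈ units,
    |potentialKernel (x + e) - potentialKernel x| ≤ C / nrm x := by
  obtain ⟨C, hC1, hC⟩ := exists_abs_diag_step
  have heven : ∀ x : ℤ × ℤ, x ≠ 0 → (x.1 + x.2) % 2 = 0 →
      |potentialKernel (x + (1, 0)) - potentialKernel x| ≤ 3 * C / nrm x := by
    intro x hx he
    have hn := nrm_pos hx
    have hn' : (1 : ℝ) ≤ nrm x := by exact_mod_cast hn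
    have htwo : |potentialKernel (x + (2, 0)) - potentialKernel x| ≤ 3 * C / nrm x := by
      have hstep : ∀ s : ℤ × ℤ, nrm s = 1 → (s.1 + s.2) % 2 = 0 → nrm ((2, 0) - s) = 1 →
          x + s ≠ 0 → |potentialKernel (x + (2, 0)) - potentialKernel x| ≤ 3 * C / nrm x := by
        intro s hs hs2 hs3 hxs
        have h1 := hC x hx he s hs hs2
        have h2 := hC (x + s) hxs (by simp only [Prod.fst_add, Prod.snd_add]; omega) ((2, 0) - s) hs3
          (by simp only [Prod.fst_sub, Prod.snd_sub]; omega)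
        rw [add_assoc, add_sub_cancel] at h2
        have hp := nrm_pos hxs
        have h3 : nrm x ≤ 2 * nrm (x + s) := by
          simp only [nrm, Prod.fst_add, Prod.snd_add] at hp hs ⊢
          omega
        have h3' : (nrm x : ℝ) ≤ 2 * nrm (x + s) := by exact_mod_cast h3
        have hp' : (0 : ℝ) < nrm (x + s) := by exact_mod_cast hp
        have h4 : C / nrm (x + s) ≤ 2 * C / nrm x := by
          rw [div_le_div_iff₀ hp' (by linarith)]; nlinarith
        have h5 : 3 * C / nrm x = 2 * C / nrm x + C / nrm x := by ring
        rw [h5]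
        refine (abs_sub_le _ (potentialKernel (x + s)) _).trans ?_
        linarith
      -- The intermediate site on the way to x + (2, 0) must not be 0, where the diagonal bound says
      -- nothing; the other diagonal is then used.
      by_cases hx1 : x + (1, 1) = 0
      · refine hstep (1, -1) rfl rfl rfl ?_
        rw [eq_neg_of_add_eq_zero_left hx1]
        decide
      · exact hstep (1, 1) rfl rfl rfl hx1
    have h1 := hC x hx he (1, 1) rfl rfl
    have h2 := hC x hx he (1, -1) rfl rfl
    have hne : x + (1, 0) ≠ 0 := by
      intro h0
      have := congrArg (fun y : ℤ × ℤ => y.1 + y.2) h0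
      simp only [Prod.fst_add, Prod.snd_add, Prod.fst_zero, Prod.snd_zero] at this
      omega
    have h3 := avg_potentialKernel_of_ne hne
    unfold avg at h3
    simp only [add_assoc, Prod.mk_add_mk] at h3
    norm_num at h3
    have h4 : x + ((0 : ℤ), (0 : ℤ)) = x := add_zero x
    rw [h4] at h3
    have h5 : 3 * C / nrm x = 3 * (C / nrm x) := by ring
    rw [h5] at htwo ⊢
    have h6 : 0 ≤ C / nrm x := by positivity
    rw [abs_le] at *
    constructor <;> linarith
  have hright : ∀ x : ℤ × ℤ, x ≠ 0 →
      |potentialKernel (x + (1, 0)) - potentialKernel x| ≤ 6 * C / nrm x := by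
    intro x hx
    have hn := nrm_pos hx
    have hn' : (1 : ℝ) ≤ nrm x := by exact_mod_cast hn
    by_cases he : (x.1 + x.2) % 2 = 0
    · refine (heven x hx he).trans ?_
      gcongr
      linarith
    · by_cases hx1 : x + (1, 0) = 0
      · have hx2 : x = (-1, 0) := eq_neg_of_add_eq_zero_left hx1
        rw [hx1, hx2, potentialKernel_zero, potentialKernel_unit (by simp [units])]
        simp [nrm]
        linarith
      · obtain ⟨x1, x2⟩ := x
        rw [Prod.mk_add_mk] at hx1 ⊢
        simp only [Prod.mk_eq_zero, ne_eq, not_and, add_zero] at hx1 hx he ⊢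
        -- Reflection in the first coordinate turns the step from the odd site x to x + (1, 0) into
        -- one that starts at an even site.
        have h1 := heven (-(x1 + 1), x2) (by rw [ne_eq, Prod.mk_eq_zero]; omega) (by simp only; omega)
        rw [Prod.mk_add_mk, show -(x1 + 1) + 1 = -x1 by ring, add_zero, potentialKernel_reflect_fst,
          potentialKernel_reflect_fst] at h1
        rw [abs_sub_comm]
        refine h1.trans ?_
        have h2 : nrm (x1, x2) ≤ 2 * nrm (-(x1 + 1), x2) := by
          simp only [nrm]
          omega
        have h2' : (nrm (x1, x2) : ℝ) ≤ 2 * nrm (-(x1 + 1), x2) := by exact_mod_cast h2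
        rw [div_le_div_iff₀ (by linarith) (by linarith)]
        nlinarith
  refine ⟨6 * C, by linarith, fun x hx e he => ?_⟩
  obtain ⟨x1, x2⟩ := x
  have hswap : nrm (x2, x1) = nrm (x1, x2) := by simp only [nrm]; exact max_comm _ _
  simp only [units, Finset.mem_insert, Finset.mem_singleton] at he
  simp only [Prod.mk_eq_zero, ne_eq, not_and] at hx
  rcases he with rfl | rfl | rfl | rfl
  · exact hright _ (by simpa using hx)
  · have := hright (-x1, x2) (by simpa using hx)
    rw [Prod.mk_add_mk, show -x1 + 1 = -(x1 + -1) by ring, potentialKernel_reflect_fst,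
      potentialKernel_reflect_fst] at this
    simpa [nrm] using this
  · have := hright (x2, x1) (by simpa [imp_not_comm] using hx)
    rw [Prod.mk_add_mk, potentialKernel_swap x1 x2, potentialKernel_swap (x1 + 0) (x2 + 1), hswap]
      at this
    simpa using this
  · have := hright (-x2, x1) (by simpa [imp_not_comm] using hx)
    rw [Prod.mk_add_mk, show -x2 + 1 = -(x2 + -1) by ring, potentialKernel_reflect_fst,
      potentialKernel_reflect_fst, potentialKernel_swap x1 x2,
      potentialKernel_swap (x1 + 0) (x2 + -1)] at this
    have h2 : nrm (-x2, x1) = nrm (x1, x2) := by rw [← hswap]; simp [nrm]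
    rw [h2] at this
    simpa using this

theorem exists_abs_horizontal : ∃ C : ℝ, 1 ≤ C ∧ ∀ (R : ℕ) (p p' s : ℤ), 0 < R → p ≤ p' →
    (∀ t, p ≤ t → t ≤ p' → R ≤ nrm (t, s)) →
    |potentialKernel (p', s) - potentialKernel (p, s)| ≤ (p' - p) * (C / R) := by
  obtain ⟨C, hC1, hC⟩ := exists_abs_unit_step
  refine ⟨C, hC1, fun R p p' s hR hp => ?_⟩
  induction p', hp using Int.leInduction with
  | base => intro _; simp
  | succ q hq ih =>
    intro h
    have h1 := ih fun t ht ht' => h t ht (by omega)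
    have hn := h q hq (by omega)
    have hne : ((q, s) : ℤ × ℤ) ≠ 0 := by
      intro h0; rw [h0] at hn; simp [nrm] at hn; omega
    have h2 := hC (q, s) hne (1, 0) (by simp [units])
    rw [Prod.mk_add_mk, add_zero] at h2
    have hn' : (R : ℝ) ≤ nrm (q, s) := by exact_mod_cast hn
    have hR' : (0 : ℝ) < R := by exact_mod_cast hR
    have h3 : C / nrm (q, s) ≤ C / R := by gcongr
    push_cast
    refine (abs_sub_le _ (potentialKernel (q, s)) _).trans ?_
    linarith

/-- The potential kernel is Lipschitz, with constant `O(1 / R)`, at distance `R` from `0`. -/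
theorem exists_abs_sub_near : ∃ C : ℝ, 1 ≤ C ∧ ∀ u v : ℤ × ℤ, u ≠ 0 → 2 * nrm (u - v) ≤ nrm u →
    |potentialKernel u - potentialKernel v| ≤ C * (nrm (u - v) / nrm u) := by
  obtain ⟨C, hC1, hC⟩ := exists_abs_horizontal
  have hor : ∀ (R : ℕ) (p p' s : ℤ), 0 < R → (∀ t, min p p' ≤ t → t ≤ max p p' → R ≤ nrm (t, s)) →
      |potentialKernel (p', s) - potentialKernel (p, s)| ≤ |(p' : ℝ) - p| * (C / R) := by
    intro R p p' s hR h
    rcases le_total p p' with hp | hp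
    · rw [min_eq_left hp, max_eq_right hp] at h
      rw [abs_of_nonneg (a := (p' : ℝ) - p) (by rw [sub_nonneg]; exact_mod_cast hp)]
      exact hC R p p' s hR hp h
    · rw [min_eq_right hp, max_eq_left hp] at h
      rw [abs_sub_comm, abs_sub_comm (p' : ℝ),
        abs_of_nonneg (a := (p : ℝ) - p') (by rw [sub_nonneg]; exact_mod_cast hp)]
      exact hC R p' p s hR hp h
  refine ⟨8 * C, by linarith, fun u v hu huv => ?_⟩
  obtain ⟨u1, u2⟩ := u
  obtain ⟨v1, v2⟩ := v
  have hn := nrm_pos hu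
  have hn' : (0 : ℝ) < nrm (u1, u2) := by exact_mod_cast hn
  -- Rounding up keeps `R` positive. Both legs of the path u → (v₁, u₂) → v stay within |u - v| ≤
  -- |u|/2 of u, hence at norm at least `R`.
  set R := (nrm (u1, u2) + 1) / 2 with hR
  have hR0 : 0 < R := by omega
  have hR0' : (0 : ℝ) < R := by exact_mod_cast hR0
  have hR2 : (nrm (u1, u2) : ℝ) ≤ 2 * R := by exact_mod_cast (by omega : nrm (u1, u2) ≤ 2 * R)
  simp only [Prod.mk_sub_mk] at huv ⊢
  have h1 := hor R u1 v1 u2 hR0 (by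
    intro t ht1 ht2
    simp only [nrm] at huv hR ⊢
    omega)
  have h2 := hor R u2 v2 v1 hR0 (by
    intro t ht1 ht2
    simp only [nrm] at huv hR ⊢
    omega)
  rw [potentialKernel_swap v1 v2, potentialKernel_swap v1 u2] at h2
  have hb1 : |(v1 : ℝ) - u1| ≤ nrm (u1 - v1, u2 - v2) := by
    have : |v1 - u1| ≤ (nrm (u1 - v1, u2 - v2) : ℤ) := by
      rw [Int.abs_eq_natAbs]; simp only [nrm]; omega
    exact_mod_cast this
  have hb2 : |(v2 : ℝ) - u2| ≤ nrm (u1 - v1, u2 - v2) := by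
    have : |v2 - u2| ≤ (nrm (u1 - v1, u2 - v2) : ℤ) := by
      rw [Int.abs_eq_natAbs]; simp only [nrm]; omega
    exact_mod_cast this
  have hCR : C / R ≤ 4 * C / nrm (u1, u2) := by
    rw [div_le_div_iff₀ hR0' hn']; nlinarith
  have hCR0 : 0 ≤ C / R := by positivity
  rw [abs_sub_comm]
  refine (abs_sub_le _ (potentialKernel (v1, u2)) _).trans ?_
  have h3 : |(v1 : ℝ) - u1| * (C / R) ≤ nrm (u1 - v1, u2 - v2) * (4 * C / nrm (u1, u2)) := by
    gcongr
  have h4 : |(v2 : ℝ) - u2| * (C / R) ≤ nrm (u1 - v1, u2 - v2) * (4 * C / nrm (u1, u2)) := by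
    gcongr
  have h5 : 8 * C * ((nrm (u1 - v1, u2 - v2) : ℝ) / nrm (u1, u2)) =
      2 * (nrm (u1 - v1, u2 - v2) * (4 * C / nrm (u1, u2))) := by ring
  rw [h5]
  linarith

/-- The route passes through the axis points (|u|, 0) and (|v|, 0): sliding along a sphere of radius
r costs at most r steps of size O(1/r), and moving along the axis from m to n ≤ Lm costs O(L). -/
theorem exists_abs_sub_comparable : ∃ C : ℝ, 1 ≤ C ∧ ∀ (L : ℕ) (u v : ℤ × ℤ), u ≠ 0 → v ≠ 0 →
    nrm u ≤ L * nrm v → nrm v ≤ L * nrm u →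
    |potentialKernel u - potentialKernel v| ≤ (2 + L) * C := by
  obtain ⟨C, hC1, hC⟩ := exists_abs_horizontal
  have axis : ∀ u : ℤ × ℤ, u ≠ 0 →
      |potentialKernel u - potentialKernel ((nrm u : ℤ), 0)| ≤ C := by
    have hnat : ∀ p s : ℕ, 0 < p → s ≤ p →
        |potentialKernel ((p : ℤ), (s : ℤ)) - potentialKernel ((p : ℤ), 0)| ≤ C := by
      intro p s hp hs
      have := hC p 0 s p hp (by omega) (by intro t _ _; simp only [nrm]; omega)
      rw [potentialKernel_swap p s, potentialKernel_swap p 0] at this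
      refine this.trans ?_
      push_cast
      have hp' : (0 : ℝ) < p := by exact_mod_cast hp
      have hs' : (s : ℝ) ≤ p := by exact_mod_cast hs
      rw [sub_zero, mul_div_assoc', div_le_iff₀ hp']
      nlinarith
    rintro ⟨u1, u2⟩ hu
    have hn := nrm_pos hu
    rw [← potentialKernel_natAbs]
    rcases le_total u2.natAbs u1.natAbs with h | h
    · have : nrm (u1, u2) = u1.natAbs := by simp only [nrm]; omega
      rw [this] at hn ⊢
      exact hnat _ _ hn h
    · have : nrm (u1, u2) = u2.natAbs := by simp only [nrm]; omega
      rw [this] at hn ⊢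
      rw [potentialKernel_swap]
      exact hnat _ _ hn h
  have along : ∀ (L m n : ℕ), 0 < m → m ≤ n → n ≤ L * m →
      |potentialKernel ((n : ℤ), 0) - potentialKernel ((m : ℤ), 0)| ≤ L * C := by
    intro L m n hm hmn hn
    refine (hC m m n 0 hm (by omega) (by intro t _ _; simp only [nrm]; omega)).trans ?_
    push_cast
    have hm' : (0 : ℝ) < m := by exact_mod_cast hm
    have hn' : (n : ℝ) ≤ L * m := by exact_mod_cast hn
    rw [mul_div_assoc', div_le_iff₀ hm']
    nlinarith
  refine ⟨C, hC1, fun L u v hu hv huv hvu => ?_⟩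
  have h1 := axis u hu
  have h2 := axis v hv
  have h3 : |potentialKernel ((nrm u : ℤ), 0) - potentialKernel ((nrm v : ℤ), 0)| ≤ L * C := by
    rcases le_total (nrm u) (nrm v) with h | h
    · rw [abs_sub_comm]
      exact along L _ _ (nrm_pos hu) h hvu
    · exact along L _ _ (nrm_pos hv) h huv
  rw [abs_le] at *
  constructor <;> linarith

/-- The potential kernel varies by `O(|u - v| / |u|)` between sites of comparable norms. -/
theorem exists_abs_sub_le (L : ℕ) : ∃ C : ℝ, 1 ≤ C ∧ ∀ u v : ℤ × ℤ, u ≠ 0 → v ≠ 0 →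
    nrm u ≤ L * nrm v → nrm v ≤ L * nrm u →
    |potentialKernel u - potentialKernel v| ≤ C * (nrm (u - v) / nrm u) := by
  obtain ⟨C1, hC1, h1⟩ := exists_abs_sub_near
  obtain ⟨C2, hC2, h2⟩ := exists_abs_sub_comparable
  have hL : (0 : ℝ) ≤ L := by positivity
  refine ⟨C1 + 2 * ((2 + L) * C2), by nlinarith, fun u v hu hv huv hvu => ?_⟩
  have hn : (0 : ℝ) < nrm u := by exact_mod_cast nrm_pos hu
  have h0 : (0 : ℝ) ≤ (nrm (u - v) : ℝ) / nrm u := by positivity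
  rcases le_or_gt (2 * nrm (u - v)) (nrm u) with h | h
  · refine (h1 u v hu h).trans ?_
    gcongr
    nlinarith
  · refine (h2 L u v hu hv huv hvu).trans ?_
    have h3 : (1 : ℝ) ≤ 2 * ((nrm (u - v) : ℝ) / nrm u) := by
      rw [mul_div_assoc', le_div_iff₀ hn, one_mul]
      exact_mod_cast h.le
    have h4 : 0 ≤ (2 + (L : ℝ)) * C2 := by positivity
    nlinarith

theorem potentialKernel_nonneg (x : ℤ × ℤ) : 0 ≤ potentialKernel x := by
  have heven : ∀ y : ℤ × ℤ, (y.1 + y.2) % 2 = 0 → 0 ≤ potentialKernel y := by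
    intro y hy
    rw [show y = ((y.1 + y.2) / 2 + (y.1 - y.2) / 2, (y.1 + y.2) / 2 - (y.1 - y.2) / 2) by
      ext <;> simp only <;> omega]
    exact potentialKernel_nonneg_even _ _
  by_cases hx : (x.1 + x.2) % 2 = 0
  · exact heven x hx
  · rw [← avg_potentialKernel_of_ne (by rintro rfl; simp at hx)]
    have h1 := heven (x + (1, 0)) (by simp only [Prod.fst_add, Prod.snd_add]; omega)
    have h2 := heven (x + (-1, 0)) (by simp only [Prod.fst_add, Prod.snd_add]; omega)
    have h3 := heven (x + (0, 1)) (by simp only [Prod.fst_add, Prod.snd_add]; omega)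
    have h4 := heven (x + (0, -1)) (by simp only [Prod.fst_add, Prod.snd_add]; omega)
    unfold avg
    linarith

/-- The potential kernel grows at least logarithmically. -/
theorem exists_growth (J : ℝ) : ∃ K : ℕ, ∀ u v : ℤ × ℤ, K * max (nrm v) 1 ≤ nrm u →
    potentialKernel v + J ≤ potentialKernel u := by
  obtain ⟨C, hC1, hC⟩ := exists_abs_sub_comparable
  set f : ℕ → ℝ := fun n => potentialKernel ((n : ℤ), (n : ℤ)) with hf
  have hstep : ∀ k : ℕ, 1 / (256 * (k + 1 : ℝ)) ≤ f (k + 1) - f k := by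
    intro k
    have := le_potentialKernel_diag_sub k
    simpa [hf] using this
  have hmono : Monotone f := monotone_nat_of_le_succ fun k => by
    have := hstep k
    have h0 : (0 : ℝ) ≤ 1 / (256 * (k + 1 : ℝ)) := by positivity
    linarith
  -- There are n increments between n and 2n, each at least 1/(512n); every doubling gains a fixed
  -- amount.
  have hdouble : ∀ n : ℕ, 1 ≤ n → f n + 1 / 512 ≤ f (2 * n) := by
    intro n hn
    have hn' : (0 : ℝ) < n := by exact_mod_cast hn
    have h : ∀ i ≤ n, f n + i * (1 / (512 * n)) ≤ f (n + i) := by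
      intro i hi
      induction i with
      | zero => simp
      | succ i ih =>
        have h1 := ih (by omega)
        have h2 := hstep (n + i)
        have h3 : 1 / (512 * (n : ℝ)) ≤ 1 / (256 * (((n + i : ℕ) : ℝ) + 1)) := by
          have : ((n + i : ℕ) : ℝ) + 1 ≤ 2 * n := by exact_mod_cast (by omega : n + i + 1 ≤ 2 * n)
          exact one_div_le_one_div_of_le (by positivity) (by linarith)
        rw [← add_assoc]
        push_cast
        linarith
    have := h n le_rfl
    rw [two_mul]
    refine le_trans ?_ this
    have : (n : ℝ) * (1 / (512 * n)) = 1 / 512 := by field_simp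
    rw [this]
  have hpow : ∀ i n : ℕ, 1 ≤ n → f n + i * (1 / 512) ≤ f (2 ^ i * n) := by
    intro i n hn
    induction i with
    | zero => simp
    | succ i ih =>
      have h1 := hdouble (2 ^ i * n) (by have : 0 < 2 ^ i * n := by positivity
                                         omega)
      rw [pow_succ, mul_comm (2 ^ i) 2, mul_assoc]
      push_cast
      linarith
  have hdiag : ∀ u : ℤ × ℤ, u ≠ 0 → |potentialKernel u - f (nrm u)| ≤ (2 + (1 : ℕ)) * C := by
    intro u hu
    have hn := nrm_pos hu
    have h1 : nrm ((nrm u : ℤ), (nrm u : ℤ)) = nrm u := by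
      generalize nrm u = n
      simp [nrm]
    refine hC 1 u _ hu ?_ ?_ ?_
    · intro h0
      rw [Prod.mk_eq_zero] at h0
      omega
    · rw [h1]; omega
    · rw [h1]; omega
  -- The gain i/512 has to exceed J plus 3C twice, the price of replacing u and v by diagonal
  -- points.
  obtain ⟨i, hi⟩ := exists_nat_gt (512 * (6 * C + J))
  refine ⟨2 ^ i, fun u v huv => ?_⟩
  have hu : u ≠ 0 := by
    rintro rfl
    have : 0 < 2 ^ i * max (nrm v) 1 := by positivity
    simp [nrm] at huv this
  have h1 := hdiag u hu
  have h2 := hpow i (max (nrm v) 1) (le_max_right _ _)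
  have h3 := hmono huv
  have h4 : potentialKernel v ≤ f (max (nrm v) 1) + 3 * C := by
    by_cases hv : v = 0
    · have h5 : 0 ≤ f (max (nrm v) 1) := potentialKernel_nonneg _
      rw [hv, potentialKernel_zero]
      rw [hv] at h5
      linarith
    · rw [max_eq_left (nrm_pos hv)]
      have := hdiag v hv
      rw [abs_le] at this
      push_cast at this
      linarith
  rw [abs_le] at h1
  push_cast at h1
  linarith

/-! ### Discrete potential theory -/

theorem avg_add (f g : ℤ × ℤ → ℝ) (x : ℤ × ℤ) :
    avg (fun w => f w + g w) x = avg f x + avg g x := by unfold avg; ring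

theorem avg_sub (f g : ℤ × ℤ → ℝ) (x : ℤ × ℤ) :
    avg (fun w => f w - g w) x = avg f x - avg g x := by unfold avg; ring

theorem avg_neg (f : ℤ × ℤ → ℝ) (x : ℤ × ℤ) : avg (fun w => -f w) x = -avg f x := by
  unfold avg; ring

theorem avg_const_mul (c : ℝ) (f : ℤ × ℤ → ℝ) (x : ℤ × ℤ) :
    avg (fun w => c * f w) x = c * avg f x := by unfold avg; ring

theorem avg_mul_const (c : ℝ) (f : ℤ × ℤ → ℝ) (x : ℤ × ℤ) :
    avg (fun w => f w * c) x = avg f x * c := by unfold avg; ring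

theorem avg_const (c : ℝ) (x : ℤ × ℤ) : avg (fun _ => c) x = c := by unfold avg; ring

theorem avg_sum {ι : Type*} (s : Finset ι) (f : ι → ℤ × ℤ → ℝ) (x : ℤ × ℤ) :
    avg (fun w => ∑ i ∈ s, f i w) x = ∑ i ∈ s, avg (f i) x := by
  unfold avg
  rw [← Finset.sum_div]
  simp only [Finset.sum_add_distrib]

theorem avg_comp_sub (f : ℤ × ℤ → ℝ) (z x : ℤ × ℤ) :
    avg (fun w => f (w - z)) x = avg f (x - z) := by
  unfold avg
  simp only [add_sub_right_comm]

theorem avg_le_avg {f g : ℤ × ℤ → ℝ} {x : ℤ × ℤ} (h : ∀ e ∈ units, f (x + e) ≤ g (x + e)) :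
    avg f x ≤ avg g x := by
  rw [avg_eq_sum, avg_eq_sum]
  have := Finset.sum_le_sum h
  linarith

theorem avg_congr {f g : ℤ × ℤ → ℝ} {x : ℤ × ℤ} (h : ∀ e ∈ units, f (x + e) = g (x + e)) :
    avg f x = avg g x := by
  rw [avg_eq_sum, avg_eq_sum, Finset.sum_congr rfl h]

theorem avg_potentialKernel_sub (z x : ℤ × ℤ) :
    avg (fun w => potentialKernel (w - z)) x = potentialKernel (x - z) + if x = z then 1 else 0 := by
  rw [avg_comp_sub, avg_potentialKernel]
  simp only [sub_eq_zero]

/-! ### Maximum principles -/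

/-- The maximum principle on a finite set. -/
theorem nonpos_of_subharmonic_finset {U : Finset (ℤ × ℤ)} {f : ℤ × ℤ → ℝ}
    (hsub : ∀ x ∈ U, f x ≤ avg f x)
    (hbd : ∀ x ∈ U, ∀ e ∈ units, x + e ∉ U → f (x + e) ≤ 0) : ∀ x ∈ U, f x ≤ 0 := by
  classical
  by_contra! hc
  obtain ⟨x0, hx0, hpos⟩ := hc
  obtain ⟨m, hm, hmax⟩ := U.exists_max_image f ⟨x0, hx0⟩
  have hM : 0 < f m := hpos.trans_le (hmax x0 hx0)
  -- Among the maximisers the rightmost one is taken: its right neighbour is strictly smaller, which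
  -- contradicts subharmonicity.
  obtain ⟨x, hx, hxmax⟩ := (U.filter fun z => f z = f m).exists_max_image Prod.fst
    ⟨m, by simp [hm]⟩
  rw [Finset.mem_filter] at hx
  have hle : ∀ e ∈ units, f (x + e) ≤ f m := by
    intro e he
    by_cases h : x + e ∈ U
    · exact hmax _ h
    · exact (hbd x hx.1 e he h).trans hM.le
  have hlt : f (x + (1, 0)) < f m := by
    by_cases h : x + (1, 0) ∈ U
    · refine lt_of_le_of_ne (hmax _ h) fun heq => ?_
      have := hxmax (x + (1, 0)) (Finset.mem_filter.2 ⟨h, heq⟩)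
      simp at this
    · exact (hbd x hx.1 _ (by simp [units]) h).trans_lt hM
  have h1 := hsub x hx.1
  have h2 := hle (-1, 0) (by simp [units])
  have h3 := hle (0, 1) (by simp [units])
  have h4 := hle (0, -1) (by simp [units])
  unfold avg at h1
  linarith [hx.2]

/-- The sup-norm ball. -/
noncomputable def box (o : ℤ × ℤ) (R : ℕ) : Finset (ℤ × ℤ) :=
  Finset.Icc (o.1 - R) (o.1 + R) ×ˢ Finset.Icc (o.2 - R) (o.2 + R)

theorem mem_box {o x : ℤ × ℤ} {R : ℕ} : x ∈ box o R ↔ nrm (x - o) ≤ R := by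
  simp only [box, Finset.mem_product, Finset.mem_Icc, nrm, Prod.fst_sub, Prod.snd_sub]
  omega

/-- The maximum principle for subharmonic functions that are bounded above. -/
theorem nonpos_of_subharmonic {f : ℤ × ℤ → ℝ} {B : Set (ℤ × ℤ)} {b : ℤ × ℤ} (hb : b ∈ B) {C : ℝ}
    (hC : ∀ x, f x ≤ C) (hsub : ∀ x, x ∉ B → f x ≤ avg f x) (hB : ∀ x ∈ B, f x ≤ 0) (x : ℤ × ℤ) :
    f x ≤ 0 := by
  classical
  by_cases hx : x ∈ B
  · exact hB x hx
  -- The correction -ε a(· - b) is harmonic off b ∈ B and tends to -∞, so on a large enough box the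
  -- finite maximum principle applies.
  have key : ∀ ε : ℝ, 0 < ε → f x ≤ ε * potentialKernel (x - b) := by
    intro ε hε
    obtain ⟨K, hK⟩ := exists_growth (C / ε)
    have hfar : ∀ y, K ≤ nrm (y - b) → f y - ε * potentialKernel (y - b) ≤ 0 := by
      intro y hy
      have h1 := hK (y - b) 0 (by simpa [nrm] using hy)
      rw [potentialKernel_zero, zero_add, div_le_iff₀ hε] at h1
      linarith [hC y]
    set U := (box b (max K (nrm (x - b)))).filter (· ∉ B) with hU
    have hxU : x ∈ U := by
      rw [hU, Finset.mem_filter, mem_box]; exact ⟨le_max_right _ _, hx⟩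
    have := nonpos_of_subharmonic_finset (U := U)
      (f := fun y => f y - ε * potentialKernel (y - b)) ?_ ?_ x hxU
    · linarith
    · intro y hy
      rw [hU, Finset.mem_filter] at hy
      rw [avg_sub, avg_const_mul, avg_potentialKernel_sub, if_neg (by rintro rfl; exact hy.2 hb),
        add_zero]
      linarith [hsub y hy.2]
    · intro y _ e _ hn
      rw [hU, Finset.mem_filter, mem_box, not_and_or, not_not] at hn
      rcases hn with hn | hn
      · exact hfar _ ((le_max_left _ _).trans (not_le.1 hn).le)
      · have h1 := hB _ hn
        have h2 := mul_nonneg hε.le (potentialKernel_nonneg (y + e - b))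
        linarith
  by_contra! hpos
  have h0 := potentialKernel_nonneg (x - b)
  have := key (f x / (2 * (potentialKernel (x - b) + 1))) (by positivity)
  rw [div_mul_eq_mul_div, le_div_iff₀ (by positivity)] at this
  nlinarith

/-! ### The Green function of the walk killed at 0 -/

/-- The Green function of the simple random walk killed at `0`. -/
noncomputable def green (w x : ℤ × ℤ) : ℝ :=
  potentialKernel w + potentialKernel x - potentialKernel (w - x)

theorem green_zero_left (x : ℤ × ℤ) : green 0 x = 0 := by
  simp [green, potentialKernel_zero, potentialKernel_neg]

theorem green_comm (w x : ℤ × ℤ) : green w x = green x w := by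
  unfold green
  rw [← potentialKernel_neg (w - x), neg_sub]
  ring

theorem green_self (x : ℤ × ℤ) : green x x = 2 * potentialKernel x := by
  simp [green, potentialKernel_zero]; ring

theorem avg_green (w x : ℤ × ℤ) (hw : w ≠ 0) :
    avg (fun w => green w x) w = green w x - if w = x then 1 else 0 := by
  unfold green
  rw [avg_sub, avg_add, avg_potentialKernel_sub, avg_potentialKernel_of_ne hw, avg_const]
  ring

/-- Only qualitative boundedness is obtained here. It supplies the growth condition for the maximum
principle in `green_nonneg`, from which the sharp bound a(x) follows. -/
theorem exists_abs_potentialKernel_sub_le (x : ℤ × ℤ) :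
    ∃ C, ∀ w, |potentialKernel w - potentialKernel (w - x)| ≤ C := by
  obtain ⟨C, hC1, hC⟩ := exists_abs_sub_near
  refine ⟨C + ∑ w ∈ box 0 (2 * nrm x), |potentialKernel w - potentialKernel (w - x)|, fun w => ?_⟩
  have hs : 0 ≤ ∑ w ∈ box 0 (2 * nrm x), |potentialKernel w - potentialKernel (w - x)| :=
    Finset.sum_nonneg fun _ _ => abs_nonneg _
  by_cases h : nrm w ≤ 2 * nrm x
  · have := Finset.single_le_sum (f := fun w => |potentialKernel w - potentialKernel (w - x)|)
      (fun w _ => abs_nonneg _) (mem_box.2 (by simpa using h) : w ∈ box 0 (2 * nrm x))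
    linarith
  · have h0 : w ≠ 0 := by
      rintro rfl
      exact h (Nat.zero_le _)
    have h1 := hC w (w - x) h0 (by rw [sub_sub_cancel]; omega)
    rw [sub_sub_cancel] at h1
    have hn : (0 : ℝ) < nrm w := by exact_mod_cast nrm_pos h0
    have h2 : (nrm x : ℝ) / nrm w ≤ 1 := by
      rw [div_le_one hn]; exact_mod_cast (by omega : nrm x ≤ nrm w)
    nlinarith

theorem green_nonneg (w x : ℤ × ℤ) : 0 ≤ green w x := by
  obtain ⟨C, hC⟩ := exists_abs_potentialKernel_sub_le x
  have := nonpos_of_subharmonic (f := fun w => -green w x) (B := {0}) (b := 0) rfl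
    (C := C) ?_ ?_ ?_ w
  · linarith
  · intro y
    have h1 := (abs_le.1 (hC y)).1
    have h2 := potentialKernel_nonneg x
    unfold green
    linarith
  · intro y hy
    rw [avg_neg, avg_green y x (by simpa using hy)]
    split_ifs <;> linarith
  · intro y hy
    rw [Set.mem_singleton_iff] at hy
    simp [hy, green_zero_left]

/-- The two halves are the nonnegativity of g(w, x) and of g(w - x, -x). -/
theorem abs_potentialKernel_sub_le (w x : ℤ × ℤ) :
    |potentialKernel w - potentialKernel (w - x)| ≤ potentialKernel x := by
  have h1 := green_nonneg w x
  have h2 := green_nonneg (w - x) (-x)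
  unfold green at h1 h2
  rw [sub_neg_eq_add, sub_add_cancel, potentialKernel_neg] at h2
  rw [abs_le]
  constructor <;> linarith

theorem green_le (w x : ℤ × ℤ) : green w x ≤ 2 * potentialKernel x := by
  have := (abs_le.1 (abs_potentialKernel_sub_le w x)).2
  unfold green
  linarith

theorem abs_green_le (w x : ℤ × ℤ) : |green w x| ≤ 2 * potentialKernel x := by
  rw [abs_of_nonneg (green_nonneg w x)]; exact green_le w x

/-! ### Liouville theorem and Green's identity -/

/-- Such a function lies below H(0) - 1 on all far sites, and hence, by the maximum principle, at 0
as well. -/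
theorem not_harmonic_of_tendsto_bot {H : ℤ × ℤ → ℝ} (hH : ∀ x, H x ≤ avg H x) {C κ : ℝ} (hκ : 0 < κ)
    (hb : ∀ x, H x ≤ C - κ * potentialKernel x) : False := by
  obtain ⟨K, hK⟩ := exists_growth ((C - (H 0 - 1)) / κ)
  have := nonpos_of_subharmonic_finset (U := box 0 K) (f := fun x => H x - (H 0 - 1))
    (fun x _ => by rw [avg_sub, avg_const]; linarith [hH x])
    (fun x _ e _ hn => by
      rw [mem_box, sub_zero, not_le] at hn
      have h1 := hK (x + e) 0 (by simpa [nrm_zero] using hn.le)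
      rw [potentialKernel_zero, zero_add, div_le_iff₀ hκ] at h1
      linarith [hb (x + e)]) 0 (by rw [mem_box]; simp [nrm])
  linarith

/-- A harmonic function at bounded distance from a multiple of the potential kernel is constant. -/
theorem harmonic_eq_const {H : ℤ × ℤ → ℝ} (hH : ∀ x, avg H x = H x) {C κ : ℝ}
    (hb : ∀ x, |H x + κ * potentialKernel x| ≤ C) : κ = 0 ∧ ∀ x, H x = H 0 := by
  have hκ : κ = 0 := by
    rcases lt_trichotomy κ 0 with h | h | h
    · refine (not_harmonic_of_tendsto_bot (H := fun x => -H x) (fun x => ?_) (C := C)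
        (neg_pos.2 h) fun x => ?_).elim
      · rw [avg_neg, hH]
      · have := (abs_le.1 (hb x)).1
        linarith
    · exact h
    · refine (not_harmonic_of_tendsto_bot (H := H) (fun x => (hH x).ge) (C := C) h fun x => ?_).elim
      have := (abs_le.1 (hb x)).2
      linarith
  refine ⟨hκ, fun x => le_antisymm ?_ ?_⟩
  · have := nonpos_of_subharmonic (f := fun x => H x - H 0) (B := {0}) (b := 0) rfl
      (C := C - H 0) (fun y => ?_) (fun y _ => ?_) (fun y hy => ?_) x
    · linarith
    · have := (abs_le.1 (hb y)).2
      rw [hκ] at this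
      linarith
    · rw [avg_sub, avg_const, hH]
    · rw [Set.mem_singleton_iff] at hy; simp [hy]
  · have := nonpos_of_subharmonic (f := fun x => H 0 - H x) (B := {0}) (b := 0) rfl
      (C := C + H 0) (fun y => ?_) (fun y _ => ?_) (fun y hy => ?_) x
    · linarith
    · have := (abs_le.1 (hb y)).1
      rw [hκ] at this
      linarith
    · rw [avg_sub, avg_const, hH]
    · rw [Set.mem_singleton_iff] at hy; simp [hy]

/-- A bounded function that is harmonic off a finite set is a combination of potential kernels. -/
theorem eq_sum_potentialKernel {f : ℤ × ℤ → ℝ} {F : Finset (ℤ × ℤ)} {C : ℝ} (hb : ∀ x, |f x| ≤ C)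
    (hF : ∀ x, x ∉ F → avg f x = f x) :
    ∑ z ∈ F, (avg f z - f z) = 0 ∧
      ∃ c, ∀ w, f w = c + ∑ z ∈ F, (avg f z - f z) * potentialKernel (w - z) := by
  classical
  set δ : ℤ × ℤ → ℝ := fun z => avg f z - f z with hδ
  set H : ℤ × ℤ → ℝ := fun w => f w - ∑ z ∈ F, δ z * potentialKernel (w - z) with hHdef
  have hH : ∀ x, avg H x = H x := by
    intro x
    rw [hHdef, avg_sub, avg_sum]
    simp only [avg_const_mul, avg_potentialKernel_sub, mul_add, Finset.sum_add_distrib, mul_ite,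
      mul_one, mul_zero, Finset.sum_ite_eq]
    split_ifs with h
    · simp only [hδ]; ring
    · rw [hF x h]; ring
  -- Subtracting the potentials makes `H` harmonic everywhere. As a(w) - a(w - z) is bounded in w,
  -- `H` is bounded up to -(∑ δ) a, and the Liouville theorem yields both conclusions.
  obtain ⟨hκ, hc⟩ := harmonic_eq_const hH (κ := ∑ z ∈ F, δ z)
    (C := C + ∑ z ∈ F, |δ z| * potentialKernel z) (fun w => by
      have e : H w + (∑ z ∈ F, δ z) * potentialKernel w =
          f w + ∑ z ∈ F, δ z * (potentialKernel w - potentialKernel (w - z)) := by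
        simp only [hHdef, mul_sub, Finset.sum_sub_distrib, Finset.sum_mul]; ring
      rw [e]
      refine (abs_add_le _ _).trans (add_le_add (hb w) ((Finset.abs_sum_le_sum_abs _ _).trans
        (Finset.sum_le_sum fun z _ => ?_)))
      rw [abs_mul]
      exact mul_le_mul_of_nonneg_left (abs_potentialKernel_sub_le w z) (abs_nonneg _))
  refine ⟨hκ, H 0, fun w => ?_⟩
  have := hc w
  rw [← this]
  simp only [hHdef]
  ring

/-- Green's identity for bounded functions that are harmonic off a finite set. -/
theorem green_identity {f g : ℤ × ℤ → ℝ} {F : Finset (ℤ × ℤ)} {C C' : ℝ} (hf : ∀ x, |f x| ≤ C)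
    (hg : ∀ x, |g x| ≤ C') (hfF : ∀ x, x ∉ F → avg f x = f x) (hgF : ∀ x, x ∉ F → avg g x = g x) :
    ∑ z ∈ F, f z * (avg g z - g z) = ∑ z ∈ F, g z * (avg f z - f z) := by
  obtain ⟨hf0, c, hc⟩ := eq_sum_potentialKernel hf hfF
  obtain ⟨hg0, c', hc'⟩ := eq_sum_potentialKernel hg hgF
  have h1 : ∑ z ∈ F, f z * (avg g z - g z) =
      ∑ z ∈ F, ∑ t ∈ F, (avg f t - f t) * (avg g z - g z) * potentialKernel (z - t) := by
    have : ∀ z ∈ F, f z * (avg g z - g z) = c * (avg g z - g z) +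
        ∑ t ∈ F, (avg f t - f t) * (avg g z - g z) * potentialKernel (z - t) := by
      intro z _
      conv_lhs => rw [hc z]
      rw [add_mul, Finset.sum_mul]
      congr 1
      exact Finset.sum_congr rfl fun t _ => by ring
    rw [Finset.sum_congr rfl this, Finset.sum_add_distrib, ← Finset.mul_sum, hg0, mul_zero, zero_add]
  have h2 : ∑ z ∈ F, g z * (avg f z - f z) =
      ∑ z ∈ F, ∑ t ∈ F, (avg f z - f z) * (avg g t - g t) * potentialKernel (z - t) := by
    have : ∀ z ∈ F, g z * (avg f z - f z) = c' * (avg f z - f z) +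
        ∑ t ∈ F, (avg f z - f z) * (avg g t - g t) * potentialKernel (z - t) := by
      intro z _
      conv_lhs => rw [hc' z]
      rw [add_mul, Finset.sum_mul]
      congr 1
      exact Finset.sum_congr rfl fun t _ => by ring
    rw [Finset.sum_congr rfl this, Finset.sum_add_distrib, ← Finset.mul_sum, hf0, mul_zero, zero_add]
  -- The constants have dropped out since the sources have total mass 0; what remains is a double
  -- sum with a symmetric kernel.
  rw [h1, h2, Finset.sum_comm]
  refine Finset.sum_congr rfl fun t _ => Finset.sum_congr rfl fun z _ => ?_
  rw [← potentialKernel_neg (z - t), neg_sub]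

/-! ### Hitting probabilities of the simple random walk killed at `0` -/

/-- `h y x` is the probability that the simple random walk from `x` visits `A` before `0`, and
enters it at `y`. -/
structure IsHittingKernel (A : Finset (ℤ × ℤ)) (h : ℤ × ℤ → ℤ × ℤ → ℝ) : Prop where
  zero_notMem : (0 : ℤ × ℤ) ∉ A
  nonneg : ∀ y ∈ A, ∀ x, 0 ≤ h y x
  bounded : ∀ y ∈ A, ∃ C, ∀ x, h y x ≤ C
  harmonic : ∀ y ∈ A, ∀ x, x ∉ A → x ≠ 0 → avg (h y) x = h y x
  of_mem : ∀ y ∈ A, ∀ x ∈ A, h y x = if x = y then 1 else 0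
  of_zero : ∀ y ∈ A, h y 0 = 0

/-- The mean of the potential kernel at the entrance point. -/
noncomputable def hitMean (A : Finset (ℤ × ℤ)) (h : ℤ × ℤ → ℤ × ℤ → ℝ) (x : ℤ × ℤ) : ℝ :=
  ∑ z ∈ A, h z x * potentialKernel z

/-- The potential kernel relative to `A ∪ {0}`. -/
noncomputable def escape (A : Finset (ℤ × ℤ)) (h : ℤ × ℤ → ℤ × ℤ → ℝ) (x : ℤ × ℤ) : ℝ :=
  potentialKernel x - hitMean A h x

/-- The harmonic measure of `A ∪ {0}` from infinity, for the simple random walk. -/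
noncomputable def harmMeas (A : Finset (ℤ × ℤ)) (h : ℤ × ℤ → ℤ × ℤ → ℝ) (y : ℤ × ℤ) : ℝ :=
  avg (escape A h) y

namespace IsHittingKernel

variable {A : Finset (ℤ × ℤ)} {h : ℤ × ℤ → ℤ × ℤ → ℝ}

theorem ne_zero (H : IsHittingKernel A h) {y : ℤ × ℤ} (hy : y ∈ A) : y ≠ 0 :=
  fun h0 => H.zero_notMem (h0 ▸ hy)

theorem abs_bounded (H : IsHittingKernel A h) {y : ℤ × ℤ} (hy : y ∈ A) : ∃ C, ∀ x, |h y x| ≤ C := by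
  obtain ⟨C, hC⟩ := H.bounded y hy
  exact ⟨C, fun x => by rw [abs_of_nonneg (H.nonneg y hy x)]; exact hC x⟩

theorem sum_mul_of_mem (H : IsHittingKernel A h) (f : ℤ × ℤ → ℝ) {x : ℤ × ℤ} (hx : x ∈ A) :
    ∑ z ∈ A, h z x * f z = f x := by
  rw [Finset.sum_congr rfl fun z hz => by rw [H.of_mem z hz x hx]]
  simp [hx]

theorem sum_mul_zero (H : IsHittingKernel A h) (f : ℤ × ℤ → ℝ) : ∑ z ∈ A, h z 0 * f z = 0 :=
  Finset.sum_eq_zero fun z hz => by rw [H.of_zero z hz, zero_mul]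

theorem avg_sum_mul (H : IsHittingKernel A h) (f : ℤ × ℤ → ℝ) {x : ℤ × ℤ} (hx : x ∉ A)
    (hx0 : x ≠ 0) : avg (fun w => ∑ z ∈ A, h z w * f z) x = ∑ z ∈ A, h z x * f z := by
  rw [avg_sum]
  exact Finset.sum_congr rfl fun z hz => by
    rw [avg_mul_const]
    rw [H.harmonic z hz x hx hx0]

theorem exists_abs_sum_mul_le (H : IsHittingKernel A h) (f : ℤ × ℤ → ℝ) :
    ∃ C, ∀ x, |∑ z ∈ A, h z x * f z| ≤ C := by
  have : ∀ z, ∃ C, z ∈ A → ∀ x, |h z x| ≤ C := by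
    intro z
    by_cases hz : z ∈ A
    · obtain ⟨C, hC⟩ := H.abs_bounded hz
      exact ⟨C, fun _ => hC⟩
    · exact ⟨0, fun h' => absurd h' hz⟩
  choose C hC using this
  refine ⟨∑ z ∈ A, C z * |f z|, fun x => (Finset.abs_sum_le_sum_abs _ _).trans
    (Finset.sum_le_sum fun z hz => ?_)⟩
  rw [abs_mul]
  exact mul_le_mul_of_nonneg_right (hC z hz x) (abs_nonneg _)

theorem sum_le_one (H : IsHittingKernel A h) (x : ℤ × ℤ) : ∑ z ∈ A, h z x ≤ 1 := by
  obtain ⟨C, hC⟩ := H.exists_abs_sum_mul_le (fun _ => 1)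
  have := nonpos_of_subharmonic (f := fun x => ∑ z ∈ A, h z x * 1 - 1)
    (B := {x | x ∈ A ∨ x = 0}) (b := 0) (Or.inr rfl) (C := C) ?_ ?_ ?_ x
  · simpa using this
  · intro y
    have := (abs_le.1 (hC y)).2
    linarith
  · intro y hy
    have hy' : ¬ (y ∈ A ∨ y = 0) := hy
    rw [not_or] at hy'
    rw [avg_sub, avg_const, H.avg_sum_mul (fun _ => 1) hy'.1 hy'.2]
  · rintro y (hy | rfl)
    · rw [H.sum_mul_of_mem (fun _ => 1) hy]; norm_num
    · rw [H.sum_mul_zero (fun _ => 1)]; norm_num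

theorem escape_of_mem (H : IsHittingKernel A h) {x : ℤ × ℤ} (hx : x ∈ A) : escape A h x = 0 := by
  rw [escape, hitMean, H.sum_mul_of_mem _ hx, sub_self]

theorem escape_zero (H : IsHittingKernel A h) : escape A h 0 = 0 := by
  rw [escape, hitMean, H.sum_mul_zero, potentialKernel_zero, sub_self]

theorem hitMean_zero (H : IsHittingKernel A h) : hitMean A h 0 = 0 := H.sum_mul_zero _

theorem avg_hitMean (H : IsHittingKernel A h) {x : ℤ × ℤ} (hx : x ∉ A) (hx0 : x ≠ 0) :
    avg (hitMean A h) x = hitMean A h x := H.avg_sum_mul _ hx hx0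

theorem avg_escape (H : IsHittingKernel A h) {x : ℤ × ℤ} (hx : x ∉ A) (hx0 : x ≠ 0) :
    avg (escape A h) x = escape A h x := by
  change avg (fun w => potentialKernel w - hitMean A h w) x = _
  rw [avg_sub, avg_potentialKernel_of_ne hx0, H.avg_hitMean hx hx0]
  rfl

theorem hitMean_nonneg (H : IsHittingKernel A h) (x : ℤ × ℤ) : 0 ≤ hitMean A h x :=
  Finset.sum_nonneg fun z hz => mul_nonneg (H.nonneg z hz x) (potentialKernel_nonneg z)

/-- A function that is harmonic off `A ∪ {0}`, nonpositive on it and at most `escape` up to a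
constant is dominated by `escape`. -/
theorem le_escape (H : IsHittingKernel A h) {F : ℤ × ℤ → ℝ} {C : ℝ}
    (hC : ∀ x, F x ≤ potentialKernel x + C) (hsub : ∀ x, x ∉ A → x ≠ 0 → F x ≤ avg F x)
    (hA : ∀ x ∈ A, F x ≤ 0) (h0 : F 0 ≤ 0) (x : ℤ × ℤ) : F x ≤ escape A h x := by
  obtain ⟨C', hC'⟩ := H.exists_abs_sum_mul_le potentialKernel
  have := nonpos_of_subharmonic (f := fun x => F x - escape A h x)
    (B := {x | x ∈ A ∨ x = 0}) (b := 0) (Or.inr rfl) (C := C + C') ?_ ?_ ?_ x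
  · linarith
  · intro y
    have h1 := (abs_le.1 (hC' y)).2
    have h2 := hC y
    change hitMean A h y ≤ C' at h1
    unfold escape
    linarith
  · intro y hy
    have hy' : ¬ (y ∈ A ∨ y = 0) := hy
    rw [not_or] at hy'
    rw [avg_sub, H.avg_escape hy'.1 hy'.2]
    linarith [hsub y hy'.1 hy'.2]
  · rintro y (hy | rfl)
    · linarith [hA y hy, H.escape_of_mem hy]
    · linarith [H.escape_zero]

theorem escape_nonneg (H : IsHittingKernel A h) (x : ℤ × ℤ) : 0 ≤ escape A h x :=
  H.le_escape (F := fun _ => 0) (C := 0) (fun x => by linarith [potentialKernel_nonneg x])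
    (fun x _ _ => by rw [avg_const]) (fun _ _ => le_rfl) le_rfl x

theorem harmMeas_nonneg (H : IsHittingKernel A h) (y : ℤ × ℤ) : 0 ≤ harmMeas A h y := by
  have := avg_le_avg (f := fun _ => 0) (g := escape A h) (x := y) fun e _ => H.escape_nonneg _
  rwa [avg_const] at this

theorem avg_hitMean_of_mem (H : IsHittingKernel A h) {y : ℤ × ℤ} (hy : y ∈ A) :
    avg (hitMean A h) y = potentialKernel y - harmMeas A h y := by
  have h1 : harmMeas A h y = avg potentialKernel y - avg (hitMean A h) y :=
    avg_sub potentialKernel (hitMean A h) y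
  rw [avg_potentialKernel_of_ne (H.ne_zero hy)] at h1
  linarith

/-- The function is bounded and harmonic off A ∪ {0}, with discrete Laplacian -μ on A. The sources
sum to 0, so the one at 0 is ∑ μ; the value 0 at 0 fixes the additive constant, and the terms
regroup into Green functions. -/
theorem hitMean_eq_sum_green (H : IsHittingKernel A h) (x : ℤ × ℤ) :
    hitMean A h x = ∑ t ∈ A, green x t * harmMeas A h t := by
  classical
  obtain ⟨C, hC⟩ := H.exists_abs_sum_mul_le potentialKernel
  obtain ⟨hs, c, hc⟩ := eq_sum_potentialKernel (f := hitMean A h) (F := insert 0 A) hC (by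
    intro x hx
    rw [Finset.mem_insert, not_or] at hx
    exact H.avg_hitMean hx.2 hx.1)
  rw [Finset.sum_insert H.zero_notMem] at hs
  have hδ : ∀ y ∈ A, avg (hitMean A h) y - hitMean A h y = -harmMeas A h y := by
    intro y hy
    rw [H.avg_hitMean_of_mem hy, hitMean, H.sum_mul_of_mem _ hy]
    ring
  rw [Finset.sum_congr rfl hδ, Finset.sum_neg_distrib] at hs
  have hc2 : ∀ w, hitMean A h w = c + (∑ t ∈ A, harmMeas A h t) * potentialKernel w -
      ∑ t ∈ A, harmMeas A h t * potentialKernel (w - t) := by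
    intro w
    rw [hc w, Finset.sum_insert H.zero_notMem, Finset.sum_congr rfl fun t ht => by rw [hδ t ht],
      sub_zero]
    simp only [neg_mul, Finset.sum_neg_distrib]
    have : avg (hitMean A h) 0 - hitMean A h 0 = ∑ t ∈ A, harmMeas A h t := by linarith
    rw [this]
    ring
  have h0 := hc2 0
  rw [H.hitMean_zero, potentialKernel_zero] at h0
  simp only [zero_sub, potentialKernel_neg, mul_zero, add_zero] at h0
  rw [hc2 x]
  unfold green
  have : ∑ t ∈ A, (potentialKernel x + potentialKernel t - potentialKernel (x - t)) * harmMeas A h t =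
      (∑ t ∈ A, harmMeas A h t) * potentialKernel x + ∑ t ∈ A, harmMeas A h t * potentialKernel t -
      ∑ t ∈ A, harmMeas A h t * potentialKernel (x - t) := by
    rw [Finset.sum_mul, ← Finset.sum_add_distrib, ← Finset.sum_sub_distrib]
    exact Finset.sum_congr rfl fun t _ => by ring
  rw [this]
  linarith

/-- The total mass `∑ a(y) μ(y)`; it is the capacity of `A` for the conditioned walk. -/
theorem sum_harmMeas_pos (H : IsHittingKernel A h) (hA : A.Nonempty)
    (hpos : ∀ x, x ≠ 0 → 0 < potentialKernel x) :
    0 < ∑ y ∈ A, potentialKernel y * harmMeas A h y := by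
  obtain ⟨y, hy⟩ := hA
  refine Finset.sum_pos' (fun z _ => mul_nonneg (potentialKernel_nonneg z) (H.harmMeas_nonneg z)) ?_
  by_contra! hc
  -- If no point carried mass, the Green representation would make `hitMean` vanish at y ∈ A, where
  -- it equals a(y) > 0.
  have h1 := H.hitMean_eq_sum_green y
  rw [Finset.sum_eq_zero fun t ht => ?_] at h1
  · rw [hitMean, H.sum_mul_of_mem _ hy] at h1
    exact (hpos y (H.ne_zero hy)).ne' h1
  · have h2 := hc t ht
    have h3 := hpos t (H.ne_zero ht)
    have h4 := H.harmMeas_nonneg t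
    have h5 : harmMeas A h t = 0 := by nlinarith
    rw [h5, mul_zero]

/-- The Green function of the walk killed on `A ∪ {0}`. -/
theorem eq_avg_killedGreen (H : IsHittingKernel A h) {x y : ℤ × ℤ} (hy : y ∈ A) (hx : x ∉ A)
    (hx0 : x ≠ 0) :
    h y x = avg (fun w => green w x - ∑ z ∈ A, h z w * green z x) y := by
  classical
  set u : ℤ × ℤ → ℝ := fun w => green w x - ∑ z ∈ A, h z w * green z x with hu
  obtain ⟨C, hC⟩ := H.exists_abs_sum_mul_le (fun z => green z x)
  obtain ⟨C', hC'⟩ := H.abs_bounded hy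
  have havg : ∀ w, w ∉ A → w ≠ 0 → avg u w = u w - if w = x then 1 else 0 := by
    intro w hw hw0
    rw [hu, avg_sub, avg_green w x hw0, H.avg_sum_mul (fun z => green z x) hw hw0]
    ring
  have hu0 : u 0 = 0 := by
    simp only [hu]
    rw [green_zero_left, H.sum_mul_zero (fun z => green z x), sub_zero]
  have huA : ∀ z ∈ A, u z = 0 := by
    intro z hz
    simp only [hu]
    rw [H.sum_mul_of_mem (fun z => green z x) hz, sub_self]
  have hF : ∀ w, w ∉ insert x (insert 0 A) → w ≠ x ∧ w ≠ 0 ∧ w ∉ A := by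
    intro w hw
    simpa [Finset.mem_insert, not_or] using hw
  -- `u` vanishes on A ∪ {0} and has source -1 at x, while `h y` is 1_{y} on A, 0 at 0 and harmonic
  -- at x: only -h_y(x) and the mean of `u` around y survive.
  have key := green_identity (f := h y) (g := u) (F := insert x (insert 0 A)) hC'
    (C' := 2 * potentialKernel x + C) (fun w => by
      refine (abs_sub _ _).trans (add_le_add (abs_green_le w x) (hC w)))
    (fun w hw => H.harmonic y hy w (hF w hw).2.2 (hF w hw).2.1)
    (fun w hw => by
      rw [havg w (hF w hw).2.2 (hF w hw).2.1, if_neg (hF w hw).1, sub_zero])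
  have hxF : x ∉ insert (0 : ℤ × ℤ) A := by simp [hx, hx0]
  rw [Finset.sum_insert hxF, Finset.sum_insert H.zero_notMem, Finset.sum_insert hxF,
    Finset.sum_insert H.zero_notMem, hu0, H.of_zero y hy, H.harmonic y hy x hx hx0,
    havg x hx hx0, if_pos rfl] at key
  have h1 : ∑ z ∈ A, h y z * (avg u z - u z) = avg u y := by
    rw [Finset.sum_congr rfl fun z hz => by rw [H.of_mem y hy z hz, huA z hz]]
    simp [hy]
  have h2 : ∑ z ∈ A, u z * (avg (h y) z - h y z) = 0 :=
    Finset.sum_eq_zero fun z hz => by rw [huA z hz, zero_mul]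
  rw [h1, h2] at key
  linarith

/-- Comparison of the entrance law with the harmonic measure from infinity: it suffices to compare
the Green function with a multiple of the potential kernel on `A` and on a surface around `A`. -/
theorem abs_sub_le_of_surface (H : IsHittingKernel A h) {x : ℤ × ℤ} {U : Finset (ℤ × ℤ)} {c ε κ : ℝ}
    (hAU : A ⊆ U) (hxU : x ∉ U) (hx0 : x ≠ 0) (hε : 0 ≤ ε) (hκ : 0 < κ)
    (hψA : ∀ z ∈ A, |green z x - c * potentialKernel z| ≤ ε)
    (hψ : ∀ w ∈ U, ∀ e ∈ units, w + e ∉ U → |green (w + e) x - c * potentialKernel (w + e)| ≤ ε)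
    (hesc : ∀ w ∈ U, ∀ e ∈ units, w + e ∉ U → κ ≤ escape A h (w + e)) {y : ℤ × ℤ} (hy : y ∈ A) :
    |h y x - c * harmMeas A h y| ≤ 2 * ε / κ * harmMeas A h y := by
  classical
  have hxA : x ∉ A := fun hx => hxU (hAU hx)
  set θ := 2 * ε / κ with hθ
  have hθ0 : 0 ≤ θ := by positivity
  set ψ : ℤ × ℤ → ℝ := fun w => green w x - c * potentialKernel w with hψdef
  -- `φ` is the killed Green function minus c times `escape`; its mean around y is the quantity to
  -- be bounded.
  set φ : ℤ × ℤ → ℝ := fun w => ψ w - ∑ z ∈ A, h z w * ψ z with hφ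
  have hφavg : ∀ w, w ∉ A → w ≠ 0 → w ≠ x → avg φ w = φ w := by
    intro w hw hw0 hwx
    rw [hφ, avg_sub, H.avg_sum_mul ψ hw hw0, hψdef, avg_sub, avg_const_mul, avg_green w x hw0,
      avg_potentialKernel_of_ne hw0, if_neg hwx, sub_zero]
  have hφA : ∀ w ∈ A, φ w = 0 := by
    intro w hw
    simp only [hφ]
    rw [H.sum_mul_of_mem ψ hw, sub_self]
  have hφ0 : φ 0 = 0 := by
    simp only [hφ]
    rw [H.sum_mul_zero ψ, sub_zero]
    simp only [hψdef]
    rw [green_zero_left, potentialKernel_zero, mul_zero, sub_zero]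
  have hbd : ∀ w ∈ U, ∀ e ∈ units, w + e ∉ U → |φ (w + e)| ≤ θ * escape A h (w + e) := by
    intro w hw e he hn
    have h1 := hψ w hw e he hn
    have h2 := hesc w hw e he hn
    have h3 : |∑ z ∈ A, h z (w + e) * ψ z| ≤ ε := by
      calc |∑ z ∈ A, h z (w + e) * ψ z| ≤ ∑ z ∈ A, |h z (w + e) * ψ z| :=
            Finset.abs_sum_le_sum_abs _ _
        _ ≤ ∑ z ∈ A, h z (w + e) * ε := by
            refine Finset.sum_le_sum fun z hz => ?_
            rw [abs_mul, abs_of_nonneg (H.nonneg z hz _)]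
            exact mul_le_mul_of_nonneg_left (hψA z hz) (H.nonneg z hz _)
        _ = (∑ z ∈ A, h z (w + e)) * ε := by rw [Finset.sum_mul]
        _ ≤ 1 * ε := mul_le_mul_of_nonneg_right (H.sum_le_one _) hε
        _ = ε := one_mul _
    have h4 : |φ (w + e)| ≤ 2 * ε := by
      refine (abs_sub _ _).trans ?_
      linarith
    refine h4.trans ?_
    calc 2 * ε = θ * κ := by rw [hθ]; field_simp
      _ ≤ _ := mul_le_mul_of_nonneg_left h2 hθ0
  -- The maximum principle is applied to ±φ - θ·`escape` in U off A ∪ {0}; since x ∉ U, no source of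
  -- the Green function lies there.
  have hsign : ∀ s : ℝ, |s| = 1 → ∀ w ∈ U, s * φ w ≤ θ * escape A h w := by
    intro s hs w hw
    by_cases hwB : w ∈ A ∨ w = 0
    · rcases hwB with hwA | rfl
      · rw [hφA w hwA, H.escape_of_mem hwA]; simp
      · rw [hφ0, H.escape_zero]; simp
    · have := nonpos_of_subharmonic_finset (U := U.filter fun w => ¬ (w ∈ A ∨ w = 0))
        (f := fun w => s * φ w - θ * escape A h w) ?_ ?_ w (by simp only [Finset.mem_filter]; exact ⟨hw, hwB⟩)
      · linarith
      · intro z hz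
        rw [Finset.mem_filter, not_or] at hz
        rw [avg_sub, avg_const_mul, avg_const_mul, hφavg z hz.2.1 hz.2.2
          (fun h0 => hxU (h0 ▸ hz.1)), H.avg_escape hz.2.1 hz.2.2]
      · intro z hz e he hn
        rw [Finset.mem_filter] at hz
        rw [Finset.mem_filter, not_and_or, not_not] at hn
        rcases hn with hn | hn | hn
        · have h1 := hbd z hz.1 e he hn
          have h2 : s * φ (z + e) ≤ |φ (z + e)| := by
            refine (le_abs_self _).trans ?_
            rw [abs_mul, hs, one_mul]
          linarith
        · rw [hφA _ hn, H.escape_of_mem hn]; simp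
        · rw [hn, hφ0, H.escape_zero]; simp
  have hall : ∀ e ∈ units, |φ (y + e)| ≤ θ * escape A h (y + e) := by
    intro e he
    by_cases hn : y + e ∈ U
    · have h1 := hsign 1 (by simp) _ hn
      have h2 := hsign (-1) (by simp) _ hn
      rw [abs_le]
      constructor <;> linarith
    · exact hbd y (hAU hy) e he hn
  have hrep : h y x - c * harmMeas A h y = avg φ y := by
    rw [H.eq_avg_killedGreen hy hxA hx0, harmMeas, ← avg_const_mul, ← avg_sub]
    refine avg_congr fun e _ => ?_
    simp only [hφ, hψdef, escape, hitMean, mul_sub, Finset.sum_sub_distrib, Finset.mul_sum]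
    have : ∀ z ∈ A, h z (y + e) * (c * potentialKernel z) = c * (h z (y + e) * potentialKernel z) :=
      fun z _ => by ring
    rw [Finset.sum_congr rfl this]
    ring
  rw [hrep, harmMeas, ← avg_const_mul, abs_le, ← avg_neg]
  exact ⟨avg_le_avg fun e he => (abs_le.1 (hall e he)).1,
    avg_le_avg fun e he => (abs_le.1 (hall e he)).2⟩

end IsHittingKernel

/-! ### Quantitative estimates -/

theorem one_le_potentialKernel {x : ℤ × ℤ} (hx : x ≠ 0) : 1 ≤ potentialKernel x := by
  classical
  -- The value at 0 is reset to 0, since 1 - a(0) = 1 violates the boundary condition. A site that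
  -- is neither 0 nor a unit vector does not have 0 as a neighbour, so harmonicity is unaffected.
  have := nonpos_of_subharmonic (f := fun x => if x = 0 then 0 else 1 - potentialKernel x)
    (B := {x | x = 0 ∨ x ∈ units}) (b := 0) (Or.inl rfl) (C := 1) ?_ ?_ ?_ x
  · rw [if_neg hx] at this; linarith
  · intro y
    have := potentialKernel_nonneg y
    split_ifs <;> linarith
  · intro y hy
    have hy' : ¬ (y = 0 ∨ y ∈ units) := hy
    rw [not_or] at hy'
    rw [if_neg hy'.1]
    refine le_of_eq ?_
    have h1 : avg (fun w => 1 - potentialKernel w) y = 1 - potentialKernel y := by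
      rw [avg_sub, avg_const, avg_potentialKernel_of_ne hy'.1]
    rw [← h1]
    refine avg_congr fun e he => ?_
    rw [if_neg]
    intro h0
    refine hy'.2 ?_
    rw [eq_neg_of_add_eq_zero_left h0]
    simp only [units, Finset.mem_insert, Finset.mem_singleton] at he ⊢
    rcases he with rfl | rfl | rfl | rfl <;> simp
  · rintro y (rfl | hy)
    · simp
    · rw [potentialKernel_unit hy]; simp

theorem potentialKernel_pos {x : ℤ × ℤ} (hx : x ≠ 0) : 0 < potentialKernel x :=
  zero_lt_one.trans_le (one_le_potentialKernel hx)

/-- If |v| is much larger than |u|, growth already gives a(u) ≤ a(v); otherwise the two norms are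
comparable. -/
theorem exists_le_add_of_nrm_le (L : ℕ) : ∃ C : ℝ, 1 ≤ C ∧ ∀ u v : ℤ × ℤ, v ≠ 0 →
    nrm u ≤ L * nrm v → potentialKernel u ≤ potentialKernel v + C := by
  obtain ⟨K, hK⟩ := exists_growth 0
  obtain ⟨C, hC1, hC⟩ := exists_abs_sub_comparable
  have hC' : 1 ≤ (2 + ((L + K : ℕ) : ℝ)) * C := by
    have : (0 : ℝ) ≤ ((L + K : ℕ) : ℝ) := by positivity
    nlinarith
  refine ⟨_, hC', fun u v hv huv => ?_⟩
  by_cases hu : u = 0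
  · have := potentialKernel_nonneg v
    rw [hu, potentialKernel_zero]
    linarith
  rcases le_or_gt (K * max (nrm u) 1) (nrm v) with h | h
  · have := hK v u h
    linarith
  · rw [max_eq_left (nrm_pos hu)] at h
    have := (abs_le.1 (hC (L + K) u v hu hv (by nlinarith) (by nlinarith))).2
    linarith

/-! ### Harnack chains along rays and estimates of the Green function -/

/-- A crude Harnack inequality: each neighbour's value is at most four times the average. It
transports a lower bound at the far end of a ray of bounded length back to its origin. -/
theorem le_pow_mul_of_ray {f : ℤ × ℤ → ℝ} (hf : ∀ x, 0 ≤ f x) {e : ℤ × ℤ} (he : e ∈ units)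
    (w : ℤ × ℤ) (L : ℕ) (hsup : ∀ k < L, avg f (w + k • e) ≤ f (w + k • e)) :
    f (w + L • e) ≤ 4 ^ L * f w := by
  induction L with
  | zero => simp
  | succ L ih =>
    have h1 := ih fun k hk => hsup k (by omega)
    have h2 := hsup L (by omega)
    have h3 : f (w + L • e + e) ≤ 4 * avg f (w + L • e) := by
      rw [avg_eq_sum]
      have h4 := Finset.single_le_sum (f := fun e' => f (w + L • e + e')) (s := units)
        (fun e' _ => hf _) he
      linarith
    rw [succ_nsmul, ← add_assoc, pow_succ]
    linarith

theorem exists_ray_of_ne_zero {x : ℤ × ℤ} (hx : x ≠ 0) :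
    ∃ e ∈ units, ∀ k : ℕ, x + k • e ≠ 0 ∧ k ≤ nrm (x + k • e) := by
  obtain ⟨x1, x2⟩ := x
  simp only [Prod.mk_eq_zero, ne_eq, not_and] at hx
  rcases le_or_gt 0 x1 with h | h
  · refine ⟨(1, 0), by simp [units], fun k => ?_⟩
    simp only [nrm, Prod.smul_mk, Prod.mk_add_mk, nsmul_eq_mul, mul_one, mul_zero, ne_eq,
      Prod.mk_eq_zero]
    omega
  · refine ⟨(-1, 0), by simp [units], fun k => ?_⟩
    simp only [nrm, Prod.smul_mk, Prod.mk_add_mk, nsmul_eq_mul, mul_neg, mul_one, mul_zero, ne_eq,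
      Prod.mk_eq_zero]
    omega

/-- Moving outwards in the dominant coordinate can meet 0 only if the other coordinate of w
vanishes. In that case the ray moves in the other coordinate: the dominant one keeps it outside the
inner box and, being nonzero, away from 0. -/
theorem exists_ray_to_sphere {o w : ℤ × ℤ} {d R : ℕ} (hd : d < nrm (w - o)) (hR : nrm (w - o) ≤ R)
    (hw : w ≠ 0) :
    ∃ e ∈ units, ∃ L ≤ 2 * R, nrm (w + L • e - o) = R ∧
      ∀ k < L, d < nrm (w + k • e - o) ∧ w + k • e ≠ 0 := by
  obtain ⟨o1, o2⟩ := o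
  obtain ⟨w1, w2⟩ := w
  simp only [Prod.mk_eq_zero, ne_eq, not_and, nrm, Prod.mk_sub_mk] at hw hd hR
  rcases le_total (w2 - o2).natAbs (w1 - o1).natAbs with h12 | h12
  · by_cases h0 : w2 = 0
    · refine ⟨(0, 1), by simp [units], (R - (w2 - o2)).toNat, by omega, ?_, fun k hk => ?_⟩ <;>
        simp only [nrm, Prod.smul_mk, Prod.mk_add_mk, Prod.mk_sub_mk, nsmul_eq_mul, mul_one,
          mul_zero, ne_eq, Prod.mk_eq_zero] <;> omega
    · rcases le_total 0 (w1 - o1) with h | h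
      · refine ⟨(1, 0), by simp [units], (R - (w1 - o1)).toNat, by omega, ?_, fun k hk => ?_⟩ <;>
          simp only [nrm, Prod.smul_mk, Prod.mk_add_mk, Prod.mk_sub_mk, nsmul_eq_mul, mul_one,
            mul_zero, ne_eq, Prod.mk_eq_zero] <;> omega
      · refine ⟨(-1, 0), by simp [units], (R + (w1 - o1)).toNat, by omega, ?_, fun k hk => ?_⟩ <;>
          simp only [nrm, Prod.smul_mk, Prod.mk_add_mk, Prod.mk_sub_mk, nsmul_eq_mul, mul_one,
            mul_neg, mul_zero, ne_eq, Prod.mk_eq_zero] <;> omega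
  · by_cases h0 : w1 = 0
    · refine ⟨(1, 0), by simp [units], (R - (w1 - o1)).toNat, by omega, ?_, fun k hk => ?_⟩ <;>
        simp only [nrm, Prod.smul_mk, Prod.mk_add_mk, Prod.mk_sub_mk, nsmul_eq_mul, mul_one,
          mul_zero, ne_eq, Prod.mk_eq_zero] <;> omega
    · rcases le_total 0 (w2 - o2) with h | h
      · refine ⟨(0, 1), by simp [units], (R - (w2 - o2)).toNat, by omega, ?_, fun k hk => ?_⟩ <;>
          simp only [nrm, Prod.smul_mk, Prod.mk_add_mk, Prod.mk_sub_mk, nsmul_eq_mul, mul_one,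
            mul_zero, ne_eq, Prod.mk_eq_zero] <;> omega
      · refine ⟨(0, -1), by simp [units], (R + (w2 - o2)).toNat, by omega, ?_, fun k hk => ?_⟩ <;>
          simp only [nrm, Prod.smul_mk, Prod.mk_add_mk, Prod.mk_sub_mk, nsmul_eq_mul, mul_one,
            mul_neg, mul_zero, ne_eq, Prod.mk_eq_zero] <;> omega

theorem avg_green_le (x t : ℤ × ℤ) (hx : x ≠ 0) : avg (fun w => green w t) x ≤ green x t := by
  rw [avg_green x t hx]
  split_ifs <;> linarith

/-- If `x` is not much closer to `0` than `t`, the Green function is comparable to `a(t)`. -/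
theorem exists_le_green (η : ℕ) : ∃ κ : ℝ, 0 < κ ∧ ∀ x t : ℤ × ℤ, x ≠ 0 → t ≠ 0 →
    nrm t ≤ η * nrm x → κ * potentialKernel t ≤ green x t := by
  obtain ⟨C, hC1, hC⟩ := exists_le_add_of_nrm_le (1 + η)
  obtain ⟨K, hK⟩ := exists_growth (2 * C)
  obtain ⟨C1, hC11, hC1'⟩ := exists_abs_sub_near
  set X := 2 * (K + 1) * ⌈C1⌉₊ with hX
  have hceil : C1 ≤ ⌈C1⌉₊ := Nat.le_ceil C1
  have hceil1 : 1 ≤ ⌈C1⌉₊ := by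
    have : (1 : ℝ) ≤ ⌈C1⌉₊ := hC11.trans hceil
    exact_mod_cast this
  have hXpos : 0 < X := by positivity
  have hfar : ∀ x t : ℤ × ℤ, t ≠ 0 → nrm t < K + 1 → X ≤ nrm x →
      potentialKernel t / 2 ≤ green x t := by
    intro x t ht htK hx
    have hx0 : x ≠ 0 := by
      rintro rfl
      rw [nrm_zero] at hx
      omega
    have h1 := hC1' x (x - t) hx0 (by rw [sub_sub_cancel]; nlinarith)
    rw [sub_sub_cancel] at h1
    have hn : (0 : ℝ) < nrm x := by exact_mod_cast nrm_pos hx0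
    have h2 : C1 * ((nrm t : ℝ) / nrm x) ≤ 1 / 2 := by
      rw [mul_div_assoc', div_le_div_iff₀ hn (by norm_num)]
      have h3 : (2 * (K + 1) * ⌈C1⌉₊ : ℝ) ≤ nrm x := by exact_mod_cast hx
      have h4 : (nrm t : ℝ) ≤ K + 1 := by exact_mod_cast htK.le
      have h5 : C1 * nrm t ≤ ⌈C1⌉₊ * (K + 1) := by gcongr
      linarith
    have h6 := one_le_potentialKernel ht
    have h7 := (abs_le.1 h1).1
    unfold green
    linarith
  refine ⟨1 / (2 * 4 ^ X), by positivity, fun x t hx ht hxt => ?_⟩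
  have hat := potentialKernel_pos ht
  have hpow : (1 : ℝ) ≤ 4 ^ X := one_le_pow₀ (by norm_num)
  have hhalf : potentialKernel t / 2 ≤ green x t → 1 / (2 * 4 ^ X) * potentialKernel t ≤ green x t := by
    intro h
    refine le_trans ?_ h
    rw [div_mul_eq_mul_div, one_mul, div_le_div_iff₀ (by positivity) (by norm_num)]
    nlinarith
  -- For large a(t), g(x, t) ≥ a(t) - C ≥ a(t)/2. Otherwise t lies in a fixed box: a far x is
  -- covered by the Lipschitz bound, and a near x is joined to a far site by a ray, at the price
  -- 4^X.
  by_cases h2C : 2 * C ≤ potentialKernel t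
  · refine hhalf ?_
    have h1 := hC (x - t) x hx (by
      have := nrm_add_le x (-t)
      rw [nrm_neg, ← sub_eq_add_neg] at this
      nlinarith)
    unfold green
    linarith
  · have htK : nrm t < K + 1 := by
      by_contra hc
      have := hK t 0 (by rw [nrm_zero]; simp; omega)
      rw [potentialKernel_zero] at this
      linarith
    rcases le_or_gt X (nrm x) with h | h
    · exact hhalf (hfar x t ht htK h)
    · obtain ⟨e, he, hray⟩ := exists_ray_of_ne_zero hx
      have h1 := le_pow_mul_of_ray (f := fun w => green w t) (fun w => green_nonneg w t) he x X
        fun k _ => avg_green_le _ t (hray k).1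
      have h2 := hfar (x + X • e) t ht htK (hray X).2
      rw [div_mul_eq_mul_div, one_mul, div_le_iff₀ (by positivity)]
      linarith

theorem green_pos {x t : ℤ × ℤ} (hx : x ≠ 0) (ht : t ≠ 0) : 0 < green x t := by
  obtain ⟨κ, hκ, h⟩ := exists_le_green (nrm t)
  refine lt_of_lt_of_le (mul_pos hκ (potentialKernel_pos ht)) (h x t hx ht ?_)
  have := nrm_pos hx
  nlinarith

/-- Near `o`, the Green function `G(·, x)` is a multiple of the potential kernel up to a relative
error `O(d / |x - o|)`. -/
theorem exists_abs_green_sub_le : ∃ C : ℝ, 0 < C ∧ ∀ (o x : ℤ × ℤ) (d : ℕ), 1 ≤ d → o ≠ 0 →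
    5 * d ≤ nrm (x - o) → nrm (x - o) ≤ 10 * nrm x →
    ∃ c, ∀ w, nrm (w - o) ≤ 4 * d →
      |green w x - c * potentialKernel w| ≤ C * (d / nrm (x - o)) := by
  obtain ⟨C, hC1, hC⟩ := exists_abs_sub_le 20
  refine ⟨120 * C + 40 * C * C, by nlinarith, fun o x d hd ho hN hNx => ?_⟩
  set N := nrm (x - o) with hNdef
  have hN0 : 0 < N := by omega
  have hN0' : (0 : ℝ) < N := by exact_mod_cast hN0
  have hd' : (1 : ℝ) ≤ d := by exact_mod_cast hd
  have hxpos : 0 < nrm x := by omega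
  have hx0 : x ≠ 0 := fun h => by rw [h, nrm_zero] at hxpos; omega
  have hNx' : (N : ℝ) ≤ 10 * nrm x := by exact_mod_cast hNx
  have hxpos' : (0 : ℝ) < nrm x := by exact_mod_cast hxpos
  have hxo : nrm x ≤ nrm o + N := nrm_le_add_sub x o
  have hratio : (0 : ℝ) ≤ (d : ℝ) / N := by positivity
  rcases le_or_gt (nrm o) (8 * d) with hnear | hfar
  -- When A is near 0, c = 1 works: g(w, x) - a(w) = a(x) - a(x - w), and |w| is of order at most d.
  · refine ⟨1, fun w hw => ?_⟩
    have hwn : nrm w ≤ 12 * d := by have := nrm_le_add_sub w o; omega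
    have h1 : N ≤ nrm (x - w) + nrm (w - o) := nrm_sub_le x w o
    have h2 : nrm (x - w) ≤ N + nrm (w - o) := by
      have := nrm_sub_le x o w
      rwa [nrm_sub_comm o w] at this
    have hxw : x - w ≠ 0 := fun h => by rw [h, nrm_zero] at h1; omega
    have h3 := hC x (x - w) hx0 hxw (by omega) (by omega)
    rw [sub_sub_cancel] at h3
    have h4 : green w x - 1 * potentialKernel w = potentialKernel x - potentialKernel (x - w) := by
      rw [green_comm]; unfold green; ring
    rw [h4]
    refine h3.trans ?_
    have hwn' : (nrm w : ℝ) ≤ 12 * d := by exact_mod_cast hwn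
    have h5 : (nrm w : ℝ) / nrm x ≤ 120 * (d / N) := by
      rw [mul_div_assoc', div_le_div_iff₀ hxpos' hN0']
      have := mul_le_mul hwn' hNx' hN0'.le (by positivity)
      linarith
    calc C * ((nrm w : ℝ) / nrm x) ≤ C * (120 * (d / N)) := by gcongr
      _ ≤ _ := by nlinarith [mul_nonneg (mul_nonneg (by linarith : (0 : ℝ) ≤ C) (by linarith : (0 : ℝ) ≤ C)) hratio]
  -- Here c = 1 + q = g(o, x)/a(o), so that the comparison is exact at w = o.
  · set q := (potentialKernel x - potentialKernel (x - o)) / potentialKernel o with hq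
    have hao := one_le_potentialKernel ho
    have hρ : (0 : ℝ) < nrm o := by exact_mod_cast nrm_pos ho
    have hxo0 : x - o ≠ 0 := fun h => by rw [hNdef, h, nrm_zero] at hN0; omega
    have hqle : |q| ≤ 10 * C * (nrm o / N) := by
      rw [hq, abs_div, abs_of_pos (a := potentialKernel o) (by linarith)]
      rcases le_or_gt (nrm o) N with h | h
      · have h1 := hC x (x - o) hx0 hxo0 (by omega) (by omega)
        rw [sub_sub_cancel] at h1
        have h2 : |potentialKernel x - potentialKernel (x - o)| / potentialKernel o ≤
            |potentialKernel x - potentialKernel (x - o)| := div_le_self (abs_nonneg _) hao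
        refine h2.trans (h1.trans ?_)
        have h3 : (nrm o : ℝ) / nrm x ≤ 10 * (nrm o / N) := by
          rw [mul_div_assoc', div_le_div_iff₀ hxpos' hN0']
          nlinarith
        calc C * ((nrm o : ℝ) / nrm x) ≤ C * (10 * (nrm o / N)) := by gcongr
          _ = _ := by ring
      · have h1 : |potentialKernel x - potentialKernel (x - o)| / potentialKernel o ≤ 1 := by
          rw [div_le_one (by linarith)]
          exact abs_potentialKernel_sub_le x o
        refine h1.trans ?_
        have h2 : (1 : ℝ) ≤ nrm o / N := by
          rw [le_div_iff₀ hN0', one_mul]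
          exact_mod_cast h.le
        nlinarith
    refine ⟨1 + q, fun w hw => ?_⟩
    have hw' : (nrm (w - o) : ℝ) ≤ 4 * d := by exact_mod_cast hw
    have hwo1 : nrm w ≤ nrm o + nrm (w - o) := nrm_le_add_sub w o
    have hwo2 : nrm o ≤ nrm w + nrm (w - o) := by
      have := nrm_le_add_sub o w
      rwa [nrm_sub_comm o w] at this
    have hw0 : w ≠ 0 := fun h => by rw [h, nrm_zero, ← h] at hwo2; omega
    have h1 : N ≤ nrm (x - w) + nrm (w - o) := nrm_sub_le x w o
    have h2 : nrm (x - w) ≤ N + nrm (w - o) := by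
      have := nrm_sub_le x o w
      rwa [nrm_sub_comm o w] at this
    have hxw : x - w ≠ 0 := fun h => by rw [h, nrm_zero] at h1; omega
    have h3 := hC (x - o) (x - w) hxo0 hxw (by omega) (by omega)
    rw [sub_sub_sub_cancel_left, ← hNdef] at h3
    have h4 := hC o w ho hw0 (by omega) (by omega)
    rw [nrm_sub_comm] at h4
    have h5 : green w x - (1 + q) * potentialKernel w =
        (potentialKernel (x - o) - potentialKernel (x - w)) +
          q * (potentialKernel o - potentialKernel w) := by
      have h6 : q * potentialKernel o = potentialKernel x - potentialKernel (x - o) := by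
        rw [hq]; field_simp
      rw [green_comm]; unfold green
      linear_combination -h6
    rw [h5]
    refine (abs_add_le _ _).trans ?_
    rw [abs_mul]
    have h7 : C * ((nrm (w - o) : ℝ) / N) ≤ 4 * C * (d / N) := by
      calc C * ((nrm (w - o) : ℝ) / N) ≤ C * (4 * d / N) := by gcongr
        _ = _ := by ring
    -- The factor |o| cancels: q is O(|o|/N), while a varies by O(d/|o|) near o.
    have h8 : |q| * |potentialKernel o - potentialKernel w| ≤ 40 * C * C * (d / N) := by
      calc |q| * |potentialKernel o - potentialKernel w|
          ≤ (10 * C * (nrm o / N)) * (C * (nrm (w - o) / nrm o)) := by gcongr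
        _ ≤ (10 * C * (nrm o / N)) * (C * (4 * d / nrm o)) := by gcongr
        _ = _ := by field_simp; norm_num
    nlinarith

/-! ### Lower bounds for the potential kernel relative to `A ∪ {0}` -/

theorem IsHittingKernel.hitMean_le {A : Finset (ℤ × ℤ)} {h : ℤ × ℤ → ℤ × ℤ → ℝ}
    (H : IsHittingKernel A h) {m : ℝ} (hm : 0 ≤ m) (hA : ∀ z ∈ A, potentialKernel z ≤ m)
    (x : ℤ × ℤ) : hitMean A h x ≤ m := by
  calc hitMean A h x ≤ ∑ z ∈ A, h z x * m :=
        Finset.sum_le_sum fun z hz => mul_le_mul_of_nonneg_left (hA z hz) (H.nonneg z hz x)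
    _ = (∑ z ∈ A, h z x) * m := by rw [Finset.sum_mul]
    _ ≤ 1 * m := mul_le_mul_of_nonneg_right (H.sum_le_one x) hm
    _ = m := one_mul m

/-- The starting point for lower bounds on `escape`: one good sphere at scale d, with constants
independent of A and of its position relative to 0. -/
theorem exists_escape_ge_one : ∃ K : ℕ, 5 ≤ K ∧ ∀ (A : Finset (ℤ × ℤ)) (h : ℤ × ℤ → ℤ × ℤ → ℝ),
    IsHittingKernel A h → ∀ (o : ℤ × ℤ) (d : ℕ), o ∈ A → 1 ≤ d → A ⊆ box o d →
    ∃ R : ℕ, 5 * d ≤ R ∧ R ≤ K * d ∧ ∀ w, nrm (w - o) = R → 1 ≤ escape A h w := by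
  obtain ⟨K0, hK0⟩ := exists_growth 3
  obtain ⟨C, hC1, hC⟩ := exists_abs_sub_near
  set K := K0 + 5 with hKdef
  have hK : ∀ u v : ℤ × ℤ, K * max (nrm v) 1 ≤ nrm u → potentialKernel v + 3 ≤ potentialKernel u :=
    fun u v huv => hK0 u v (le_trans (Nat.mul_le_mul_right _ (by omega)) huv)
  have hceil : C ≤ ⌈C⌉₊ := Nat.le_ceil C
  have hceil1 : 1 ≤ ⌈C⌉₊ := by
    have : (1 : ℝ) ≤ ⌈C⌉₊ := hC1.trans hceil
    exact_mod_cast this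
  set K1 := 2 * (⌈C⌉₊ * (K + 1)) with hK1
  have hKK1 : 2 * (K + 1) ≤ K1 := by nlinarith
  refine ⟨K * (K1 + 1) + K1, by nlinarith, fun A h H o d ho hd hA => ?_⟩
  obtain ⟨z, hz, hzmax⟩ := A.exists_max_image potentialKernel ⟨o, ho⟩
  have ho0 := H.ne_zero ho
  have hz0 := potentialKernel_nonneg z
  rcases le_or_gt (K1 * d) (nrm o) with hfar | hnear
  · refine ⟨K * d, by nlinarith, Nat.mul_le_mul_right _ (by nlinarith), fun w hw => ?_⟩
    obtain ⟨v, hv, hvmax⟩ := (box 0 d).exists_max_image potentialKernel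
      ⟨0, by rw [mem_box]; simp [nrm]⟩
    have hv0 := potentialKernel_nonneg v
    rw [mem_box, sub_zero] at hv
    have hoz : nrm (o - z) ≤ d := by rw [nrm_sub_comm]; exact mem_box.1 (hA hz)
    have how : nrm (o - w) = K * d := by rw [nrm_sub_comm]; exact hw
    have hKd : K * d + d = (K + 1) * d := by ring
    have h1 := hC o z ho0 (by nlinarith)
    have h2 := hC o w ho0 (by nlinarith)
    have h3 := hK (w - o) v (by
      rw [hw]; exact Nat.mul_le_mul_left _ (by omega))
    have hρ : (0 : ℝ) < nrm o := by exact_mod_cast nrm_pos ho0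
    have h4 : C * ((nrm (o - z) : ℝ) / nrm o) + C * ((nrm (o - w) : ℝ) / nrm o) ≤ 1 / 2 := by
      rw [← mul_add, ← add_div, mul_div_assoc', div_le_div_iff₀ hρ (by norm_num)]
      have h5 : (nrm (o - z) : ℝ) + nrm (o - w) ≤ (K + 1) * d := by
        exact_mod_cast (by omega : nrm (o - z) + nrm (o - w) ≤ (K + 1) * d)
      have h6 : 2 * ((⌈C⌉₊ : ℝ) * (K + 1)) * d ≤ nrm o := by exact_mod_cast hfar
      have h7 : C * ((nrm (o - z) : ℝ) + nrm (o - w)) ≤ ⌈C⌉₊ * ((K + 1) * d) := by gcongr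
      linarith
    have h8 := (abs_le.1 h1).1
    have h9 := (abs_le.1 h2).2
    -- Away from 0 the comparison function puts half its weight on a(· - o), which gains 3/2 on the
    -- sphere, and half on a, which hardly varies near o and makes the value at 0 nonpositive. The
    -- halves add up to the growth of `escape`.
    refine le_trans ?_ (H.le_escape (C := potentialKernel o / 2)
      (F := fun x => (potentialKernel (x - o) - potentialKernel v) / 2 +
        (potentialKernel x - potentialKernel z) / 2) ?_ ?_ ?_ ?_ w)
    · linarith
    · intro x
      have := (abs_le.1 (abs_potentialKernel_sub_le x o)).1
      linarith
    · intro x _ hx0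
      have e1 : avg (fun x => (potentialKernel (x - o) - potentialKernel v) / 2 +
          (potentialKernel x - potentialKernel z) / 2) x =
          (avg (fun x => potentialKernel (x - o)) x - potentialKernel v) / 2 +
          (avg potentialKernel x - potentialKernel z) / 2 := by unfold avg; ring
      rw [e1, avg_potentialKernel_sub, avg_potentialKernel_of_ne hx0]
      split_ifs <;> linarith
    · intro x hx
      have e1 := hzmax x hx
      have e2 := hvmax (x - o) (by rw [mem_box, sub_zero]; exact mem_box.1 (hA hx))
      linarith
    · have e1 := hzmax o ho
      simp only [zero_sub, potentialKernel_neg, potentialKernel_zero]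
      linarith
  -- If 0 is within O(d) of A, a sphere large enough for a to exceed its maximum over A by 3
  -- suffices, as `hitMean` is at most that maximum.
  · refine ⟨(K * (K1 + 1) + K1) * d, by nlinarith, le_rfl, fun w hw => ?_⟩
    have h1 : nrm z ≤ (K1 + 1) * d := by
      have e1 := nrm_le_add_sub z o
      have e2 := mem_box.1 (hA hz)
      have : (K1 + 1) * d = K1 * d + d := by ring
      omega
    have h2 : K * ((K1 + 1) * d) ≤ nrm w := by
      have e1 := nrm_sub_le w 0 o
      rw [sub_zero, zero_sub, nrm_neg, hw] at e1
      have : (K * (K1 + 1) + K1) * d = K * ((K1 + 1) * d) + K1 * d := by ring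
      omega
    have h3 := hK w z (le_trans (Nat.mul_le_mul_left _ (by
      rw [max_eq_left (nrm_pos (H.ne_zero hz))]; exact h1)) h2)
    have h4 := H.hitMean_le hz0 hzmax w
    unfold escape
    linarith

/-- A signed coordinate is a supporting functional of the sup norm at w - o: a harmonic minorant of
the norm that is exact at w. -/
theorem exists_linear_eq_nrm (o w : ℤ × ℤ) : ∃ l : ℤ × ℤ → ℝ, l w = nrm (w - o) ∧
    (∀ z, l z ≤ nrm (z - o)) ∧ ∀ z, avg l z = l z := by
  have key : ∀ i j : ℤ, (∀ z : ℤ × ℤ, i * (z.1 - o.1) + j * (z.2 - o.2) ≤ nrm (z - o)) →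
      i * (w.1 - o.1) + j * (w.2 - o.2) = nrm (w - o) → ∃ l : ℤ × ℤ → ℝ, l w = nrm (w - o) ∧
      (∀ z, l z ≤ nrm (z - o)) ∧ ∀ z, avg l z = l z := by
    intro i j hle heq
    refine ⟨fun z => ((i * (z.1 - o.1) + j * (z.2 - o.2) : ℤ) : ℝ), by simp only []; rw [heq]; simp, fun z => ?_,
      fun z => ?_⟩
    · change ((i * (z.1 - o.1) + j * (z.2 - o.2) : ℤ) : ℝ) ≤ _
      exact_mod_cast hle z
    · simp only [avg, Prod.fst_add, Prod.snd_add]; push_cast; ring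
  have hsplit : (w.1 - o.1 = nrm (w - o) ∨ -(w.1 - o.1) = nrm (w - o)) ∨
      (w.2 - o.2 = nrm (w - o) ∨ -(w.2 - o.2) = nrm (w - o)) := by
    simp only [nrm, Prod.fst_sub, Prod.snd_sub]; omega
  rcases hsplit with (h | h) | (h | h)
  · exact key 1 0 (fun z => by simp only [nrm, Prod.fst_sub, Prod.snd_sub]; omega) (by omega)
  · exact key (-1) 0 (fun z => by simp only [nrm, Prod.fst_sub, Prod.snd_sub]; omega) (by omega)
  · exact key 0 1 (fun z => by simp only [nrm, Prod.fst_sub, Prod.snd_sub]; omega) (by omega)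
  · exact key 0 (-1) (fun z => by simp only [nrm, Prod.fst_sub, Prod.snd_sub]; omega) (by omega)

/-- The affine function (l - d)/R is nonpositive on A, at most 1 on the good sphere and at least 1/K
at w, but may be positive at 0. Subtracting (m - a)/m, with m the maximum of a on the box, repairs
this: it is 1 at 0 and at most C/m ≤ 1/(2K) at w, since large d forces m to be large. -/
theorem exists_le_escape_of_large : ∃ κ : ℝ, 0 < κ ∧ ∃ d₀ : ℕ, ∀ (A : Finset (ℤ × ℤ))
    (h : ℤ × ℤ → ℤ × ℤ → ℝ), IsHittingKernel A h → ∀ (o : ℤ × ℤ) (d : ℕ), o ∈ A → 1 ≤ d → d₀ ≤ d →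
    A ⊆ box o d → ∀ w, 2 * d ≤ nrm (w - o) → nrm (w - o) ≤ 4 * d → d ≤ nrm w →
    κ ≤ escape A h w := by
  classical
  obtain ⟨K, hK5, hK⟩ := exists_escape_ge_one
  obtain ⟨C, hC1, hC⟩ := exists_le_add_of_nrm_le (2 * K + 10)
  obtain ⟨d₀, hd₀⟩ := exists_growth (2 * K * C)
  have hK0 : (0 : ℝ) < K := by exact_mod_cast (by omega : 0 < K)
  refine ⟨1 / (2 * K), by positivity, d₀, fun A h H o d ho hd hd0 hA w hw1 hw2 hdw => ?_⟩
  obtain ⟨R, hR5, hRK, hR⟩ := hK A h H o d ho hd hA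
  obtain ⟨l, hlw, hl, hlavg⟩ := exists_linear_eq_nrm o w
  have hwR : w ∈ box o R := mem_box.2 (by omega)
  obtain ⟨u, hu, humax⟩ := (box o R).exists_max_image potentialKernel ⟨w, hwR⟩
  have hw0 : w ≠ 0 := fun h0 => by rw [h0, nrm_zero] at hdw; omega
  have h1 : potentialKernel u ≤ potentialKernel w + C := by
    refine hC u w hw0 ?_
    have e1 := nrm_le_add_sub u o
    have e2 := mem_box.1 hu
    have e3 := nrm_le_add_sub o w
    rw [nrm_sub_comm] at e3
    have e4 : K * d ≤ K * nrm w := Nat.mul_le_mul_left _ hdw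
    have e5 : (2 * K + 10) * nrm w = 2 * (K * nrm w) + 10 * nrm w := by ring
    omega
  have h2 : 2 * K * C ≤ potentialKernel u := by
    have e1 := hd₀ w 0 (by rw [nrm_zero]; simp; omega)
    rw [potentialKernel_zero] at e1
    linarith [humax w hwR]
  have hm : 0 < potentialKernel u := lt_of_lt_of_le (by positivity) h2
  set m := potentialKernel u with hmdef
  have hRpos : (0 : ℝ) < R := by exact_mod_cast (by omega : 0 < R)
  have hRd : (R : ℝ) ≤ K * d := by exact_mod_cast hRK
  have hd' : (1 : ℝ) ≤ d := by exact_mod_cast hd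
  have hle : ∀ z ∈ box o R, (l z - d) / R - 1 / m * (m - potentialKernel z) ≤
      (nrm (z - o) - d) / R := by
    intro z hz
    have e1 : (l z - d) / R ≤ (nrm (z - o) - d) / R := by
      have := hl z
      gcongr
    have e2 : 0 ≤ 1 / m * (m - potentialKernel z) :=
      mul_nonneg (by positivity) (by linarith [humax z hz])
    linarith
  have hMP := nonpos_of_subharmonic_finset
    (U := (box o (R - 1)).filter fun w => ¬ (w ∈ A ∨ w = 0))
    (f := fun z => ((l z - d) / R - 1 / m * (m - potentialKernel z)) - escape A h z)
    ?_ ?_ w ?_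
  · have e1 : (d : ℝ) ≤ l w - d := by
      rw [hlw]
      have : (2 * d : ℝ) ≤ nrm (w - o) := by exact_mod_cast hw1
      linarith
    have e2 : 1 / (K : ℝ) ≤ (l w - d) / R := by
      rw [div_le_div_iff₀ hK0 hRpos]
      nlinarith
    have e3 : 1 / m * (m - potentialKernel w) ≤ 1 / (2 * K) := by
      rw [div_mul_eq_mul_div, one_mul, div_le_div_iff₀ hm (by positivity)]
      nlinarith
    have e4 : 1 / (K : ℝ) = 1 / (2 * K) + 1 / (2 * K) := by field_simp; norm_num
    linarith
  · intro z hz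
    rw [Finset.mem_filter, not_or] at hz
    have e1 : avg (fun z => (l z - d) / R - 1 / m * (m - potentialKernel z)) z =
        (avg l z - d) / R - 1 / m * (m - avg potentialKernel z) := by unfold avg; ring
    rw [avg_sub, e1, hlavg, avg_potentialKernel_of_ne hz.2.2, H.avg_escape hz.2.1 hz.2.2]
  · intro z hz e he hn
    rw [Finset.mem_filter, mem_box] at hz
    have hzR : nrm (z + e - o) ≤ R := by
      have e1 := nrm_add_le (z - o) e
      rw [nrm_unit he, sub_add_eq_add_sub] at e1
      omega
    have e1 := hle (z + e) (mem_box.2 hzR)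
    have e2 := H.escape_nonneg (z + e)
    rw [Finset.mem_filter, mem_box, not_and_or, not_not] at hn
    rcases hn with hn | hn | hn
    · have e3 := hR (z + e) (by omega)
      have e4 : ((nrm (z + e - o) : ℝ) - d) / R ≤ 1 := by
        rw [div_le_one hRpos]
        have : (nrm (z + e - o) : ℝ) ≤ R := by exact_mod_cast hzR
        linarith
      linarith
    · have e3 : ((nrm (z + e - o) : ℝ) - d) / R ≤ 0 := by
        refine div_nonpos_of_nonpos_of_nonneg ?_ hRpos.le
        have : (nrm (z + e - o) : ℝ) ≤ d := by exact_mod_cast mem_box.1 (hA hn)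
        linarith
      linarith
    · rw [hn] at hzR ⊢
      have e3 : (l 0 - d) / R ≤ 1 := by
        rw [div_le_one hRpos]
        have : (nrm (0 - o) : ℝ) ≤ R := by exact_mod_cast hzR
        linarith [hl 0]
      rw [potentialKernel_zero, H.escape_zero, sub_zero, sub_zero, one_div, inv_mul_cancel₀ hm.ne']
      linarith
  · rw [Finset.mem_filter, mem_box, not_or]
    refine ⟨by omega, fun hwA => ?_, hw0⟩
    have := mem_box.1 (hA hwA)
    omega

/-- For d below the threshold the good sphere is reached by a ray of bounded length, and the Harnack
chain gives a uniform constant. The condition d ≤ |w| is needed because `escape` vanishes at 0. -/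
theorem exists_le_escape : ∃ κ : ℝ, 0 < κ ∧ ∀ (A : Finset (ℤ × ℤ))
    (h : ℤ × ℤ → ℤ × ℤ → ℝ), IsHittingKernel A h → ∀ (o : ℤ × ℤ) (d : ℕ), o ∈ A → 1 ≤ d →
    A ⊆ box o d → ∀ w, 2 * d ≤ nrm (w - o) → nrm (w - o) ≤ 4 * d → d ≤ nrm w →
    κ ≤ escape A h w := by
  obtain ⟨κ, hκ, d₀, hlarge⟩ := exists_le_escape_of_large
  obtain ⟨K, hK5, hK⟩ := exists_escape_ge_one
  refine ⟨min κ (1 / 4 ^ (2 * (K * d₀))), by positivity,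
    fun A h H o d ho hd hA w hw1 hw2 hdw => ?_⟩
  rcases le_or_gt d₀ d with h0 | h0
  · exact (min_le_left _ _).trans (hlarge A h H o d ho hd h0 hA w hw1 hw2 hdw)
  · refine (min_le_right _ _).trans ?_
    obtain ⟨R, hR5, hRK, hR⟩ := hK A h H o d ho hd hA
    have hw0 : w ≠ 0 := fun h0 => by rw [h0, nrm_zero] at hdw; omega
    obtain ⟨e, he, L, hL, hLR, hray⟩ := exists_ray_to_sphere (d := d) (R := R) (o := o) (w := w)
      (by omega) (by omega) hw0
    have h1 := hR _ hLR
    have h2 := le_pow_mul_of_ray H.escape_nonneg he w L fun k hk => by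
      refine (H.avg_escape (fun hA' => ?_) (hray k hk).2).le
      have e1 := (hray k hk).1
      have e2 := mem_box.1 (hA hA')
      omega
    have h3 : (4 : ℝ) ^ L ≤ 4 ^ (2 * (K * d₀)) := by
      refine pow_le_pow_right₀ (by norm_num) (hL.trans (Nat.mul_le_mul_left _ (hRK.trans
        (Nat.mul_le_mul_left _ h0.le))))
    rw [div_le_iff₀ (by positivity)]
    nlinarith [mul_le_mul_of_nonneg_right h3 (H.escape_nonneg w)]

/-! ### Comparison of the entrance law with the harmonic measure -/

/-- The capacity of `A` for the conditioned walk. -/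
noncomputable def harmMass (A : Finset (ℤ × ℤ)) (h : ℤ × ℤ → ℤ × ℤ → ℝ) : ℝ :=
  ∑ y ∈ A, potentialKernel y * harmMeas A h y

namespace IsHittingKernel

variable {A : Finset (ℤ × ℤ)} {h : ℤ × ℤ → ℤ × ℤ → ℝ}

theorem harmMass_pos (H : IsHittingKernel A h) (hA : A.Nonempty) : 0 < harmMass A h :=
  H.sum_harmMeas_pos hA fun _ => potentialKernel_pos

theorem hitMean_pos (H : IsHittingKernel A h) (hA : A.Nonempty) {x : ℤ × ℤ} (hx : x ≠ 0) :
    0 < hitMean A h x := by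
  by_contra! hc
  have hsum := H.hitMean_eq_sum_green x
  have h0 : ∀ t ∈ A, green x t * harmMeas A h t = 0 := by
    refine (Finset.sum_eq_zero_iff_of_nonneg fun t _ =>
      mul_nonneg (green_nonneg x t) (H.harmMeas_nonneg t)).1 ?_
    linarith [H.hitMean_nonneg x]
  refine (H.harmMass_pos hA).ne' (Finset.sum_eq_zero fun t ht => ?_)
  rcases mul_eq_zero.1 (h0 t ht) with h1 | h1
  · exact absurd h1 (green_pos hx (H.ne_zero ht)).ne'
  · rw [h1, mul_zero]

theorem mul_harmMass_le_hitMean (H : IsHittingKernel A h) {x : ℤ × ℤ} {κ : ℝ}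
    (hκ : ∀ t ∈ A, κ * potentialKernel t ≤ green x t) : κ * harmMass A h ≤ hitMean A h x := by
  rw [H.hitMean_eq_sum_green, harmMass, Finset.mul_sum]
  refine Finset.sum_le_sum fun t ht => ?_
  rw [← mul_assoc]
  exact mul_le_mul_of_nonneg_right (hκ t ht) (H.harmMeas_nonneg t)

/-- Maximum principle outside a sphere around `A`. -/
theorem sum_mul_nonpos_of_sphere (H : IsHittingKernel A h) (k : ℤ × ℤ → ℝ) {o : ℤ × ℤ} {N : ℕ}
    (hA : A ⊆ box o N) (hN : ∀ z, nrm (z - o) = N → ∑ t ∈ A, h t z * k t ≤ 0) {x : ℤ × ℤ}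
    (hx : N ≤ nrm (x - o)) : ∑ t ∈ A, h t x * k t ≤ 0 := by
  obtain ⟨C, hC⟩ := H.exists_abs_sum_mul_le k
  have := nonpos_of_subharmonic
    (f := fun z => if N ≤ nrm (z - o) then ∑ t ∈ A, h t z * k t else 0)
    (B := {z | nrm (z - o) ≤ N ∨ z = 0}) (b := 0) (Or.inr rfl) (C := C) ?_ ?_ ?_ x
  · rwa [if_pos hx] at this
  · intro z
    split_ifs
    · exact (abs_le.1 (hC z)).2
    · exact (abs_nonneg _).trans (hC 0)
  · intro z hz
    have hz' : ¬ (nrm (z - o) ≤ N ∨ z = 0) := hz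
    rw [not_or, not_le] at hz'
    rw [if_pos hz'.1.le, ← H.avg_sum_mul k (fun hzA => hz'.1.not_ge (mem_box.1 (hA hzA))) hz'.2]
    refine (avg_congr fun e he => ?_).le
    rw [if_pos]
    have h1 := nrm_le_add_sub (z - o) (z + e - o)
    rw [show z - o - (z + e - o) = -e by abel, nrm_neg, nrm_unit he] at h1
    omega
  · rintro z (hz | rfl)
    · split_ifs with h1
      · exact hN z (le_antisymm hz h1)
      · exact le_rfl
    · rw [H.sum_mul_zero k]
      split_ifs <;> exact le_rfl

end IsHittingKernel

theorem exists_abs_sub_le_of_nrm_le : ∃ C : ℝ, 0 < C ∧ ∀ (A : Finset (ℤ × ℤ))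
    (h : ℤ × ℤ → ℤ × ℤ → ℝ), IsHittingKernel A h → ∀ (o x : ℤ × ℤ) (d : ℕ), o ∈ A → 1 ≤ d →
    A ⊆ box o d → 5 * d ≤ nrm (x - o) → nrm (x - o) ≤ 10 * nrm x → ∀ y ∈ A,
    |h y x * harmMass A h - harmMeas A h y * hitMean A h x| ≤
      C * (d / nrm (x - o)) * (harmMeas A h y * hitMean A h x) := by
  obtain ⟨κ, hκ, hesc⟩ := exists_le_escape
  obtain ⟨C, hC, hgreen⟩ := exists_abs_green_sub_le
  obtain ⟨κ', hκ', hM⟩ := exists_le_green 21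
  refine ⟨4 * C / (κ * κ'), by positivity, fun A h H o x d ho hd hA hN hNx y hy => ?_⟩
  obtain ⟨c, hc⟩ := hgreen o x d hd (H.ne_zero ho) hN hNx
  have hx0 : x ≠ 0 := fun h0 => by rw [h0, nrm_zero] at hNx; rw [h0] at hN; omega
  -- One of the radii 2d and 4d keeps the sphere at distance at least d from 0, whatever |o| is.
  obtain ⟨r, hr2, hr4, hr⟩ : ∃ r : ℕ, 2 * d ≤ r ∧ r ≤ 4 * d ∧
      ∀ w, nrm (w - o) = r → d ≤ nrm w := by
    have key : ∀ w, nrm o ≤ nrm w + nrm (w - o) ∧ nrm (w - o) ≤ nrm w + nrm o := by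
      intro w
      have e1 := nrm_le_add_sub o w
      have e2 := nrm_sub_le w 0 o
      rw [nrm_sub_comm] at e1
      rw [sub_zero, zero_sub, nrm_neg] at e2
      exact ⟨e1, e2⟩
    by_cases h1 : nrm o ≤ d ∨ 3 * d ≤ nrm o
    · exact ⟨2 * d, le_rfl, by omega, fun w hw => by have := key w; omega⟩
    · exact ⟨4 * d, by omega, le_rfl, fun w hw => by have := key w; omega⟩
  set θ := C * ((d : ℝ) / nrm (x - o)) with hθ
  have hθ0 : 0 ≤ θ := by positivity
  have hbd : ∀ w ∈ box o (r - 1), ∀ e ∈ units, w + e ∉ box o (r - 1) → nrm (w + e - o) = r := by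
    intro w hw e he hn
    rw [mem_box] at hw hn
    have e1 := nrm_add_le (w - o) e
    rw [nrm_unit he, sub_add_eq_add_sub] at e1
    omega
  have hstep : ∀ z ∈ A, |h z x - c * harmMeas A h z| ≤ 2 * θ / κ * harmMeas A h z := by
    intro z hz
    refine H.abs_sub_le_of_surface (U := box o (r - 1)) (fun t ht => ?_) (fun hxU => ?_) hx0 hθ0 hκ
      (fun t ht => hc t ?_) (fun w hw e he hn => hc _ ?_) (fun w hw e he hn => ?_) hz
    · have := mem_box.1 (hA ht)
      exact mem_box.2 (by omega)
    · have := mem_box.1 hxU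
      omega
    · have := mem_box.1 (hA ht)
      omega
    · have := hbd w hw e he hn
      omega
    · have := hbd w hw e he hn
      exact hesc A h H o d ho hd hA _ (by omega) (by omega) (hr _ this)
  set M := harmMass A h with hMdef
  set T := hitMean A h x with hTdef
  set μ := harmMeas A h y with hμdef
  have hμ : 0 ≤ μ := H.harmMeas_nonneg y
  have hM0 : 0 < M := H.harmMass_pos ⟨o, ho⟩
  -- Summation with weights a(z) gives T ≈ cM with the same c, which then cancels against h_y(x) ≈ c
  -- μ(y).
  have hT : |T - c * M| ≤ 2 * θ / κ * M := by
    have e1 : T - c * M = ∑ z ∈ A, (h z x - c * harmMeas A h z) * potentialKernel z := by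
      rw [hTdef, hMdef, hitMean, harmMass, Finset.mul_sum, ← Finset.sum_sub_distrib]
      exact Finset.sum_congr rfl fun z _ => by ring
    have e2 : 2 * θ / κ * M =
        ∑ z ∈ A, (2 * θ / κ * harmMeas A h z) * potentialKernel z := by
      rw [hMdef, harmMass, Finset.mul_sum]
      exact Finset.sum_congr rfl fun z _ => by ring
    rw [e1, e2]
    refine (Finset.abs_sum_le_sum_abs _ _).trans (Finset.sum_le_sum fun z hz => ?_)
    rw [abs_mul, abs_of_nonneg (potentialKernel_nonneg z)]
    exact mul_le_mul_of_nonneg_right (hstep z hz) (potentialKernel_nonneg z)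
  have hMT : κ' * M ≤ T := by
    refine H.mul_harmMass_le_hitMean fun t ht => hM x t hx0 (H.ne_zero ht) ?_
    have e1 := nrm_le_add_sub t o
    have e2 := mem_box.1 (hA ht)
    have e3 := nrm_le_add_sub o x
    rw [nrm_sub_comm] at e3
    omega
  have e1 : h y x * M - μ * T = (h y x - c * μ) * M - μ * (T - c * M) := by ring
  rw [e1]
  refine (abs_sub _ _).trans ?_
  rw [abs_mul, abs_mul, abs_of_pos hM0, abs_of_nonneg hμ]
  have e2 := mul_le_mul_of_nonneg_right (hstep y hy) hM0.le
  have e3 := mul_le_mul_of_nonneg_left hT hμ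
  have e4 : 4 * C / (κ * κ') * ((d : ℝ) / nrm (x - o)) * (μ * T) =
      4 * θ / κ * μ * (T / κ') := by rw [hθ]; field_simp
  rw [e4]
  have e5 : M ≤ T / κ' := by rw [le_div_iff₀ hκ']; linarith
  have e6 : 4 * θ / κ * μ * M ≤ 4 * θ / κ * μ * (T / κ') := by
    refine mul_le_mul_of_nonneg_left e5 (by positivity)
  have e7 : 4 * θ / κ * μ * M = 2 * θ / κ * μ * M + μ * (2 * θ / κ * M) := by ring
  linarith

/-- Entrance laws from far away are close to the harmonic measure. -/
theorem exists_abs_sub_le_of_far : ∃ C : ℝ, 0 < C ∧ ∀ (A : Finset (ℤ × ℤ))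
    (h : ℤ × ℤ → ℤ × ℤ → ℝ), IsHittingKernel A h → ∀ (o x : ℤ × ℤ) (d : ℕ), o ∈ A → 1 ≤ d →
    A ⊆ box o d → 8 * (d + 1) ≤ nrm (x - o) → ∀ y ∈ A,
    |h y x * harmMass A h - harmMeas A h y * hitMean A h x| ≤
      C * (d / nrm (x - o)) * (harmMeas A h y * hitMean A h x) := by
  classical
  obtain ⟨C, hC, hcirc⟩ := exists_abs_sub_le_of_nrm_le
  refine ⟨2 * C, by positivity, fun A h H o x d ho hd hA hD y hy => ?_⟩
  set D := nrm (x - o) with hDdef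
  have hD0 : (0 : ℝ) < D := by exact_mod_cast (by omega : 0 < D)
  have hμ : 0 ≤ harmMeas A h y := H.harmMeas_nonneg y
  have hT : ∀ z, 0 ≤ harmMeas A h y * hitMean A h z := fun z => mul_nonneg hμ (H.hitMean_nonneg z)
  rcases le_or_gt (8 * nrm o) (7 * D) with h1 | h1
  · have e1 : D ≤ nrm x + nrm o := by
      have := nrm_sub_le x 0 o
      rwa [sub_zero, zero_sub, nrm_neg] at this
    refine (hcirc A h H o x d ho hd hA (by omega) (by omega) y hy).trans ?_
    refine mul_le_mul_of_nonneg_right ?_ (hT x)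
    have : 0 ≤ C * ((d : ℝ) / D) := by positivity
    linarith
  -- Here |o| > 7D/8. On the sphere of radius about 3D/4 around o one has |z| ≥ |o| - N > D/8, so
  -- the previous estimate applies there, with N ≥ D/2 costing a factor 2.
  · obtain ⟨N, hN1, hN2⟩ : ∃ N : ℕ, 4 * N ≤ 3 * D ∧ 3 * D < 4 * N + 4 := ⟨3 * D / 4, by omega, by omega⟩
    have hN0 : (0 : ℝ) < N := by exact_mod_cast (by omega : 0 < N)
    have hND : C * ((d : ℝ) / N) ≤ 2 * C * (d / D) := by
      have : (d : ℝ) / N ≤ 2 * (d / D) := by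
        rw [mul_div_assoc', div_le_div_iff₀ hN0 hD0]
        have e1 : (D : ℝ) ≤ 2 * N := by exact_mod_cast (by omega : D ≤ 2 * N)
        have : (0 : ℝ) ≤ d := by positivity
        nlinarith
      nlinarith
    -- The inequality is written as a linear combination of the h_t, with the absolute value
    -- replaced by a sign s, so that the exterior maximum principle applies.
    have hsum : ∀ s z, ∑ t ∈ A, h t z * (s * ((if t = y then harmMass A h else 0) -
        harmMeas A h y * potentialKernel t) - 2 * C * (d / D) *
          (harmMeas A h y * potentialKernel t)) =
        s * (h y z * harmMass A h - harmMeas A h y * hitMean A h z) -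
          2 * C * (d / D) * (harmMeas A h y * hitMean A h z) := by
      intro s z
      have e1 : ∑ t ∈ A, h t z * (if t = y then harmMass A h else 0) = h y z * harmMass A h := by
        simp [hy]
      rw [← e1, hitMean, Finset.mul_sum, ← Finset.sum_sub_distrib, Finset.mul_sum, Finset.mul_sum,
        ← Finset.sum_sub_distrib]
      exact Finset.sum_congr rfl fun t _ => by ring
    have hsign : ∀ s : ℝ, |s| = 1 →
        s * (h y x * harmMass A h - harmMeas A h y * hitMean A h x) -
          2 * C * (d / D) * (harmMeas A h y * hitMean A h x) ≤ 0 := by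
      intro s hs
      rw [← hsum]
      refine H.sum_mul_nonpos_of_sphere _ (o := o) (N := N) (fun t ht => ?_) (fun z hz => ?_)
        (by omega)
      · have := mem_box.1 (hA ht)
        exact mem_box.2 (by omega)
      · rw [hsum]
        have e1 : nrm o ≤ nrm z + nrm (z - o) := by
          have := nrm_le_add_sub o z
          rwa [nrm_sub_comm] at this
        have e2 := hcirc A h H o z d ho hd hA (by omega) (by omega) y hy
        have e3 := mul_le_mul_of_nonneg_right hND (hT z)
        rw [hz] at e2
        have e4 : s * (h y z * harmMass A h - harmMeas A h y * hitMean A h z) ≤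
            |h y z * harmMass A h - harmMeas A h y * hitMean A h z| := by
          refine (le_abs_self _).trans ?_
          rw [abs_mul, hs, one_mul]
        linarith
    have e1 := hsign 1 (by simp)
    have e2 := hsign (-1) (by simp)
    rw [abs_le]
    constructor <;> linarith

/-! ### The conditioned walk -/

/-- The row sums to 1 because a is harmonic off 0. -/
theorem isWalkRow_condMatrix {x : ℤ × ℤ} (hx : x ≠ 0) : IsWalkRow condMatrix x where
  nonneg y := by
    unfold condMatrix
    have h1 := potentialKernel_nonneg x
    have h2 := potentialKernel_nonneg y
    split_ifs
    · exact div_nonneg h2 (mul_nonneg (by norm_num) h1)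
    · exact le_rfl
  eq_zero y h := by simp [condMatrix, h]
  sum_eq := by
    rw [Finset.sum_congr rfl fun e he => show condMatrix x (x + e) =
        potentialKernel (x + e) / (4 * potentialKernel x) from
      if_pos ⟨nbr_add_unit x he, hx⟩, ← Finset.sum_div]
    have h1 := avg_potentialKernel_of_ne hx
    have h2 := potentialKernel_pos hx
    rw [avg_eq_sum] at h1
    rw [div_eq_one_iff_eq (by linarith)]
    linarith

/-- The Doob transform: the weight a(x) cancels the denominator of the transition probability, which
leaves an unweighted average. -/
theorem mul_condWalk_real {x : ℤ × ℤ} (hx : x ≠ 0) {E F : Set (ℕ → ℤ × ℤ)} (hF : MeasurableSet F)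
    (hEF : ∀ ω : ℕ → ℤ × ℤ, ω 0 = x → (ω ∈ E ↔ (fun n => ω (n + 1)) ∈ F)) :
    potentialKernel x * (condWalk x).real E =
      avg (fun w => potentialKernel w * (condWalk w).real F) x := by
  unfold condWalk
  rw [chainLaw_real_shift (isWalkRow_condMatrix hx) hF hEF, avg_eq_sum, Finset.mul_sum,
    Finset.sum_div]
  refine Finset.sum_congr rfl fun e he => ?_
  have h1 : condMatrix x (x + e) = potentialKernel (x + e) / (4 * potentialKernel x) :=
    if_pos ⟨nbr_add_unit x he, hx⟩
  have h2 := (potentialKernel_pos hx).ne'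
  rw [h1]
  field_simp

theorem condWalk_real_entersAt_of_mem {A : Finset (ℤ × ℤ)} {x : ℤ × ℤ} (hx : x ∈ A) (y : ℤ × ℤ) :
    (condWalk x).real (entersAt A y) = if x = y then 1 else 0 := by
  unfold condWalk
  split_ifs with h
  · rw [chainLaw_real_congr (F := Set.univ)]
    · simp
    · intro ω hω
      rw [entersAt_of_mem (by rwa [hω]), hω]
      simp [h]
  · rw [chainLaw_real_congr (F := ∅)]
    · simp
    · intro ω hω
      rw [entersAt_of_mem (by rwa [hω]), hω]
      simp [h]

/-- The function g(·, y) is nonnegative, superharmonic off 0 and equal to 2a(y) at y, so it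
dominates by induction on the horizon. This is what makes `condHit` bounded in spite of the
unbounded factor a(x). -/
theorem mul_condWalk_real_entersAtBy_le {A : Finset (ℤ × ℤ)} {y : ℤ × ℤ}
    (hy : y ∈ A) (N : ℕ) (x : ℤ × ℤ) :
    potentialKernel x * (condWalk x).real (entersAtBy A y N) ≤ green x y := by
  induction N generalizing x with
  | zero =>
    by_cases hxy : x = y
    · subst hxy
      rw [green_self]
      have h1 := potentialKernel_nonneg x
      have h2 : (condWalk x).real (entersAtBy A x 0) ≤ 1 := by
        unfold condWalk; exact measureReal_le_one
      nlinarith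
    · have : (condWalk x).real (entersAtBy A y 0) = 0 := by
        unfold condWalk
        rw [chainLaw_real_congr (F := ∅)]
        · simp
        · intro ω hω
          refine iff_of_false ?_ (Set.notMem_empty _)
          rintro ⟨n, hn, h1, -⟩
          rw [Nat.le_zero.1 hn, hω] at h1
          exact hxy h1
      rw [this, mul_zero]
      exact green_nonneg x y
  | succ N ih =>
    by_cases hx0 : x = 0
    · rw [hx0, potentialKernel_zero, zero_mul]
      exact green_nonneg 0 y
    by_cases hxA : x ∈ A
    · have : (condWalk x).real (entersAtBy A y (N + 1)) = (condWalk x).real (entersAtBy A y N) := by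
        unfold condWalk
        exact chainLaw_real_congr fun ω hω => by
          rw [entersAtBy_of_mem (by rwa [hω]), entersAtBy_of_mem (by rwa [hω])]
      rw [this]
      exact ih x
    · rw [mul_condWalk_real hx0 (measurableSet_entersAtBy A y N) fun ω hω =>
        entersAtBy_shift (by rwa [hω]) hy N]
      exact (avg_le_avg fun e _ => ih (x + e)).trans (avg_green_le x y hx0)

theorem mul_condWalk_real_entersAt_le {A : Finset (ℤ × ℤ)} {y : ℤ × ℤ}
    (hy : y ∈ A) (x : ℤ × ℤ) :
    potentialKernel x * (condWalk x).real (entersAt A y) ≤ green x y :=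
  le_of_tendsto ((tendsto_entersAtBy A x y).const_mul (potentialKernel x))
    (Eventually.of_forall fun N => mul_condWalk_real_entersAtBy_le hy N x)

/-- The hitting probabilities of the killed walk, obtained from those of the conditioned walk. -/
noncomputable def condHit (A : Finset (ℤ × ℤ)) (y x : ℤ × ℤ) : ℝ :=
  potentialKernel x * (condWalk x).real (entersAt A y) / potentialKernel y

theorem isHittingKernel_condHit {A : Finset (ℤ × ℤ)} (h0 : (0 : ℤ × ℤ) ∉ A) :
    IsHittingKernel A (condHit A) where
  zero_notMem := h0
  nonneg y _ x := div_nonneg (mul_nonneg (potentialKernel_nonneg x) measureReal_nonneg)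
    (potentialKernel_nonneg y)
  bounded y hy := by
    refine ⟨2, fun x => ?_⟩
    have hpos := potentialKernel_pos (x := y) fun h => h0 (h ▸ hy)
    rw [condHit, div_le_iff₀ hpos]
    exact (mul_condWalk_real_entersAt_le hy x).trans (green_le x y)
  harmonic y hy x hx hx0 := by
    have h1 := mul_condWalk_real hx0 (measurableSet_entersAt A y)
      (fun ω hω => entersAt_shift (by rwa [hω]) hy)
    rw [condHit, h1]
    unfold condHit avg
    ring
  of_mem y hy x hx := by
    have hpos := potentialKernel_pos (x := y) fun h => h0 (h ▸ hy)
    rw [condHit, condWalk_real_entersAt_of_mem hx]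
    split_ifs with h
    · rw [h, mul_one, div_self hpos.ne']
    · rw [mul_zero, zero_div]
  of_zero y _ := by rw [condHit, potentialKernel_zero, zero_mul, zero_div]

theorem mul_condWalk_real_meets {A : Finset (ℤ × ℤ)} (h0 : (0 : ℤ × ℤ) ∉ A) (x : ℤ × ℤ) :
    potentialKernel x * (condWalk x).real (meets A) = hitMean A (condHit A) x := by
  rw [condWalk, real_meets, hitMean, Finset.mul_sum]
  refine Finset.sum_congr rfl fun y hy => ?_
  have hpos := potentialKernel_pos (x := y) fun h => h0 (h ▸ hy)
  rw [condHit, div_mul_cancel₀ _ hpos.ne']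
  rfl

/-- After one step from y the weighted escape probability is a(w)(1 - P̂_w[meet A]) = a(w) -
`hitMean`, that is, `escape`. -/
theorem mul_condEs {A : Finset (ℤ × ℤ)} (h0 : (0 : ℤ × ℤ) ∉ A) {y : ℤ × ℤ} (hy : y ∈ A) :
    potentialKernel y * condEs A y = harmMeas A (condHit A) y := by
  rw [condEs, if_pos hy, mul_condWalk_real (fun h => h0 (h ▸ hy)) (measurableSet_meets A).compl
    fun ω _ => hittingTime_eq_top A ω, harmMeas]
  refine avg_congr fun e _ => ?_
  have : (condWalk (y + e)).real (meets A)ᶜ = 1 - (condWalk (y + e)).real (meets A) := by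
    unfold condWalk
    exact probReal_compl_eq_one_sub (measurableSet_meets A)
  rw [this, mul_sub, mul_one, mul_condWalk_real_meets h0, escape]

theorem condCap_eq {A : Finset (ℤ × ℤ)} (h0 : (0 : ℤ × ℤ) ∉ A) :
    condCap A = harmMass A (condHit A) :=
  Finset.sum_congr rfl fun y hy => by rw [← mul_condEs h0 hy]; ring

theorem condHm_eq {A : Finset (ℤ × ℤ)} (h0 : (0 : ℤ × ℤ) ∉ A) {y : ℤ × ℤ} (hy : y ∈ A) :
    condHm A y = potentialKernel y * harmMeas A (condHit A) y / harmMass A (condHit A) := by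
  rw [condHm, condCap_eq h0, ← mul_condEs h0 hy]; ring

theorem condEntrance_eq {A : Finset (ℤ × ℤ)} (h0 : (0 : ℤ × ℤ) ∉ A) {x y : ℤ × ℤ} (hx : x ≠ 0)
    (hy : y ∈ A) :
    condEntrance A x y = potentialKernel y * condHit A y x / hitMean A (condHit A) x := by
  have hpos := potentialKernel_pos (x := y) fun h => h0 (h ▸ hy)
  have hposx := potentialKernel_pos hx
  rw [condEntrance, entranceTime_lt_top, measureReal_def, cond_apply (measurableSet_meets A),
    ENNReal.toReal_mul, ENNReal.toReal_inv, ← measureReal_def, ← measureReal_def,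
    meets_inter_stoppedValue A hy, ← mul_condWalk_real_meets h0, condHit]
  field_simp

/-! ### Euclidean distances -/

theorem sq_dist_toPlane (x y : ℤ × ℤ) : dist (toPlane x) (toPlane y) ^ 2 =
    ((x.1 - y.1 : ℤ) : ℝ) ^ 2 + ((x.2 - y.2 : ℤ) : ℝ) ^ 2 := by
  rw [EuclideanSpace.dist_eq, Real.sq_sqrt (Finset.sum_nonneg fun _ _ => sq_nonneg _)]
  simp [toPlane, Real.dist_eq, sq_abs]

theorem nrm_le_dist_toPlane (x y : ℤ × ℤ) : (nrm (x - y) : ℝ) ≤ dist (toPlane x) (toPlane y) := by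
  refine le_of_pow_le_pow_left₀ two_ne_zero dist_nonneg ?_
  rw [sq_dist_toPlane]
  have h1 := sq_nonneg ((x.1 - y.1 : ℤ) : ℝ)
  have h2 := sq_nonneg ((x.2 - y.2 : ℤ) : ℝ)
  unfold nrm
  rcases le_total (x - y).1.natAbs (x - y).2.natAbs with h | h
  · rw [max_eq_right h, Nat.cast_natAbs, Int.cast_abs, sq_abs]
    simpa using h1
  · rw [max_eq_left h, Nat.cast_natAbs, Int.cast_abs, sq_abs]
    simpa using h2

theorem dist_toPlane_le (x y : ℤ × ℤ) :
    dist (toPlane x) (toPlane y) ≤ 3 / 2 * (nrm (x - y) : ℝ) := by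
  refine le_of_pow_le_pow_left₀ two_ne_zero (by positivity) ?_
  rw [sq_dist_toPlane]
  have key : ∀ n : ℤ, n.natAbs ≤ nrm (x - y) → (n : ℝ) ^ 2 ≤ (nrm (x - y) : ℝ) ^ 2 := by
    intro n hn
    rw [← sq_abs, ← Int.cast_abs, ← Nat.cast_natAbs]
    gcongr
  have h1 := key (x.1 - y.1) (le_max_left _ _)
  have h2 := key (x.2 - y.2) (le_max_right _ _)
  nlinarith [sq_nonneg (nrm (x - y) : ℝ)]

theorem nrm_le_latticeDiam {A : Finset (ℤ × ℤ)} {y z : ℤ × ℤ} (hy : y ∈ A) (hz : z ∈ A) :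
    (nrm (y - z) : ℝ) ≤ latticeDiam A :=
  (nrm_le_dist_toPlane y z).trans (Metric.dist_le_diam_of_mem
    (A.finite_toSet.image toPlane).isBounded (Set.mem_image_of_mem _ hy) (Set.mem_image_of_mem _ hz))

theorem latticeDist_le (x : ℤ × ℤ) {A : Finset (ℤ × ℤ)} {z : ℤ × ℤ} (hz : z ∈ A) :
    latticeDist x A ≤ 3 / 2 * (nrm (x - z) : ℝ) :=
  (Metric.infDist_le_dist_of_mem (Set.mem_image_of_mem _ hz)).trans (dist_toPlane_le x z)

/-! ### The main theorem -/

theorem theorem2 :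
    ∃ C : ℝ, ∀ (A : Finset (ℤ × ℤ)) (x : ℤ × ℤ), (0 : ℤ × ℤ) ∉ A → x ≠ 0 → x ∉ A →
      12 * (latticeDiam A + 1) ≤ latticeDist x A →
      ∀ y ∈ A, ∃ ε : ℝ, |ε| ≤ C * (latticeDiam A / latticeDist x A) ∧
        condEntrance A x y = condHm A y * (1 + ε) := by
  obtain ⟨C, hC, hfar⟩ := exists_abs_sub_le_of_far
  refine ⟨3 / 2 * C, fun A x h0 hx0 _ hdist y hy => ?_⟩
  have H := isHittingKernel_condHit h0
  have hM := H.harmMass_pos ⟨y, hy⟩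
  have hT := H.hitMean_pos ⟨y, hy⟩ hx0
  have hμ := H.harmMeas_nonneg y
  have hay := potentialKernel_pos (H.ne_zero hy)
  have hdiam : 0 ≤ latticeDiam A := Metric.diam_nonneg
  have hdist0 : 0 < latticeDist x A := by linarith
  have hratio : 0 ≤ 3 / 2 * C * (latticeDiam A / latticeDist x A) :=
    mul_nonneg (by linarith) (div_nonneg hdiam hdist0.le)
  rw [condEntrance_eq h0 hx0 hy, condHm_eq h0 hy]
  obtain ⟨z, hz, hzmax⟩ := A.exists_max_image (fun z => nrm (z - y)) ⟨y, hy⟩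
  set d := nrm (z - y) with hd
  have hAd : A ⊆ box y d := fun t ht => mem_box.2 (hzmax t ht)
  -- A singleton has diameter 0 and allows no error; both sides are then equal to 1.
  rcases Nat.eq_zero_or_pos d with hd0 | hdpos
  · have hAy : A = {y} := by
      refine Finset.eq_singleton_iff_unique_mem.2 ⟨hy, fun t ht => ?_⟩
      have := mem_box.1 (hAd ht)
      exact sub_eq_zero.1 (nrm_eq_zero.1 (by omega))
    refine ⟨0, by simpa using hratio, ?_⟩
    have e1 : hitMean A (condHit A) x = potentialKernel y * condHit A y x := by
      rw [hitMean]
      nth_rw 1 [hAy]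
      rw [Finset.sum_singleton, mul_comm]
    have e2 : harmMass A (condHit A) = potentialKernel y * harmMeas A (condHit A) y := by
      rw [harmMass]
      nth_rw 1 [hAy]
      rw [Finset.sum_singleton]
    rw [← e1, ← e2, div_self hT.ne', div_self hM.ne']
    norm_num
  · have hdA : (d : ℝ) ≤ latticeDiam A := nrm_le_latticeDiam hz hy
    have hD := latticeDist_le x hy
    -- The Euclidean distance is at most 3/2 times the sup norm, which turns the factor 12 of the
    -- hypothesis into 8.
    have hD8 : 8 * (d + 1) ≤ nrm (x - y) := by
      have : (8 * (d + 1) : ℝ) ≤ nrm (x - y) := by linarith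
      exact_mod_cast this
    have hD0 : (0 : ℝ) < nrm (x - y) := by exact_mod_cast (by omega : 0 < nrm (x - y))
    have hmain := hfar A _ H y x d hy hdpos hAd hD8 y hy
    have hle : C * ((d : ℝ) / nrm (x - y)) ≤ 3 / 2 * C * (latticeDiam A / latticeDist x A) := by
      have : (d : ℝ) / nrm (x - y) ≤ 3 / 2 * (latticeDiam A / latticeDist x A) := by
        rw [mul_div_assoc', div_le_div_iff₀ hD0 hdist0]
        have := mul_le_mul hdA hD hdist0.le hdiam
        linarith
      nlinarith
    -- A site of zero harmonic measure cannot be handled by division, but the estimate then forces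
    -- its entrance probability to be 0.
    rcases hμ.eq_or_lt with hμ0 | hμpos
    · refine ⟨0, by simpa using hratio, ?_⟩
      rw [← hμ0, zero_mul, mul_zero, sub_zero] at hmain
      have e1 := abs_nonpos_iff.1 hmain
      rw [(mul_eq_zero.1 e1).resolve_right hM.ne', ← hμ0]
      simp
    · refine ⟨(condHit A y x * harmMass A (condHit A) -
        harmMeas A (condHit A) y * hitMean A (condHit A) x) /
          (harmMeas A (condHit A) y * hitMean A (condHit A) x), ?_, ?_⟩
      · have hpos := mul_pos hμpos hT
        rw [abs_div, abs_of_pos hpos, div_le_iff₀ hpos]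
        exact hmain.trans (mul_le_mul_of_nonneg_right hle hpos.le)
      · have := hμpos.ne'
        have := hT.ne'
        have := hM.ne'
        field_simp
        ring
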